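/- Let $\mathbb K$ be a field of characteristic $0$ and $\mathbb K\text{-Mod}$ the category of all $\mathbb K$-vector spaces. For a $\mathbb K$-linear category $\mathcal C$ let $\mathcal C\text{-Mod}$ be the category of $\mathbb K$-linear functors $\mathcal C\to\mathbb K\text{-Mod}$; a $(\mathcal C,\mathcal D)$-bimodule is a $\mathbb K$-linear functor $\mathcal D^{op}\otimes\mathcal C\to\mathbb K\text{-Mod}$. *Categories.* (i) $\mathbb K\mathbf{gr}^{op}$ is the $\mathbb K$-linearization of the opposite of the category of finitely generated free groups; its objects are the $n\ge 0$, and a morphism $m\to n$ of $\mathbf{gr}^{op}$ is a homomorphism $F_n\to F_m$, $F_n$ being free on $x_1,\dots,x_n$. (ii) $\mathrm{Cat}_{Ass}$ is the $\mathbb K$-linear PROP of unital associative algebras: $\mathrm{Cat}_{Ass}(m,n)$ has as basis the $n$-tuples of words in $1,\dots,m$ in which every letter occurs exactly once in total (the tuple is the operation $a_1\otimes\dots\otimes a_m\mapsto$ tensor product of the products spelled by the words), with composition by substitution. It is mapped to $\mathbb K\mathbf{gr}^{op}$ by sending $(w_1,\dots,w_n)$ to $F_n\to F_m$, $x_k\mapsto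 w_k$. (iii) $\mathrm{Cat}_{Lie}$ is the $\mathbb K$-linear PROP of Lie algebras: $\mathrm{Cat}_{Lie}(m,n)$ is spanned by $n$-tuples of rooted binary (trivalent) trees with leaves labelled bijectively by $1,\dots,m$, modulo AS and IHX, with composition by grafting; $\iota:\mathrm{Cat}_{Lie}\to\mathrm{Cat}_{Ass}$ sends the bracket to the commutator. *Powell's bimodule* ${}_\Delta\mathrm{Cat}_{Ass}$ is the $(\mathbb K\mathbf{gr}^{op},\mathrm{Cat}_{Lie})$-bimodule with values $\mathrm{Cat}_{Ass}(m,n)$, where $\mathrm{Cat}_{Lie}$ acts by precomposition with $\iota(-)$, and $\mathbb K\mathbf{gr}^{op}$ acts as follows on its generators: $\mu,\eta$ and permutations by postcomposition, $\Delta$ by the sum over all unshuffles of a word into two words, $\varepsilon$ by $1$ on the empty word and $0$ on all other words, $S$ by reversing a word of length $p$ and multiplying by $(-1)^p$. *The bimodule of diagrams.* $A^L_0(L^{\otimes m},H^{\otimes n})$ is the vector space spanned by the diagrams consisting of rooted trivalent trees whose leaves are attached bijectively to $m$ points on an upper line and whose roots are attached to $n$ oriented arcs (considered up to the order of the roots on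 each arc), modulo AS, IHX and the STU relation, i.e. $i[\,,]=-\mu(i\otimes i)+\mu P(i\otimes i)$ for the chord $i:L\to H$. $\mathbb K\mathbf{gr}^{op}$ acts by cabling of the arcs (an arc runs along copies and reversed copies of the old arcs; each root is put in all possible ways on one of the copies of its arc, with sign $-1$ on a reversed copy), and $\mathrm{Cat}_{Lie}$ acts by grafting on the leaves. A chord diagram is a diagram all of whose trees are trivial. Then: 1. For all $m,n\ge0$ the map $i^*_m:\mathrm{Cat}_{Ass}(m,n)\to A^L_0(L^{\otimes m},H^{\otimes n})$, $f\mapsto f\circ i^{\otimes m}$, is bijective; the chord diagrams form a basis of $A^L_0(L^{\otimes m},H^{\otimes n})$, and $i^*_m$ maps the basis of tuples of words bijectively to this basis (the tuple $(w_1,\dots,w_n)$ goes to the diagram whose chords end on the $k$-th arc in the order $w_k$). The maps $i_m^*$ are morphisms of $\mathrm{Cat}_{Ass}$-modules: $i^*_m(g\circ f)=g\cdot i^*_m(f)$ for $f\in\mathrm{Cat}_{Ass}(m,n)$, $g\in \mathrm{Cat}_{Ass}(n,p)$. 2. The maps $(-1)^m\, i^*_m$ form an isomorphism $e:{}_\Delta\mathrm{Cat}_{Ass}\cong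 A^L_0(L^{\otimes-},H^{\otimes-})$ of $(\mathbb K\mathbf{gr}^{op},\mathrm{Cat}_{Lie})$-bimodules. It induces isomorphisms of functors ${}_\Delta\mathrm{Cat}_{Ass}\otimes_{\mathrm{Cat}_{Lie}}-\;\cong A^L_0(L^{\otimes-},H^{\otimes-})\otimes_{\mathrm{Cat}_{Lie}}-$, $b\otimes y\mapsto e(b)\otimes y$, and $\mathrm{Hom}_{\mathbb K\mathbf{gr}^{op}\text{-Mod}}({}_\Delta\mathrm{Cat}_{Ass},-)\cong\mathrm{Hom}_{\mathbb K\mathbf{gr}^{op}\text{-Mod}}(A^L_0(L^{\otimes-},H^{\otimes-}),-)$, $\varphi\mapsto\varphi\circ e^{-1}$. 3. For each of the two bimodules $B={}_\Delta\mathrm{Cat}_{Ass}$ and $B=A^L_0(L^{\otimes-},H^{\otimes-})$, the functor $B\otimes_{\mathrm{Cat}_{Lie}}-:\mathrm{Cat}_{Lie}\text{-Mod}\to\mathbb K\mathbf{gr}^{op}\text{-Mod}$ is left adjoint to $\mathrm{Hom}_{\mathbb K\mathbf{gr}^{op}\text{-Mod}}(B,-)$ by the usual hom-tensor adjunction $f\mapsto(y\mapsto(b\mapsto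 f(b\otimes y)))$. This adjunction restricts to an equivalence $\mathrm{Cat}_{Lie}\text{-Mod}\simeq\mathbb K\mathbf{gr}^{op}\text{-Mod}^{\omega}$ with the full subcategory of analytic functors: $B\otimes_{\mathrm{Cat}_{Lie}}M$ is analytic for all $M$, both restricted functors are equivalences, the unit is an isomorphism at all $M$, and the counit is an isomorphism at all analytic functors. Here a functor $N$ on $\mathbf{gr}^{op}$ is polynomial of degree at most $d$ if its cross effects of order $d+1$ vanish (an element of $N(F_n)$ is zero if, for some decomposition of the set of generators into $d+1$ blocks, it is killed by each of the $d+1$ endomorphisms of $F_n$ that kill the generators in one block and fix the others), and $N$ is analytic if it is the colimit, i.e. the union, of its polynomial subfunctors. -/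

import Mathlib

open CategoryTheory
universe u

set_option linter.unusedSectionVars false

namespace JacobiDiagrams


/-- Every letter of `I` occurs exactly once in total in the words `w k`. -/
def EachOnce {κ I : Type} [Fintype κ] [DecidableEq I] (w : κ → List I) : Prop :=
  ∀ a, ∑ k, (w k).count a = 1

section EachOnceFacts
variable {κ I J : Type} [Fintype κ] [DecidableEq I] [DecidableEq J]

theorem EachOnce.flatMap [Fintype I] {w : κ → List I} (hw : EachOnce w) {v : I → List J}
    (hv : EachOnce v) : EachOnce fun k => (w k).flatMap v := by
  intro b
  have h : ∀ l : List I, (l.flatMap v).count b = ∑ i, l.count i * (v i).count b := by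
    intro l
    rw [List.count_flatMap, Finset.sum_list_map_count]
    simp only [Function.comp, smul_eq_mul]
    refine Finset.sum_subset (Finset.subset_univ _) fun i _ hi => ?_
    rw [List.count_eq_zero_of_not_mem (by simpa using hi), zero_mul]
  simp only [h]
  rw [Finset.sum_comm]
  simp only [← Finset.sum_mul, hw _, one_mul, hv b]

theorem EachOnce.singleton [DecidableEq κ] : EachOnce fun i : κ => [i] := by
  intro a
  simp [List.count_singleton]

theorem EachOnce.nodup {w : κ → List I} (hw : EachOnce w) (k : κ) : (w k).Nodup := by
  rw [List.nodup_iff_count_le_one]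
  intro a
  rw [← hw a]
  exact Finset.single_le_sum (f := fun k => (w k).count a) (fun _ _ => Nat.zero_le _)
    (Finset.mem_univ k)

theorem EachOnce.exists_mem {w : κ → List I} (hw : EachOnce w) (a : I) : ∃ k, a ∈ w k := by
  by_contra! h
  have := hw a
  simp [List.count_eq_zero_of_not_mem (h _)] at this

theorem EachOnce.unique {w : κ → List I} (hw : EachOnce w) {a : I} {k l : κ}
    (hk : a ∈ w k) (hl : a ∈ w l) : k = l := by
  classical
  by_contra h
  have h1 := hw a
  have h2 : ∑ j ∈ {k, l}, (w j).count a ≤ ∑ j, (w j).count a :=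
    Finset.sum_le_sum_of_subset (Finset.subset_univ _)
  rw [Finset.sum_pair h, h1] at h2
  have := List.count_pos_iff.2 hk
  have := List.count_pos_iff.2 hl
  omega

theorem EachOnce.of_unique {w : κ → List I} (hn : ∀ k, (w k).Nodup)
    (he : ∀ a, ∃ k, a ∈ w k) (hu : ∀ a k l, a ∈ w k → a ∈ w l → k = l) : EachOnce w := by
  classical
  intro a
  obtain ⟨k, hk⟩ := he a
  rw [Finset.sum_eq_single k]
  · exact List.count_eq_one_of_mem (hn k) hk
  · intro l _ hl
    exact List.count_eq_zero_of_not_mem fun h => hl (hu a l k h hk)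
  · simp

theorem EachOnce.map {w : κ → List I} (hw : EachOnce w) {f : I → J} (hf : f.Bijective) :
    EachOnce fun k => (w k).map f := by
  intro b
  obtain ⟨a, rfl⟩ := hf.2 b
  simpa only [List.count_map_of_injective _ _ hf.1] using hw a

end EachOnceFacts

/-- `n`-tuples of words in which every letter of `I` occurs exactly once: a map from `I` to
`{1, …, n}` together with a linear ordering of each of its fibres. -/
def WordTuple (I : Type) [DecidableEq I] (n : ℕ) : Type :=
  {w : Fin n → List I // EachOnce w}

instance (I : Type) [Fintype I] [DecidableEq I] (n : ℕ) : Finite (WordTuple I n) := by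
  refine Finite.of_injective (β := Fin n → {l : List I // l.Nodup})
    (fun w k => ⟨w.1 k, w.2.nodup k⟩) fun v w h => Subtype.ext <| funext fun k => ?_
  exact congrArg Subtype.val (congrFun h k)

noncomputable instance (I : Type) [Fintype I] [DecidableEq I] (n : ℕ) :
    Fintype (WordTuple I n) := Fintype.ofFinite _

instance (I : Type) [DecidableEq I] (n : ℕ) : DecidableEq (WordTuple I n) :=
  inferInstanceAs (DecidableEq {w : Fin n → List I // EachOnce w})

/-- The number of occurrences of `v` as a subsequence of the word `L` in the letters
`x_a = (a, true)` and `x_a⁻¹ = (a, false)`, each occurrence counted with the sign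
`(-1) ^ (number of inverse letters it uses)`. -/
def signedCount {I : Type} [DecidableEq I] : List (I × Bool) → List I → ℤ
  | _, [] => 1
  | [], _ :: _ => 0
  | x :: L, a :: v =>
      signedCount L (a :: v) + if x.1 = a then (if x.2 then 1 else -1) * signedCount L v else 0

section SignedCount
variable {I : Type} [DecidableEq I]

@[simp] theorem signedCount_nil (L : List (I × Bool)) : signedCount L [] = 1 := by
  cases L <;> rfl

theorem signedCount_cons (x : I × Bool) (L : List (I × Bool)) (a : I) (v : List I) :
    signedCount (x :: L) (a :: v) =
      signedCount L (a :: v) +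
        if x.1 = a then (if x.2 then 1 else -1) * signedCount L v else 0 := rfl

theorem signedCount_cons_of_ne (x : I × Bool) (L : List (I × Bool)) (v : List I)
    (h : x.1 ∉ v) : signedCount (x :: L) v = signedCount L v := by
  cases v with
  | nil => simp
  | cons b v =>
    rw [signedCount_cons, if_neg (by simp at h; exact h.1), add_zero]

theorem signedCount_step {L₁ L₂ : List (I × Bool)} (h : FreeGroup.Red.Step L₁ L₂) {v : List I}
    (hv : v.Nodup) : signedCount L₁ v = signedCount L₂ v := by
  obtain ⟨⟩ := h
  rename_i P Q a s
  induction P generalizing v with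
  | nil =>
    cases v with
    | nil => simp
    | cons b v =>
      simp only [List.nil_append, signedCount_cons]
      by_cases hab : a = b
      · subst hab
        rw [signedCount_cons_of_ne _ _ _ (List.nodup_cons.1 hv).1]
        cases s <;> simp
      · simp [hab]
  | cons x P ih =>
    cases v with
    | nil => simp
    | cons b v =>
      simp only [List.cons_append, signedCount_cons, ih hv, ih (List.nodup_cons.1 hv).2]

theorem signedCount_toWord (L : List (I × Bool)) {v : List I} (hv : v.Nodup) :
    signedCount (FreeGroup.mk L).toWord v = signedCount L v := by
  have h : FreeGroup.Red L (FreeGroup.mk L).toWord := by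
    rw [FreeGroup.toWord_mk]; exact FreeGroup.reduce.red
  generalize (FreeGroup.mk L).toWord = L' at h
  induction h with
  | refl => rfl
  | tail _ h ih => rw [← ih, signedCount_step h hv]

/-- `z := a`, `z := 1` and (`z := a`, `a := 1`), for an extra letter `z = none`. -/
def subBoth (a : I) : FreeGroup (Option I) →* FreeGroup I :=
  FreeGroup.lift fun o => o.elim (FreeGroup.of a) FreeGroup.of

/-- See `subBoth`. -/
def subKill : FreeGroup (Option I) →* FreeGroup I :=
  FreeGroup.lift fun o => o.elim 1 FreeGroup.of

/-- See `subBoth`. -/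
def subMove (a : I) : FreeGroup (Option I) →* FreeGroup I :=
  FreeGroup.lift fun o => o.elim (FreeGroup.of a) fun i => if i = a then 1 else FreeGroup.of i

def wordBoth (a : I) (W : List (Option I × Bool)) : List (I × Bool) :=
  W.map fun x => (x.1.getD a, x.2)

def wordKill (W : List (Option I × Bool)) : List (I × Bool) :=
  W.filterMap fun x => x.1.map fun i => (i, x.2)

def wordMove (a : I) (W : List (Option I × Bool)) : List (I × Bool) :=
  W.filterMap fun x => if x.1 = some a then none else some (x.1.getD a, x.2)

theorem mk_cons' {α : Type} (x : α × Bool) (L : List (α × Bool)) :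
    FreeGroup.mk (x :: L) = FreeGroup.mk [x] * FreeGroup.mk L := by
  rw [FreeGroup.mul_mk]; rfl

theorem mk_single {α : Type} (x : α × Bool) :
    FreeGroup.mk [x] = if x.2 then FreeGroup.of x.1 else (FreeGroup.of x.1)⁻¹ := by
  obtain ⟨a, s⟩ := x
  cases s <;> simp [FreeGroup.of, FreeGroup.inv_mk, FreeGroup.invRev]

theorem lift_mk_single {α G : Type} [Group G] (f : α → G) (x : α × Bool) :
    FreeGroup.lift f (FreeGroup.mk [x]) = if x.2 then f x.1 else (f x.1)⁻¹ := by
  rw [mk_single]; split_ifs <;> simp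

theorem subBoth_mk (a : I) (W : List (Option I × Bool)) :
    subBoth a (FreeGroup.mk W) = FreeGroup.mk (wordBoth a W) := by
  induction W with
  | nil => rw [← FreeGroup.one_eq_mk, map_one]; rfl
  | cons x W ih =>
    rw [mk_cons', map_mul, ih]
    rw [show wordBoth a (x :: W) = (x.1.getD a, x.2) :: wordBoth a W from rfl,
      mk_cons' (x.1.getD a, x.2)]
    congr 1
    rw [subBoth, lift_mk_single, mk_single]
    obtain ⟨_ | i, s⟩ := x <;> rfl

theorem subKill_mk (W : List (Option I × Bool)) :
    (subKill (FreeGroup.mk W) : FreeGroup I) = FreeGroup.mk (wordKill W) := by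
  induction W with
  | nil => rw [← FreeGroup.one_eq_mk, map_one]; rfl
  | cons x W ih =>
    rw [mk_cons', map_mul, ih, subKill, lift_mk_single]
    obtain ⟨_ | i, s⟩ := x
    · simp [wordKill]
    · rw [show wordKill ((some i, s) :: W) = (i, s) :: wordKill W from rfl, mk_cons' (_, _),
        mk_single]
      rfl

theorem subMove_mk (a : I) (W : List (Option I × Bool)) :
    subMove a (FreeGroup.mk W) = FreeGroup.mk (wordMove a W) := by
  induction W with
  | nil => rw [← FreeGroup.one_eq_mk, map_one]; rfl
  | cons x W ih =>
    rw [mk_cons', map_mul, ih, subMove, lift_mk_single]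
    by_cases hx : x.1 = some a
    · simp [wordMove, hx]
    · rw [show wordMove a (x :: W) = (x.1.getD a, x.2) :: wordMove a W by
        simp [wordMove, hx], mk_cons' (_, _), mk_single]
      obtain ⟨_ | i, s⟩ := x
      · rfl
      · have hi : i ≠ a := fun h => hx (by rw [h])
        simp only [Option.elim, if_neg hi, Option.getD]

theorem signedCount_avoid (a : I) (W : List (Option I × Bool)) {v : List I} (hv : a ∉ v) :
    signedCount (wordBoth a W) v = signedCount (wordKill W) v ∧
      signedCount (wordMove a W) v = signedCount (wordKill W) v := by
  induction W generalizing v with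
  | nil => exact ⟨rfl, rfl⟩
  | cons x W ih =>
    obtain ⟨_ | i, s⟩ := x
    · refine ⟨?_, ?_⟩
      · exact (signedCount_cons_of_ne _ _ _ hv).trans (ih hv).1
      · exact (signedCount_cons_of_ne _ _ _ hv).trans (ih hv).2
    · cases v with
      | nil => simp
      | cons b v =>
        have h1 := ih hv
        have h2 := ih (v := v) (fun h => hv (List.mem_cons_of_mem _ h))
        refine ⟨?_, ?_⟩
        · show signedCount ((i, s) :: wordBoth a W) _ = signedCount ((i, s) :: wordKill W) _
          rw [signedCount_cons, signedCount_cons, h1.1, h2.1]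
        · by_cases hi : i = a
          · subst hi
            rw [show wordMove i ((some i, s) :: W) = wordMove i W by simp [wordMove], h1.2]
            exact (signedCount_cons_of_ne (i, s) (wordKill W) _ hv).symm
          · rw [show wordMove a ((some i, s) :: W) = (i, s) :: wordMove a W by
              simp [wordMove, hi]]
            show _ = signedCount ((i, s) :: wordKill W) _
            rw [signedCount_cons, signedCount_cons, h1.2, h2.2]

theorem signedCount_primitive (a : I) (W : List (Option I × Bool)) {v : List I} (hv : v.Nodup)
    (ha : a ∈ v) :
    signedCount (wordBoth a W) v =
      signedCount (wordKill W) v + signedCount (wordMove a W) v := by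
  induction W generalizing v with
  | nil =>
    cases v with
    | nil => simp at ha
    | cons b v => rfl
  | cons x W ih =>
    cases v with
    | nil => simp at ha
    | cons b v =>
      obtain ⟨hb, hv'⟩ := List.nodup_cons.1 hv
      have h1 := ih hv ha
      obtain ⟨_ | i, s⟩ := x
      · show signedCount ((a, s) :: wordBoth a W) _ = signedCount (wordKill W) _ +
          signedCount ((a, s) :: wordMove a W) _
        rw [signedCount_cons, signedCount_cons, h1]
        by_cases hab : a = b
        · subst hab
          simp only [if_true, (signedCount_avoid a W hb).1, (signedCount_avoid a W hb).2]
          ring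
        · simp only [if_neg hab]; ring
      · show signedCount ((i, s) :: wordBoth a W) _ = signedCount ((i, s) :: wordKill W) _ + _
        by_cases hi : i = a
        · subst hi
          rw [show wordMove i ((some i, s) :: W) = wordMove i W by simp [wordMove],
            signedCount_cons, signedCount_cons, h1]
          by_cases hib : i = b
          · subst hib
            simp only [if_true, (signedCount_avoid i W hb).1]
            ring
          · simp only [if_neg hib]; ring
        · rw [show wordMove a ((some i, s) :: W) = (i, s) :: wordMove a W by
              simp [wordMove, hi], signedCount_cons, signedCount_cons, signedCount_cons, h1]
          by_cases hib : i = b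
          · subst hib
            have ha' : a ∈ v := by
              rcases List.mem_cons.1 ha with h | h
              · exact absurd h.symm hi
              · exact h
            simp only [if_true, ih hv' ha']
            ring
          · simp only [if_neg hib]; ring

/-- The coefficient of `v` in the multilinear part of the tuple `g` of group words. -/
def multCoeff {n : ℕ} (g : Fin n → FreeGroup I) (v : Fin n → List I) : ℤ :=
  ∏ k, signedCount (g k).toWord (v k)

theorem multCoeff_mk {n : ℕ} (G : Fin n → List (I × Bool)) {v : Fin n → List I}
    (hv : EachOnce v) :
    multCoeff (fun k => FreeGroup.mk (G k)) v = ∏ k, signedCount (G k) (v k) :=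
  Finset.prod_congr rfl fun k _ => signedCount_toWord _ (hv.nodup k)

theorem multCoeff_primitive {n : ℕ} (a : I) (h : Fin n → FreeGroup (Option I))
    {v : Fin n → List I} (hv : EachOnce v) :
    multCoeff (fun k => subBoth a (h k)) v =
      multCoeff (fun k => subKill (h k)) v + multCoeff (fun k => subMove a (h k)) v := by
  obtain ⟨W, rfl⟩ : ∃ W : Fin n → List (Option I × Bool), h = fun k => FreeGroup.mk (W k) :=
    ⟨fun k => (h k).toWord, funext fun k => FreeGroup.mk_toWord.symm⟩
  simp only [subBoth_mk, subKill_mk, subMove_mk, multCoeff_mk _ hv]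
  obtain ⟨k, hk⟩ := hv.exists_mem a
  rw [← Finset.mul_prod_erase _ _ (Finset.mem_univ k),
    ← Finset.mul_prod_erase _ _ (Finset.mem_univ k),
    ← Finset.mul_prod_erase _ _ (Finset.mem_univ k),
    signedCount_primitive a (W k) (hv.nodup k) hk, add_mul]
  have h0 : ∀ j ∈ Finset.univ.erase k, a ∉ v j := fun j hj hm =>
    (Finset.mem_erase.1 hj).1 (hv.unique hm hk)
  congr 2
  · exact Finset.prod_congr rfl fun j hj => (signedCount_avoid a (W j) (h0 j hj)).1
  · exact Finset.prod_congr rfl fun j hj => (signedCount_avoid a (W j) (h0 j hj)).1.trans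
      (signedCount_avoid a (W j) (h0 j hj)).2.symm

end SignedCount

section Taylor
variable {I : Type} [DecidableEq I] {n : ℕ}

/-- The tuple of positive group elements spelled by a tuple of words. -/
def spell (u : Fin n → List I) (k : Fin n) : FreeGroup I :=
  ((u k).map FreeGroup.of).prod

theorem list_prod_of (l : List I) :
    (l.map FreeGroup.of).prod = FreeGroup.mk (l.map fun a => (a, true)) := by
  induction l with
  | nil => rfl
  | cons a l ih =>
    rw [List.map_cons, List.prod_cons, ih, List.map_cons, mk_cons' (a, true), mk_single]; rfl

theorem signedCount_positive {l v : List I} (hl : l.Nodup) :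
    signedCount (l.map fun a => (a, true)) v = if v.Sublist l then 1 else 0 := by
  induction l generalizing v with
  | nil =>
    cases v with
    | nil => simp
    | cons b v => simp [signedCount]
  | cons a l ih =>
    obtain ⟨ha, hl⟩ := List.nodup_cons.1 hl
    cases v with
    | nil => simp
    | cons b v =>
      rw [List.map_cons, signedCount_cons, ih hl, ih hl]
      by_cases hab : a = b
      · subst hab
        have : ¬ (a :: v).Sublist l := fun h => ha (h.subset (List.mem_cons_self))
        simp [this]
      · have : (b :: v).Sublist (a :: l) ↔ (b :: v).Sublist l := by
          constructor
          · intro h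
            cases h with
            | cons _ h => exact h
            | cons_cons _ h => exact absurd rfl hab
          · exact fun h => h.cons _
        simp [hab, this]

theorem EachOnce.sum_length [Fintype I] {w : Fin n → List I} (hw : EachOnce w) :
    ∑ k, (w k).length = Fintype.card I := by
  have h : ∀ l : List I, l.length = ∑ i, l.count i := by
    intro l
    have := List.sum_toFinset_count_eq_length l
    rw [← this]
    refine Finset.sum_subset (Finset.subset_univ _) fun i _ hi => ?_
    exact List.count_eq_zero_of_not_mem (by simpa using hi)
  simp only [h]
  rw [Finset.sum_comm]
  simp [hw _]

theorem multCoeff_spell [Fintype I] (u v : WordTuple I n) :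
    multCoeff (spell u.1) v.1 = if u = v then 1 else 0 := by
  have h : spell u.1 = fun k => FreeGroup.mk ((u.1 k).map fun a => (a, true)) :=
    funext fun k => list_prod_of _
  rw [h, multCoeff_mk _ v.2]
  simp only [signedCount_positive (u.2.nodup _)]
  split_ifs with huv
  · subst huv
    exact Finset.prod_eq_one fun k _ => if_pos (List.Sublist.refl _)
  · by_contra hne
    have h1 : ∀ k, (v.1 k).Sublist (u.1 k) := by
      intro k
      by_contra hk
      exact hne (Finset.prod_eq_zero (Finset.mem_univ k) (if_neg hk))
    have h2 : ∑ k, (v.1 k).length = ∑ k, (u.1 k).length := by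
      rw [u.2.sum_length, v.2.sum_length]
    have h3 := (Finset.sum_eq_sum_iff_of_le fun k _ => (h1 k).length_le).1 h2
    exact huv (Subtype.ext (funext fun k =>
      ((h1 k).eq_of_length (h3 k (Finset.mem_univ k))).symm))

/-- A function of `n` elements of the free group on `I` is primitive in every letter. -/
def IsPrimitive {V : Type*} [AddCommGroup V] (L : (Fin n → FreeGroup I) → V) : Prop :=
  ∀ (a : I) (h : Fin n → FreeGroup (Option I)),
    L (fun k => subBoth a (h k)) = L (fun k => subKill (h k)) + L (fun k => subMove a (h k))

theorem wordBoth_some (a : I) (W : List (I × Bool)) :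
    wordBoth a (W.map fun x => (some x.1, x.2)) = W := by
  simp [wordBoth, Function.comp_def]

theorem wordKill_some (W : List (I × Bool)) :
    wordKill (W.map fun x => (some x.1, x.2)) = W := by
  induction W with
  | nil => rfl
  | cons x W ih => exact congrArg (x :: ·) ih

theorem wordMove_some (a : I) (W : List (I × Bool)) :
    wordMove a (W.map fun x => (some x.1, x.2)) = W.filter fun x => x.1 ≠ a := by
  induction W with
  | nil => rfl
  | cons x W ih =>
    by_cases hx : x.1 = a
    · rw [List.filter_cons_of_neg (by simpa using hx), ← ih]
      simp [wordMove, hx]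
    · rw [List.filter_cons_of_pos (by simpa using hx), ← ih]
      simp [wordMove, hx]

/-- Size of a tuple of words: number of letters plus number of inverse letters. -/
def wordSize (W : List (I × Bool)) : ℕ :=
  (W.map fun x => if x.2 then 1 else 2).sum

theorem wordSize_append (V W : List (I × Bool)) :
    wordSize (V ++ W) = wordSize V + wordSize W := by simp [wordSize]

theorem wordSize_filter (p : I × Bool → Bool) (W : List (I × Bool)) :
    wordSize (W.filter p) ≤ wordSize W :=
  ((List.filter_sublist (p := p) (l := W)).map _).sum_le_sum fun _ _ => Nat.zero_le _

theorem wordSize_filter_lt (p : I × Bool → Bool) (W : List (I × Bool)) {x : I × Bool}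
    (hx : x ∈ W) (hp : ¬ p x) : wordSize (W.filter p) < wordSize W := by
  obtain ⟨P, Q, rfl⟩ := List.append_of_mem hx
  have h1 := wordSize_filter p P
  have h2 := wordSize_filter p Q
  rw [List.filter_append, List.filter_cons_of_neg hp, wordSize_append, wordSize_append]
  have : wordSize (x :: Q) = (if x.2 then 1 else 2) + wordSize Q := by simp [wordSize]
  split_ifs at this <;> omega

theorem IsPrimitive.mk_rel {V : Type*} [AddCommGroup V] {L : (Fin n → FreeGroup I) → V}
    (hL : IsPrimitive L) (a : I) (G : Fin n → List (I × Bool)) (k₀ : Fin n)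
    (H : List (Option I × Bool)) :
    L (fun k => FreeGroup.mk (Function.update G k₀ (wordBoth a H) k)) =
      L (fun k => FreeGroup.mk (Function.update G k₀ (wordKill H) k)) +
      L (fun k => FreeGroup.mk (Function.update (fun j => (G j).filter fun x => x.1 ≠ a) k₀
        (wordMove a H) k)) := by
  have := hL a fun k => FreeGroup.mk
    (Function.update (fun j => (G j).map fun x => (some x.1, x.2)) k₀ H k)
  simp only [subBoth_mk, subKill_mk, subMove_mk] at this
  convert this using 4 with k k k
  · by_cases hk : k = k₀
    · subst hk; simp
    · simp [hk, wordBoth_some]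
  · by_cases hk : k = k₀
    · subst hk; simp
    · simp [hk, wordKill_some]
  · by_cases hk : k = k₀
    · subst hk; simp
    · simp [hk, wordMove_some]

theorem IsPrimitive.eq_zero_of_avoid {V : Type*} [AddCommGroup V]
    {L : (Fin n → FreeGroup I) → V} (hL : IsPrimitive L) (a : I) (G : Fin n → List (I × Bool))
    (hG : ∀ k, ∀ x ∈ G k, x.1 ≠ a) : L (fun k => FreeGroup.mk (G k)) = 0 := by
  have := hL a fun k => FreeGroup.mk ((G k).map fun x => (some x.1, x.2))
  simp only [subBoth_mk, subKill_mk, subMove_mk, wordBoth_some, wordKill_some,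
    wordMove_some] at this
  have h2 : ∀ k, (G k).filter (fun x => decide (x.1 ≠ a)) = G k := fun k =>
    List.filter_eq_self.2 fun x hx => by simpa using hG k x hx
  simp only [h2] at this
  simpa using this

theorem IsPrimitive.eq_zero {V : Type*} [AddCommGroup V] {L : (Fin n → FreeGroup I) → V}
    (hL : IsPrimitive L) (h0 : ∀ u : WordTuple I n, L (spell u.1) = 0) (g : Fin n → FreeGroup I) :
    L g = 0 := by
  obtain ⟨G, rfl⟩ : ∃ G : Fin n → List (I × Bool), g = fun k => FreeGroup.mk (G k) :=
    ⟨fun k => (g k).toWord, funext fun k => FreeGroup.mk_toWord.symm⟩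
  induction hN : ∑ k, wordSize (G k) using Nat.strong_induction_on generalizing G with
  | _ N ih =>
  subst hN
  replace ih : ∀ G' : Fin n → List (I × Bool), (∑ k, wordSize (G' k) < ∑ k, wordSize (G k)) →
      L (fun k => FreeGroup.mk (G' k)) = 0 := fun G' h => ih _ h G' rfl
  have hlt : ∀ (k₀ : Fin n) (A : List (I × Bool)), wordSize A < wordSize (G k₀) →
      ∀ G' : Fin n → List (I × Bool), (∀ k, wordSize (G' k) ≤ wordSize (G k)) →
      ∑ k, wordSize (Function.update G' k₀ A k) < ∑ k, wordSize (G k) := by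
    intro k₀ A hA G' hG'
    refine Finset.sum_lt_sum (fun k _ => ?_) ⟨k₀, Finset.mem_univ _, by simpa using hA⟩
    by_cases hk : k = k₀
    · subst hk; simpa using hA.le
    · simpa [hk] using hG' k
  by_cases hav : ∃ a, ∀ k, ∀ x ∈ G k, x.1 ≠ a
  · obtain ⟨a, ha⟩ := hav
    exact hL.eq_zero_of_avoid a G ha
  push Not at hav
  -- a decomposition at a letter
  have key : ∀ (a : I) (s : Bool) (k₀ : Fin n) (P Q : List (I × Bool)),
      G k₀ = P ++ (a, s) :: Q →
      ((∃ k, k ≠ k₀ ∧ ∃ x ∈ G k, x.1 = a) ∨ ∃ x ∈ P ++ Q, x.1 = a) →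
      L (fun k => FreeGroup.mk (G k)) = 0 := by
    intro a s k₀ P Q hk₀ hex
    have h := hL.mk_rel a G k₀ (P.map (fun x => (some x.1, x.2)) ++
      (none, s) :: Q.map fun x => (some x.1, x.2))
    have e1 : wordBoth a (P.map (fun x => (some x.1, x.2)) ++
      (none, s) :: Q.map fun x => (some x.1, x.2)) = G k₀ := by
      rw [hk₀]
      simp [wordBoth, Function.comp_def]
    have e2 : wordKill (P.map (fun x => (some x.1, x.2)) ++
      (none, s) :: Q.map fun x => (some x.1, x.2)) = P ++ Q := by
      have h1 := wordKill_some P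
      have h2 := wordKill_some Q
      rw [wordKill] at *
      rw [List.filterMap_append, h1, List.filterMap_cons, h2]
      rfl
    have e3 : wordMove a (P.map (fun x => (some x.1, x.2)) ++
      (none, s) :: Q.map fun x => (some x.1, x.2)) =
        P.filter (fun x => x.1 ≠ a) ++ (a, s) :: Q.filter fun x => x.1 ≠ a := by
      have h1 := wordMove_some a P
      have h2 := wordMove_some a Q
      rw [wordMove] at *
      rw [List.filterMap_append, h1, List.filterMap_cons, h2]
      rfl
    rw [e1, e2, e3, Function.update_eq_self] at h
    rw [h]
    have c : ∀ R : List (I × Bool), wordSize ((a, s) :: R) = (if s then 1 else 2) + wordSize R :=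
      fun R => by simp [wordSize]
    have hs : wordSize (G k₀) = wordSize P + ((if s then 1 else 2) + wordSize Q) := by
      rw [hk₀, wordSize_append, c]
    have hs' : 1 ≤ if s then 1 else 2 := by split_ifs <;> omega
    rw [ih _ (hlt k₀ _ (by rw [wordSize_append]; omega) G fun _ => le_rfl), zero_add]
    apply ih
    have hP := wordSize_filter (fun x => decide (x.1 ≠ a)) P
    have hQ := wordSize_filter (fun x => decide (x.1 ≠ a)) Q
    rcases hex with ⟨k, hk, x, hx, hxa⟩ | ⟨x, hx, hxa⟩
    · refine Finset.sum_lt_sum (fun j _ => ?_) ⟨k, Finset.mem_univ _, ?_⟩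
      · by_cases hj : j = k₀
        · subst hj
          rw [Function.update_self, wordSize_append, c]
          omega
        · rw [Function.update_of_ne hj]
          exact wordSize_filter _ _
      · rw [Function.update_of_ne hk]
        exact wordSize_filter_lt _ _ hx (by simpa using hxa)
    · refine hlt k₀ _ ?_ _ fun _ => wordSize_filter _ _
      rw [wordSize_append, c]
      rcases List.mem_append.1 hx with hx | hx
      · have := wordSize_filter_lt (fun x => decide (x.1 ≠ a)) P hx (by simpa using hxa)
        omega
      · have := wordSize_filter_lt (fun x => decide (x.1 ≠ a)) Q hx (by simpa using hxa)
        omega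
  by_cases hinv : ∃ k₀ a, (a, false) ∈ G k₀
  · obtain ⟨k₀, a, ha⟩ := hinv
    obtain ⟨P, Q, hk₀⟩ := List.append_of_mem ha
    by_cases hex : (∃ k, k ≠ k₀ ∧ ∃ x ∈ G k, x.1 = a) ∨ ∃ x ∈ P ++ Q, x.1 = a
    · exact key a false k₀ P Q hk₀ hex
    · push Not at hex
      have hP : P.filter (fun x => decide (x.1 ≠ a)) = P := List.filter_eq_self.2 fun x hx => by
        simpa using hex.2 x (List.mem_append_left _ hx)
      have hQ : Q.filter (fun x => decide (x.1 ≠ a)) = Q := List.filter_eq_self.2 fun x hx => by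
        simpa using hex.2 x (List.mem_append_right _ hx)
      have h := hL.mk_rel a G k₀ (P.map (fun x => (some x.1, x.2)) ++
        (none, true) :: (some a, false) :: Q.map fun x => (some x.1, x.2))
      have e1 : wordBoth a (P.map (fun x => (some x.1, x.2)) ++
        (none, true) :: (some a, false) :: Q.map fun x => (some x.1, x.2)) =
          P ++ (a, true) :: (a, false) :: Q := by
        simp [wordBoth, Function.comp_def]
      have e2 : wordKill (P.map (fun x => (some x.1, x.2)) ++
        (none, true) :: (some a, false) :: Q.map fun x => (some x.1, x.2)) = G k₀ := by
        have h1 := wordKill_some P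
        have h2 := wordKill_some Q
        rw [wordKill] at *
        rw [List.filterMap_append, h1, List.filterMap_cons, List.filterMap_cons, h2, hk₀]
        rfl
      have e3 : wordMove a (P.map (fun x => (some x.1, x.2)) ++
        (none, true) :: (some a, false) :: Q.map fun x => (some x.1, x.2)) =
          P ++ (a, true) :: Q := by
        have h1 := wordMove_some a P
        have h2 := wordMove_some a Q
        rw [wordMove] at *
        rw [List.filterMap_append, h1, List.filterMap_cons, List.filterMap_cons, h2, hP, hQ]
        simp
      rw [e1, e2, e3, Function.update_eq_self] at h
      have c : ∀ (s : Bool) (R : List (I × Bool)),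
          wordSize ((a, s) :: R) = (if s then 1 else 2) + wordSize R :=
        fun s R => by simp [wordSize]
      have z1 : L (fun k => FreeGroup.mk (Function.update G k₀
          (P ++ (a, true) :: (a, false) :: Q) k)) = 0 := by
        have : (fun k => FreeGroup.mk (Function.update G k₀
            (P ++ (a, true) :: (a, false) :: Q) k)) =
            fun k => FreeGroup.mk (Function.update G k₀ (P ++ Q) k) := by
          funext k
          by_cases hk : k = k₀
          · subst hk
            rw [Function.update_self, Function.update_self]
            exact Quot.sound FreeGroup.Red.Step.not
          · rw [Function.update_of_ne hk, Function.update_of_ne hk]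
        rw [this]
        apply hL.eq_zero_of_avoid a
        intro k x hx
        by_cases hk : k = k₀
        · subst hk
          rw [Function.update_self] at hx
          exact hex.2 x hx
        · rw [Function.update_of_ne hk] at hx
          exact hex.1 k hk x hx
      rw [z1] at h
      have z3 := ih (Function.update (fun j => (G j).filter fun x => decide (x.1 ≠ a)) k₀
          (P ++ (a, true) :: Q)) (hlt k₀ _ (by
            rw [hk₀, wordSize_append, wordSize_append, c, c]; simp) _ fun _ => wordSize_filter _ _)
      rw [z3, add_zero] at h
      exact h.symm
  · push Not at hinv
    by_cases hmult : ∃ (a : I) (s : Bool) (k₀ : Fin n) (P Q : List (I × Bool)),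
      G k₀ = P ++ (a, s) :: Q ∧
      ((∃ k, k ≠ k₀ ∧ ∃ x ∈ G k, x.1 = a) ∨ ∃ x ∈ P ++ Q, x.1 = a)
    · obtain ⟨a, s, k₀, P, Q, h1, h2⟩ := hmult
      exact key a s k₀ P Q h1 h2
    · push Not at hmult
      have hpos : ∀ k, G k = ((G k).map Prod.fst).map fun a => (a, true) := by
        intro k
        rw [List.map_map]
        conv_lhs => rw [← List.map_id (G k)]
        refine List.map_congr_left fun x hx => ?_
        obtain ⟨a, s⟩ := x
        cases s
        · exact absurd hx (hinv k a)
        · rfl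
      have hE : EachOnce fun k => (G k).map Prod.fst := by
        refine EachOnce.of_unique (fun k => ?_) (fun a => ?_) fun a k l hk hl => ?_
        · rw [List.nodup_iff_sublist]
          intro a ha
          rw [List.sublist_map_iff] at ha
          obtain ⟨l', hl', he⟩ := ha
          rcases l' with _ | ⟨x, _ | ⟨y, _ | ⟨z, l'⟩⟩⟩
          · simp at he
          · simp at he
          · simp only [List.map_cons, List.map_nil, List.cons.injEq, and_true] at he
            have hxG : x ∈ G k := hl'.subset (by simp)
            obtain ⟨P, Q, hPQ⟩ : ∃ P Q, G k = P ++ x :: Q ∧ y ∈ Q := by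
              obtain ⟨r₁, r₂, h1, h2, h3⟩ := List.cons_sublist_iff.1 hl'
              obtain ⟨P, Q, hr⟩ := List.append_of_mem h2
              refine ⟨P, Q ++ r₂, by rw [h1, hr]; simp, ?_⟩
              exact List.mem_append_right _ (List.singleton_sublist.1 h3)
            exact (hmult x.1 x.2 k P Q hPQ.1).2 y (List.mem_append_right _ hPQ.2)
              (he.2.symm.trans he.1)
          · simp at he
        · obtain ⟨k, x, hx, hxa⟩ := hav a
          exact ⟨k, List.mem_map.2 ⟨x, hx, hxa⟩⟩
        · by_contra hkl
          obtain ⟨x, hx, rfl⟩ := List.mem_map.1 hk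
          obtain ⟨y, hy, hxy⟩ := List.mem_map.1 hl
          obtain ⟨P, Q, hPQ⟩ := List.append_of_mem hx
          exact (hmult x.1 x.2 k P Q hPQ).1 l (Ne.symm hkl) y hy hxy
      have := h0 ⟨_, hE⟩
      convert this using 2
      funext k
      rw [spell, list_prod_of, ← hpos]

/-- A primitive function is determined by its values on tuples of positive multilinear words. -/
theorem IsPrimitive.expansion [Fintype I] {K V : Type*} [CommRing K]
    [AddCommGroup V] [Module K V] {L : (Fin n → FreeGroup I) → V} (hL : IsPrimitive L)
    (g : Fin n → FreeGroup I) :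
    L g = ∑ v : WordTuple I n, (multCoeff g v.1 : K) • L (spell v.1) := by
  rw [← sub_eq_zero]
  refine IsPrimitive.eq_zero (L := fun g => L g -
    ∑ v : WordTuple I n, (multCoeff g v.1 : K) • L (spell v.1)) ?_ ?_ g
  · intro a h
    have e : ∀ v : WordTuple I n, (multCoeff (fun k => subBoth a (h k)) v.1 : K) • L (spell v.1) =
        (multCoeff (fun k => subKill (h k)) v.1 : K) • L (spell v.1) +
        (multCoeff (fun k => subMove a (h k)) v.1 : K) • L (spell v.1) := fun v => by
      rw [multCoeff_primitive a h v.2, Int.cast_add, add_smul]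
    simp only [hL a h, e, Finset.sum_add_distrib]
    abel
  · intro u
    simp only [multCoeff_spell]
    rw [Finset.sum_eq_single u]
    · simp
    · intro v _ hv; simp [hv.symm]
    · simp

end Taylor

section Cabling
variable (K : Type u) [CommRing K] {I J : Type} [Fintype I] [DecidableEq I] [Fintype J]
  [DecidableEq J] {n n' n'' : ℕ}

/-- Substitution of words for letters. -/
def WordTuple.sub (u : WordTuple I n) (v : I → List J) (hv : EachOnce v) : WordTuple J n :=
  ⟨fun k => (u.1 k).flatMap v, u.2.flatMap hv⟩

/-- The multilinear part of the Magnus expansion (`x_a ↦ 1 + a`) of a tuple `g` of group words: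
the sum, over all ways to keep exactly one occurrence of every letter of `I` in `g`, of the
tuple of remaining words, with sign `-1` for every inverse letter that is kept. -/
noncomputable def multilinearPart (g : Fin n → FreeGroup I) : WordTuple I n →₀ K :=
  Finsupp.equivFunOnFinite.symm fun v => ((∏ k, signedCount (g k).toWord (v.1 k) : ℤ) : K)

theorem multilinearPart_apply (g : Fin n → FreeGroup I) (v : WordTuple I n) :
    multilinearPart K g v = (multCoeff g v.1 : K) := rfl

theorem multilinearPart_primitive :
    IsPrimitive (multilinearPart K : (Fin n → FreeGroup I) → _) := by
  intro a h
  ext v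
  simp only [multilinearPart_apply, Finsupp.add_apply, multCoeff_primitive a h v.2, Int.cast_add]

theorem multilinearPart_spell (u : WordTuple I n) :
    multilinearPart K (spell u.1) = Finsupp.single u 1 := by
  ext v
  rw [multilinearPart_apply, multCoeff_spell, Finsupp.single_apply]
  split_ifs <;> simp

theorem IsPrimitive.linear_expansion {V : Type*} [AddCommGroup V] [Module K V]
    {L : (Fin n → FreeGroup I) → V} (hL : IsPrimitive L) (g : Fin n → FreeGroup I) :
    L g = Finsupp.linearCombination K (fun v : WordTuple I n => L (spell v.1))
      (multilinearPart K g) := by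
  rw [hL.expansion (K := K), Finsupp.linearCombination_apply, Finsupp.sum_fintype]
  · rfl
  · simp

/-- The cabling of `u` along a homomorphism `φ : F_{n'} → F_n`. The `k`-th new word runs along
`φ (x_k)`, passing a copy of `u j` for every `x_j` and a reversed copy for every `x_j⁻¹`; every
letter is put on exactly one of the copies, and gets the sign `-1` on a reversed copy. -/
noncomputable def cable (φ : FreeGroup (Fin n') →* FreeGroup (Fin n)) (u : WordTuple I n) :
    WordTuple I n' →₀ K :=
  multilinearPart K fun k => FreeGroup.lift (spell u.1) (φ (FreeGroup.of k))

/-- Linear extension of `cable`. -/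
noncomputable def cableLin (φ : FreeGroup (Fin n') →* FreeGroup (Fin n)) :
    (WordTuple I n →₀ K) →ₗ[K] (WordTuple I n' →₀ K) :=
  Finsupp.linearCombination K (cable K φ)

theorem IsPrimitive.comp_left {V : Type*} [AddCommGroup V] {L : (Fin n' → FreeGroup I) → V}
    (hL : IsPrimitive L) (w : Fin n' → FreeGroup (Fin n)) :
    IsPrimitive fun g : Fin n → FreeGroup I => L fun k => FreeGroup.lift g (w k) := by
  intro a h
  have := hL a fun k => FreeGroup.lift h (w k)
  have e : ∀ f : FreeGroup (Option I) →* FreeGroup I,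
      (fun k => f (FreeGroup.lift h (w k))) =
        fun k => FreeGroup.lift (fun j => f (h j)) (w k) := fun f => funext fun k => by
    have : (f.comp (FreeGroup.lift h)) = FreeGroup.lift fun j => f (h j) := by ext; simp
    exact DFunLike.congr_fun this (w k)
  simpa only [e] using this

theorem cableLin_multilinearPart (φ : FreeGroup (Fin n') →* FreeGroup (Fin n))
    (g : Fin n → FreeGroup I) :
    cableLin K φ (multilinearPart K g) =
      multilinearPart K fun k => FreeGroup.lift g (φ (FreeGroup.of k)) :=
  (((multilinearPart_primitive K).comp_left fun k => φ (FreeGroup.of k)).linear_expansion K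
    g).symm

theorem cableLin_single (φ : FreeGroup (Fin n') →* FreeGroup (Fin n)) (u : WordTuple I n)
    (r : K) : cableLin K φ (Finsupp.single u r) = r • cable K φ u := by
  simp [cableLin]

theorem cable_id (u : WordTuple I n) :
    cable K (MonoidHom.id (FreeGroup (Fin n))) u = Finsupp.single u 1 := by
  rw [← multilinearPart_spell]
  unfold cable
  congr 1
  funext k
  simp

theorem cableLin_id :
    cableLin K (MonoidHom.id (FreeGroup (Fin n))) =
      (LinearMap.id : (WordTuple I n →₀ K) →ₗ[K] _) := by
  refine Finsupp.lhom_ext fun u r => ?_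
  rw [cableLin_single, cable_id, Finsupp.smul_single, smul_eq_mul, mul_one, LinearMap.id_apply]

theorem cableLin_comp (φ : FreeGroup (Fin n') →* FreeGroup (Fin n))
    (ψ : FreeGroup (Fin n'') →* FreeGroup (Fin n')) :
    (cableLin K (φ.comp ψ) : (WordTuple I n →₀ K) →ₗ[K] _) =
      (cableLin K ψ).comp (cableLin K φ) := by
  ext1 u
  refine LinearMap.ext_ring ?_
  simp only [LinearMap.comp_apply, Finsupp.lsingle_apply, cableLin_single, one_smul]
  rw [cable, cable, cableLin_multilinearPart]
  congr 1
  funext k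
  have : (FreeGroup.lift (spell u.1)).comp φ =
      FreeGroup.lift fun j => FreeGroup.lift (spell u.1) (φ (FreeGroup.of j)) := by ext; simp
  exact DFunLike.congr_fun this (ψ (FreeGroup.of k))

/-- Substitution of positive words for letters, on group elements. -/
def subGroup (v : I → List J) : FreeGroup I →* FreeGroup J :=
  FreeGroup.lift fun i => ((v i).map FreeGroup.of).prod

theorem subGroup_spell (u : WordTuple I n) (v : I → List J) (hv : EachOnce v) :
    (fun k => subGroup v (spell u.1 k)) = spell (u.sub v hv).1 := by
  funext k
  simp only [spell, WordTuple.sub]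
  generalize u.1 k = l
  induction l with
  | nil => simp
  | cons a l ih => rw [List.map_cons, List.prod_cons, map_mul, ih, List.flatMap_cons,
      List.map_append, List.prod_append]; simp [subGroup]

theorem subGroup_lift (u : WordTuple I n) (v : I → List J) (hv : EachOnce v)
    (w : FreeGroup (Fin n)) :
    subGroup v (FreeGroup.lift (spell u.1) w) = FreeGroup.lift (spell (u.sub v hv).1) w := by
  rw [← subGroup_spell]
  have : (subGroup v).comp (FreeGroup.lift (spell u.1)) =
      FreeGroup.lift fun k => subGroup v (spell u.1 k) := by ext; simp
  exact DFunLike.congr_fun this w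

theorem comp_subGroup_primitive {V : Type*} [AddCommGroup V] {L : (Fin n → FreeGroup J) → V}
    (hL : IsPrimitive L) (e : I ≃ J) :
    IsPrimitive fun g : Fin n → FreeGroup I => L fun k => subGroup (fun i => [e i]) (g k) := by
  intro a h
  let D : FreeGroup (Option I) →* FreeGroup (Option J) := FreeGroup.map (Option.map e)
  have := hL (e a) fun k => D (h k)
  have e1 : ∀ x, subBoth (e a) (D x) = subGroup (fun i => [e i]) (subBoth a x) := by
    intro x
    rw [← MonoidHom.comp_apply, ← MonoidHom.comp_apply]
    congr 1; ext o; cases o <;> simp [subBoth, D, subGroup]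
  have e2 : ∀ x, subKill (D x) = subGroup (fun i => [e i]) (subKill x) := by
    intro x
    rw [← MonoidHom.comp_apply, ← MonoidHom.comp_apply]
    congr 1; ext o; cases o <;> simp [subKill, D, subGroup]
  have e3 : ∀ x, subMove (e a) (D x) = subGroup (fun i => [e i]) (subMove a x) := by
    intro x
    rw [← MonoidHom.comp_apply, ← MonoidHom.comp_apply]
    congr 1; ext o
    rcases o with _ | i
    · simp [subMove, D, subGroup]
    · by_cases hi : i = a <;> simp [subMove, D, subGroup, hi]
  simpa only [e1, e2, e3] using this

/-- Cabling commutes with relabelling. -/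
theorem cableLin_relabel (φ : FreeGroup (Fin n') →* FreeGroup (Fin n)) (e : I ≃ J)
    (he : EachOnce fun i => [e i]) (u : WordTuple I n) :
    cable K φ (u.sub (fun i => [e i]) he) =
      Finsupp.mapDomain (fun v => v.sub (fun i => [e i]) he) (cable K φ u) := by
  have h := (comp_subGroup_primitive (multilinearPart_primitive K (n := n')) e).linear_expansion K
    fun k => FreeGroup.lift (spell u.1) (φ (FreeGroup.of k))
  simp only [subGroup_lift u _ he, subGroup_spell _ _ he, multilinearPart_spell] at h
  refine h.trans ?_
  rw [Finsupp.linearCombination_apply, Finsupp.mapDomain]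
  simp [cable]

/-- The letter `p` is replaced by the two-letter word `p, none`. -/
def splitLeft (p : I) (i : I) : List (Option I) := if i = p then [some p, none] else [some i]

/-- The letter `p` is replaced by the two-letter word `none, p`. -/
def splitRight (p : I) (i : I) : List (Option I) := if i = p then [none, some p] else [some i]

theorem splitLeft_eachOnce (p : I) : EachOnce (splitLeft p) := by
  refine EachOnce.of_unique (fun k => ?_) (fun a => ?_) fun a k l hk hl => ?_
  · unfold splitLeft; split_ifs <;> simp
  · rcases a with _ | a
    · exact ⟨p, by simp [splitLeft]⟩
    · exact ⟨a, by unfold splitLeft; split_ifs <;> simp_all⟩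
  · unfold splitLeft at hk hl
    split_ifs at hk hl <;> simp_all

theorem splitRight_eachOnce (p : I) : EachOnce (splitRight p) := by
  refine EachOnce.of_unique (fun k => ?_) (fun a => ?_) fun a k l hk hl => ?_
  · unfold splitRight; split_ifs <;> simp
  · rcases a with _ | a
    · exact ⟨p, by simp [splitRight]⟩
    · exact ⟨a, by unfold splitRight; split_ifs <;> simp_all⟩
  · unfold splitRight at hk hl
    split_ifs at hk hl <;> simp_all

theorem split_primitive {V : Type*} [AddCommGroup V] {M : (Fin n → FreeGroup (Option I)) → V}
    (hM : IsPrimitive M) (p : I) :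
    IsPrimitive fun g : Fin n → FreeGroup I =>
      M (fun k => subGroup (splitLeft p) (g k)) - M (fun k => subGroup (splitRight p) (g k)) := by
  intro a h
  by_cases ha : a = p
  · subst ha
    let S : FreeGroup (Option I) → FreeGroup (Option I) →
        FreeGroup (Option I) →* FreeGroup (Option I) := fun y y' =>
      FreeGroup.lift fun o => o.elim y fun i => if i = a then y' else FreeGroup.of (some i)
    let E : FreeGroup (Option I) → FreeGroup (Option I) → V := fun y y' => M fun k => S y y' (h k)
    let A : FreeGroup (Option I) := FreeGroup.of (some a)
    let B : FreeGroup (Option I) := FreeGroup.of none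
    have step : ∀ (l : Option I) (hl : ∀ i, i ≠ a → some i ≠ l)
        (Y Y' : FreeGroup (Option (Option I))), E (subBoth l Y) (subBoth l Y') =
          E (subKill Y) (subKill Y') + E (subMove l Y) (subMove l Y') := by
      intro l hl Y Y'
      let D : FreeGroup (Option I) →* FreeGroup (Option (Option I)) :=
        FreeGroup.lift fun o => o.elim Y fun i => if i = a then Y' else FreeGroup.of (some (some i))
      have h0 := hM l fun k => D (h k)
      have e1 : ∀ x, subBoth l (D x) = S (subBoth l Y) (subBoth l Y') x := by
        intro x
        rw [← MonoidHom.comp_apply]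
        congr 1; ext o
        rcases o with _ | i
        · simp [D, S]
        · by_cases hi : i = a <;> simp [D, S, hi]
          simp [subBoth]
      have e2 : ∀ x, subKill (D x) = S (subKill Y) (subKill Y') x := by
        intro x
        rw [← MonoidHom.comp_apply]
        congr 1; ext o
        rcases o with _ | i
        · simp [D, S]
        · by_cases hi : i = a <;> simp [D, S, hi]
          simp [subKill]
      have e3 : ∀ x, subMove l (D x) = S (subMove l Y) (subMove l Y') x := by
        intro x
        rw [← MonoidHom.comp_apply]
        congr 1; ext o
        rcases o with _ | i
        · simp [D, S]
        · by_cases hi : i = a <;> simp [D, S, hi]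
          simp [subMove, hl i hi]
      simpa only [e1, e2, e3] using h0
    have hn : ∀ i, i ≠ a → some i ≠ (none : Option I) := fun i _ => by simp
    have hs : ∀ i, i ≠ a → some i ≠ some a := fun i hi => by simpa using hi
    let Z : FreeGroup (Option (Option I)) := FreeGroup.of none
    let A' : FreeGroup (Option (Option I)) := FreeGroup.of (some (some a))
    let B' : FreeGroup (Option (Option I)) := FreeGroup.of (some none)
    have q1 := step (some a) hs (Z * B') (A' * B')
    have q2 := step none hn Z (A' * B')
    have q3 := step none hn (A' * Z) B'
    have r1 := step (some a) hs (B' * Z) (B' * A')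
    have r2 := step none hn Z (B' * A')
    have r3 := step none hn (Z * A') B'
    simp [Z, A', B', subBoth, subKill, subMove] at q1 q2 q3 r1 r2 r3
    have c1 : ∀ x, subGroup (splitLeft a) (subBoth a x) = S (A * B) (A * B) x := by
      intro x
      rw [← MonoidHom.comp_apply]
      congr 1; ext o
      rcases o with _ | i
      · simp [S, subBoth, subGroup, splitLeft, A, B]
      · by_cases hi : i = a <;> simp [S, hi, subBoth, subGroup, splitLeft, A, B]
    have c2 : ∀ x, subGroup (splitLeft a) (subKill x) = S 1 (A * B) x := by
      intro x
      rw [← MonoidHom.comp_apply]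
      congr 1; ext o
      rcases o with _ | i
      · simp [S, subKill, subGroup, splitLeft, A, B]
      · by_cases hi : i = a <;> simp [S, hi, subKill, subGroup, splitLeft, A, B]
    have c3 : ∀ x, subGroup (splitLeft a) (subMove a x) = S (A * B) 1 x := by
      intro x
      rw [← MonoidHom.comp_apply]
      congr 1; ext o
      rcases o with _ | i
      · simp [S, subMove, subGroup, splitLeft, A, B]
      · by_cases hi : i = a <;> simp [S, hi, subMove, subGroup, splitLeft, A, B]
    have d1 : ∀ x, subGroup (splitRight a) (subBoth a x) = S (B * A) (B * A) x := by
      intro x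
      rw [← MonoidHom.comp_apply]
      congr 1; ext o
      rcases o with _ | i
      · simp [S, subBoth, subGroup, splitRight, A, B]
      · by_cases hi : i = a <;> simp [S, hi, subBoth, subGroup, splitRight, A, B]
    have d2 : ∀ x, subGroup (splitRight a) (subKill x) = S 1 (B * A) x := by
      intro x
      rw [← MonoidHom.comp_apply]
      congr 1; ext o
      rcases o with _ | i
      · simp [S, subKill, subGroup, splitRight, A, B]
      · by_cases hi : i = a <;> simp [S, hi, subKill, subGroup, splitRight, A, B]
    have d3 : ∀ x, subGroup (splitRight a) (subMove a x) = S (B * A) 1 x := by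
      intro x
      rw [← MonoidHom.comp_apply]
      congr 1; ext o
      rcases o with _ | i
      · simp [S, subMove, subGroup, splitRight, A, B]
      · by_cases hi : i = a <;> simp [S, hi, subMove, subGroup, splitRight, A, B]
    simp only [c1, c2, c3, d1, d2, d3]
    show E (A * B) (A * B) - E (B * A) (B * A) = E 1 (A * B) - E 1 (B * A) +
      (E (A * B) 1 - E (B * A) 1)
    rw [q1, q2, q3, r1, r2, r3]
    abel
  · have main : ∀ v : I → List (Option I), (∀ i, i ≠ p → v i = [some i]) →
        (∀ o ∈ v p, o ≠ some a) →
        M (fun k => subGroup v (subBoth a (h k))) =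
          M (fun k => subGroup v (subKill (h k))) + M (fun k => subGroup v (subMove a (h k))) := by
      intro v hv hvp
      let D : FreeGroup (Option I) →* FreeGroup (Option (Option I)) :=
        FreeGroup.lift fun o => o.elim (FreeGroup.of none) fun i =>
          ((v i).map fun o => FreeGroup.of (some o)).prod
      have h0 := hM (some a) fun k => D (h k)
      have l1 : ∀ (f : FreeGroup (Option (Option I)) →* FreeGroup (Option I))
          (l : List (Option I)), (∀ o ∈ l, f (FreeGroup.of (some o)) = FreeGroup.of o) →
          f ((l.map fun o => FreeGroup.of (some o)).prod) = (l.map FreeGroup.of).prod := by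
        intro f l hl
        rw [map_list_prod, List.map_map]
        exact congrArg _ (List.map_congr_left fun o ho => hl o ho)
      have e1 : ∀ x, subBoth (some a) (D x) = subGroup v (subBoth a x) := by
        intro x
        rw [← MonoidHom.comp_apply, ← MonoidHom.comp_apply]
        congr 1; ext o
        rcases o with _ | i
        · simp [D, subBoth, subGroup, hv a ha]
        · simp only [MonoidHom.comp_apply, D, FreeGroup.lift_apply_of, Option.elim]
          rw [l1 _ _ fun o _ => by simp [subBoth]]
          simp [subBoth, subGroup]
      have e2 : ∀ x, subKill (D x) = subGroup v (subKill x) := by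
        intro x
        rw [← MonoidHom.comp_apply, ← MonoidHom.comp_apply]
        congr 1; ext o
        rcases o with _ | i
        · simp [D, subKill]
        · simp only [MonoidHom.comp_apply, D, FreeGroup.lift_apply_of, Option.elim]
          rw [l1 _ _ fun o _ => by simp [subKill]]
          simp [subKill, subGroup]
      have e3 : ∀ x, subMove (some a) (D x) = subGroup v (subMove a x) := by
        intro x
        rw [← MonoidHom.comp_apply, ← MonoidHom.comp_apply]
        congr 1; ext o
        rcases o with _ | i
        · simp [D, subMove, subGroup, hv a ha]
        · simp only [MonoidHom.comp_apply, D, FreeGroup.lift_apply_of, Option.elim]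
          by_cases hi : i = a
          · subst hi
            simp [hv i ha, subMove]
          · rw [l1 _ _ fun o ho => ?_]
            · simp [subMove, subGroup, hi]
            · have : o ≠ some a := by
                by_cases hip : i = p
                · exact hvp o (hip ▸ ho)
                · rw [hv i hip] at ho
                  simp at ho
                  subst ho
                  simpa using hi
              simp [subMove, this]
      simpa only [e1, e2, e3] using h0
    have hpa : p ≠ a := fun h => ha h.symm
    show M _ - M _ = (M _ - M _) + (M _ - M _)
    rw [main (splitLeft p) (fun i hi => by simp [splitLeft, hi]) (by simp [splitLeft, hpa]),
      main (splitRight p) (fun i hi => by simp [splitRight, hi]) (by simp [splitRight, hpa])]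
    abel

/-- Cabling commutes with the commutator that splits one letter. -/
theorem cable_split (φ : FreeGroup (Fin n') →* FreeGroup (Fin n)) (p : I) (u : WordTuple I n) :
    cable K φ (u.sub _ (splitLeft_eachOnce p)) - cable K φ (u.sub _ (splitRight_eachOnce p)) =
      Finsupp.mapDomain (fun v => v.sub _ (splitLeft_eachOnce p)) (cable K φ u) -
      Finsupp.mapDomain (fun v => v.sub _ (splitRight_eachOnce p)) (cable K φ u) := by
  have h := (split_primitive (multilinearPart_primitive K (n := n')) p).linear_expansion K
    fun k => FreeGroup.lift (spell u.1) (φ (FreeGroup.of k))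
  simp only [subGroup_lift u _ (splitLeft_eachOnce p), subGroup_lift u _ (splitRight_eachOnce p),
    subGroup_spell _ _ (splitLeft_eachOnce p), subGroup_spell _ _ (splitRight_eachOnce p),
    multilinearPart_spell] at h
  refine h.trans ?_
  rw [Finsupp.linearCombination_apply, Finsupp.mapDomain, Finsupp.mapDomain, ← Finsupp.sum_sub]
  simp [cable, smul_sub]

end Cabling

section Trees
variable {α β γ I J κ : Type}

/-- The leaves of a rooted planar binary tree, from left to right. -/
def leaves : FreeMagma α → List α
  | .of a => [a]
  | .mul s t => leaves s ++ leaves t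

/-- Grafting the trees `F a` on the leaves of a tree. -/
def graft (F : α → FreeMagma β) : FreeMagma α → FreeMagma β
  | .of a => F a
  | .mul s t => graft F s * graft F t

@[simp] theorem leaves_of (a : α) : leaves (FreeMagma.of a) = [a] := rfl
@[simp] theorem leaves_mul (s t : FreeMagma α) : leaves (s * t) = leaves s ++ leaves t := rfl
@[simp] theorem graft_of (F : α → FreeMagma β) (a : α) : graft F (FreeMagma.of a) = F a := rfl
@[simp] theorem graft_mul (F : α → FreeMagma β) (s t : FreeMagma α) :
    graft F (s * t) = graft F s * graft F t := rfl

theorem leaves_graft (F : α → FreeMagma β) (t : FreeMagma α) :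
    leaves (graft F t) = (leaves t).flatMap fun a => leaves (F a) := by
  induction t with
  | ih1 a => simp
  | ih2 s t hs ht => simp [hs, ht]

@[simp] theorem graft_id (t : FreeMagma α) : graft FreeMagma.of t = t := by
  induction t with
  | ih1 a => rfl
  | ih2 s t hs ht => rw [graft_mul, hs, ht]

theorem graft_graft (F : β → FreeMagma γ) (G : α → FreeMagma β) (t : FreeMagma α) :
    graft F (graft G t) = graft (fun a => graft F (G a)) t := by
  induction t with
  | ih1 a => rfl
  | ih2 s t hs ht => rw [graft_mul, graft_mul, graft_mul, hs, ht]

/-- Families of trees, indexed by `I`, whose leaves are in bijection with `β`. -/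
def Forest (I β : Type) [Fintype I] [DecidableEq β] : Type :=
  {F : I → FreeMagma β // EachOnce fun i => leaves (F i)}

/-- Families of `n` words in trees, the leaves of all the trees being in bijection with `β`:
trees whose roots are attached to `n` oriented arcs. -/
def Diagram (β : Type) [DecidableEq β] (n : ℕ) : Type :=
  {D : Fin n → List (FreeMagma β) // EachOnce fun k => (D k).flatMap leaves}

variable [Fintype I] [Fintype J] [Fintype κ] [DecidableEq I] [DecidableEq J] [DecidableEq β]
  [DecidableEq γ] {n : ℕ}

/-- The forest of trivial trees. -/
def Forest.id (I : Type) [Fintype I] [DecidableEq I] : Forest I I :=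
  ⟨FreeMagma.of, EachOnce.singleton⟩

/-- Grafting the trees of `F` on the leaves of the trees of `G`. -/
def Forest.comp (F : Forest I β) (G : Forest κ I) : Forest κ β :=
  ⟨fun k => graft F.1 (G.1 k), by simpa only [leaves_graft] using G.2.flatMap F.2⟩

/-- Grafting the trees of `F` on the leaves of `D`. -/
def Diagram.act (F : Forest I β) (D : Diagram I n) : Diagram β n :=
  ⟨fun k => (D.1 k).map (graft F.1), by
    have := D.2.flatMap F.2
    simpa only [List.flatMap_map, List.flatMap_assoc, leaves_graft] using this⟩

/-- The trees `F i` attached to the arcs in the way prescribed by the letters of `u`. -/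
def fill (F : Forest I β) (u : WordTuple I n) : Diagram β n :=
  ⟨fun k => (u.1 k).map F.1, by simpa only [List.flatMap_map] using u.2.flatMap F.2⟩

theorem fill_comp (F : Forest I β) (G : Forest J I) (u : WordTuple J n) :
    fill (F.comp G) u = (fill G u).act F := by
  apply Subtype.ext; funext k
  simp [fill, Diagram.act, Forest.comp, Function.comp_def]

theorem Forest.id_comp (G : Forest κ I) : (Forest.id I).comp G = G :=
  Subtype.ext (funext fun _ => graft_id _)

theorem Forest.comp_id (F : Forest I β) : F.comp (Forest.id I) = F := rfl

theorem Forest.comp_assoc (F : Forest J γ) (G : Forest I J) (H : Forest κ I) :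
    F.comp (G.comp H) = (F.comp G).comp H :=
  Subtype.ext (funext fun _ => graft_graft _ _ _)

theorem Diagram.act_id (D : Diagram I n) : D.act (Forest.id I) = D :=
  Subtype.ext (funext fun _ => List.map_id'' graft_id _)

theorem Diagram.act_act (F : Forest J γ) (G : Forest I J) (D : Diagram I n) :
    (D.act G).act F = D.act (F.comp G) := by
  apply Subtype.ext; funext k
  simp [Diagram.act, Forest.comp, graft_graft]

/-- The places on the arcs of `D`. -/
abbrev Diagram.Place (D : Diagram β n) : Type := Σ k, Fin (D.1 k).length

/-- The tree at a place. -/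
def Diagram.tree (D : Diagram β n) (i : D.Place) : FreeMagma β := (D.1 i.1).get i.2

/-- The places of `D` in their order on the arcs. -/
def Diagram.places (D : Diagram β n) : WordTuple D.Place n :=
  ⟨fun k => (List.finRange _).map fun j => ⟨k, j⟩, by
    refine EachOnce.of_unique (fun k => ?_) (fun a => ⟨a.1, ?_⟩) fun a k l hk hl => ?_
    · exact (List.nodup_finRange _).map fun i j h => by simpa using h
    · simp
    · simp only [List.mem_map, List.mem_finRange, true_and] at hk hl
      obtain ⟨i, rfl⟩ := hk
      obtain ⟨j, hj⟩ := hl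
      exact (congrArg Sigma.fst hj).symm⟩

theorem Diagram.places_map (D : Diagram β n) (k : Fin n) :
    (D.places.1 k).map D.tree = D.1 k := by
  simp only [Diagram.places, List.map_map]
  exact List.map_get_finRange _

/-- The trees of `D`, indexed by the places. -/
def Diagram.forest (D : Diagram β n) : Forest D.Place β :=
  ⟨D.tree, by
    intro b
    have h := D.2 b
    rw [Fintype.sum_sigma, ← h]
    refine Finset.sum_congr rfl fun k _ => ?_
    refine Eq.trans ?_ (congrArg (fun l => (l.flatMap leaves).count b) (D.places_map k))
    simp only [List.count_flatMap, Diagram.places, List.map_map]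
    rw [← List.ofFn_eq_map, List.sum_ofFn]
    rfl⟩

theorem Diagram.fill_places (D : Diagram β n) : fill D.forest D.places = D :=
  Subtype.ext (funext D.places_map)

end Trees

section Linearization
variable (K : Type u) [CommRing K] {A B C : Type}

theorem finsupp_ext {V : Type*} [AddCommGroup V] [Module K V] {f g : (A →₀ K) →ₗ[K] V}
    (h : ∀ a, f (Finsupp.single a 1) = g (Finsupp.single a 1)) : f = g := by
  refine Finsupp.lhom_ext fun a r => ?_
  rw [← mul_one r, ← smul_eq_mul, ← Finsupp.smul_single, map_smul, map_smul, h]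

variable {K}

theorem quot_ind {R : Submodule K (A →₀ K)} {P : (A →₀ K) ⧸ R → Prop} (zero : P 0)
    (single : ∀ a, P (R.mkQ (Finsupp.single a 1))) (add : ∀ x y, P x → P y → P (x + y))
    (smul : ∀ (r : K) x, P x → P (r • x)) (x : (A →₀ K) ⧸ R) : P x := by
  obtain ⟨x, rfl⟩ := R.mkQ_surjective x
  induction x using Finsupp.induction_linear with
  | zero => simpa using zero
  | add x y hx hy => rw [map_add]; exact add _ _ hx hy
  | single a r =>
    rw [← mul_one r, ← smul_eq_mul, ← Finsupp.smul_single, map_smul]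
    exact smul _ _ (single a)

theorem quot_ext {V : Type*} [AddCommGroup V] [Module K V] {R : Submodule K (A →₀ K)}
    {f g : ((A →₀ K) ⧸ R) →ₗ[K] V}
    (h : ∀ a, f (R.mkQ (Finsupp.single a 1)) = g (R.mkQ (Finsupp.single a 1))) : f = g :=
  Submodule.linearMap_qext _ (finsupp_ext K h)

/-- The bilinear map of quotients of free modules that is induced by an operation on the bases. -/
noncomputable def bilinQ (op : A → B → C) {RA : Submodule K (A →₀ K)} {RB : Submodule K (B →₀ K)}
    {RC : Submodule K (C →₀ K)} (h₁ : ∀ a, RB ≤ RC.comap (Finsupp.lmapDomain K K (op a)))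
    (h₂ : ∀ b, RA ≤ RC.comap (Finsupp.lmapDomain K K fun a => op a b)) :
    ((A →₀ K) ⧸ RA) →ₗ[K] ((B →₀ K) ⧸ RB) →ₗ[K] ((C →₀ K) ⧸ RC) :=
  RA.liftQ (Finsupp.linearCombination K fun a => RB.mapQ RC (Finsupp.lmapDomain K K (op a)) (h₁ a))
    (by
      intro x hx
      rw [LinearMap.mem_ker]
      refine quot_ext fun b => ?_
      have : (LinearMap.applyₗ (RB.mkQ (Finsupp.single b 1))).comp
          (Finsupp.linearCombination K fun a =>
            RB.mapQ RC (Finsupp.lmapDomain K K (op a)) (h₁ a)) =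
          RC.mkQ.comp (Finsupp.lmapDomain K K fun a => op a b) := by
        refine finsupp_ext K fun a => ?_
        simp [Finsupp.mapDomain_single]
      refine (LinearMap.congr_fun this x).trans ?_
      simpa using h₂ b hx)

@[simp] theorem bilinQ_single (op : A → B → C) {RA : Submodule K (A →₀ K)}
    {RB : Submodule K (B →₀ K)} {RC : Submodule K (C →₀ K)}
    (h₁ : ∀ a, RB ≤ RC.comap (Finsupp.lmapDomain K K (op a)))
    (h₂ : ∀ b, RA ≤ RC.comap (Finsupp.lmapDomain K K fun a => op a b)) (a : A) (b : B) :
    bilinQ op h₁ h₂ (RA.mkQ (Finsupp.single a 1)) (RB.mkQ (Finsupp.single b 1)) =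
      RC.mkQ (Finsupp.single (op a b) 1) := by
  simp [bilinQ, Finsupp.mapDomain_single]

end Linearization

section Relations
variable (K : Type u) [CommRing K] {I J β γ κ : Type} [Fintype I] [Fintype J] [Fintype κ]
  [DecidableEq I] [DecidableEq J] [DecidableEq β] [DecidableEq γ] {n n' n'' : ℕ}

/-- Antisymmetry `[a, b] + [b, a] = 0` and the Jacobi (IHX) relation
`[[a, b], c] + [[b, c], a] + [[c, a], b] = 0` at the root of one of the trees of a forest. -/
inductive IsRelator : (Forest I β →₀ K) → Prop
  | as (F F' : Forest I β) (p : I) (a b : FreeMagma β) (hF : F.1 p = a * b)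
      (hF' : F'.1 p = b * a) (h : ∀ i, i ≠ p → F'.1 i = F.1 i) :
      IsRelator (Finsupp.single F 1 + Finsupp.single F' 1)
  | ihx (F F' F'' : Forest I β) (p : I) (a b c : FreeMagma β) (hF : F.1 p = a * b * c)
      (hF' : F'.1 p = b * c * a) (hF'' : F''.1 p = c * a * b) (h : ∀ i, i ≠ p → F'.1 i = F.1 i)
      (h' : ∀ i, i ≠ p → F''.1 i = F.1 i) :
      IsRelator (Finsupp.single F 1 + Finsupp.single F' 1 + Finsupp.single F'' 1)

/-- The relations of the linear category of Lie trees: antisymmetry and IHX at any vertex. -/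
noncomputable def lieRelations (I β : Type) [Fintype I] [DecidableEq β] : Submodule K (Forest I β →₀ K) :=
  Submodule.span K {x | ∃ (l : ℕ) (r : Forest (Fin l) β →₀ K) (G : Forest I (Fin l)),
    IsRelator K r ∧ x = Finsupp.lmapDomain K K (fun F => F.comp G) r}

/-- The STU relation `D + D₁ - D₂ = 0`: the diagram `D` has on one of its arcs a tree `s * t`,
which is replaced in `D₁` by the two consecutive trees `s, t`, and in `D₂` by `t, s`. -/
inductive IsSTU : (Diagram β n →₀ K) → Prop
  | stu (D D₁ D₂ : Diagram β n) (k : Fin n) (p q : List (FreeMagma β)) (s t : FreeMagma β)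
      (hD : D.1 k = p ++ (s * t) :: q) (h₁ : D₁.1 k = p ++ s :: t :: q)
      (h₂ : D₂.1 k = p ++ t :: s :: q) (h₁' : ∀ j, j ≠ k → D₁.1 j = D.1 j)
      (h₂' : ∀ j, j ≠ k → D₂.1 j = D.1 j) :
      IsSTU (Finsupp.single D 1 + Finsupp.single D₁ 1 - Finsupp.single D₂ 1)

/-- The relations of diagrams: antisymmetry and IHX at any vertex, and STU. -/
noncomputable def diagRelations (β : Type) [DecidableEq β] (n : ℕ) : Submodule K (Diagram β n →₀ K) :=
  Submodule.span K ({x | ∃ (l : ℕ) (r : Forest (Fin l) β →₀ K) (E : Diagram (Fin l) n),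
    IsRelator K r ∧ x = Finsupp.lmapDomain K K (fun F => E.act F) r} ∪ {x | IsSTU K x})

variable {K}

theorem IsRelator.comp {r : Forest I β →₀ K} (hr : IsRelator K r) [Fintype β] (F : Forest β γ) :
    IsRelator K (Finsupp.lmapDomain K K (fun G => F.comp G) r) := by
  cases hr with
  | as G G' p a b hG hG' h =>
    simp only [map_add, Finsupp.lmapDomain_apply, Finsupp.mapDomain_single]
    exact .as _ _ p (graft F.1 a) (graft F.1 b) (congrArg (graft F.1) hG)
      (congrArg (graft F.1) hG') fun i hi => congrArg (graft F.1) (h i hi)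
  | ihx G G' G'' p a b c hG hG' hG'' h h' =>
    simp only [map_add, Finsupp.lmapDomain_apply, Finsupp.mapDomain_single]
    exact .ihx _ _ _ p (graft F.1 a) (graft F.1 b) (graft F.1 c) (congrArg (graft F.1) hG)
      (congrArg (graft F.1) hG') (congrArg (graft F.1) hG'')
      (fun i hi => congrArg (graft F.1) (h i hi)) fun i hi => congrArg (graft F.1) (h' i hi)

theorem lmap_lmap {A B C : Type} (f : A → B) (g : B → C) (x : A →₀ K) :
    Finsupp.lmapDomain K K g (Finsupp.lmapDomain K K f x) =
      Finsupp.lmapDomain K K (fun a => g (f a)) x := by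
  simp only [Finsupp.lmapDomain_apply, ← Finsupp.mapDomain_comp]; rfl

theorem lieRelations_comp_left [Fintype β] (F : Forest β γ) :
    lieRelations K I β ≤
      (lieRelations K I γ).comap (Finsupp.lmapDomain K K fun G => F.comp G) := by
  refine Submodule.span_le.2 ?_
  rintro _ ⟨l, r, G, hr, rfl⟩
  refine Submodule.subset_span ⟨l, _, G, hr.comp F, ?_⟩
  rw [lmap_lmap, lmap_lmap]
  simp only [Forest.comp_assoc]

theorem lieRelations_comp_right (G : Forest κ I) :
    lieRelations K I β ≤
      (lieRelations K κ β).comap (Finsupp.lmapDomain K K fun F => F.comp G) := by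
  refine Submodule.span_le.2 ?_
  rintro _ ⟨l, r, H, hr, rfl⟩
  refine Submodule.subset_span ⟨l, _, H.comp G, hr, ?_⟩
  rw [lmap_lmap]
  simp only [Forest.comp_assoc]

theorem IsSTU.act {x : Diagram β n →₀ K} (hx : IsSTU K x) [Fintype β] (F : Forest β γ) :
    IsSTU K (Finsupp.lmapDomain K K (fun D => D.act F) x) := by
  obtain ⟨D, D₁, D₂, k, p, q, s, t, hD, h₁, h₂, h₁', h₂'⟩ := hx
  simp only [map_add, map_sub, Finsupp.lmapDomain_apply, Finsupp.mapDomain_single]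
  refine .stu _ _ _ k (p.map (graft F.1)) (q.map (graft F.1)) (graft F.1 s) (graft F.1 t)
    ?_ ?_ ?_ ?_ ?_
  · exact (congrArg (List.map (graft F.1)) hD).trans (by simp)
  · exact (congrArg (List.map (graft F.1)) h₁).trans (by simp)
  · exact (congrArg (List.map (graft F.1)) h₂).trans (by simp)
  · exact fun j hj => congrArg (List.map (graft F.1)) (h₁' j hj)
  · exact fun j hj => congrArg (List.map (graft F.1)) (h₂' j hj)

theorem diagRelations_act [Fintype β] (F : Forest β γ) :
    diagRelations K β n ≤
      (diagRelations K γ n).comap (Finsupp.lmapDomain K K fun D => D.act F) := by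
  refine Submodule.span_le.2 ?_
  rintro _ (⟨l, r, E, hr, rfl⟩ | hx)
  · refine Submodule.subset_span (Or.inl ⟨l, _, E, hr.comp F, ?_⟩)
    rw [lmap_lmap, lmap_lmap]
    simp only [Diagram.act_act]
  · exact Submodule.subset_span (Or.inr (hx.act F))

theorem diagRelations_lie (D : Diagram I n) :
    lieRelations K I β ≤
      (diagRelations K β n).comap (Finsupp.lmapDomain K K fun F => D.act F) := by
  refine Submodule.span_le.2 ?_
  rintro _ ⟨l, r, G, hr, rfl⟩
  refine Submodule.subset_span (Or.inl ⟨l, r, D.act G, hr, ?_⟩)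
  rw [lmap_lmap]
  simp only [Diagram.act_act]

end Relations

section DiagramCabling
variable (K : Type u) [CommRing K] {I β γ : Type} [Fintype I] [DecidableEq I] [DecidableEq β]
  [DecidableEq γ] {n n' n'' : ℕ}

/-- The cabling of a diagram: the roots of its trees are moved by `cable`. -/
noncomputable def diagCable (φ : FreeGroup (Fin n') →* FreeGroup (Fin n)) (D : Diagram β n) :
    Diagram β n' →₀ K :=
  Finsupp.mapDomain (fill D.forest) (cable K φ D.places)

/-- Linear extension of `diagCable`. -/
noncomputable def diagCableLin (φ : FreeGroup (Fin n') →* FreeGroup (Fin n)) :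
    (Diagram β n →₀ K) →ₗ[K] (Diagram β n' →₀ K) :=
  Finsupp.linearCombination K (diagCable K φ)

@[simp] theorem diagCableLin_single (φ : FreeGroup (Fin n') →* FreeGroup (Fin n))
    (D : Diagram β n) : diagCableLin K φ (Finsupp.single D 1) = diagCable K φ D := by
  simp [diagCableLin]

/-- Cabling of the roots of `fill F u` does not depend on the way in which they are labelled. -/
theorem diagCable_fill (φ : FreeGroup (Fin n') →* FreeGroup (Fin n)) (F : Forest I β)
    (u : WordTuple I n) :
    diagCable K φ (fill F u) = Finsupp.mapDomain (fill F) (cable K φ u) := by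
  have hlen : ∀ k, ((fill F u).1 k).length = (u.1 k).length := fun k => List.length_map _
  let f : (fill F u).Place → I := fun i => (u.1 i.1).get (i.2.cast (hlen i.1))
  have hf : f.Bijective := by
    constructor
    · rintro ⟨k, i⟩ ⟨l, j⟩ h
      have hkl : k = l := u.2.unique (List.get_mem _ _) (by
        have : f ⟨l, j⟩ ∈ u.1 l := List.get_mem _ _
        rw [← h] at this
        exact this)
      subst hkl
      have := (List.nodup_iff_injective_get.1 (u.2.nodup k)) h
      simpa [Fin.ext_iff] using this
    · intro a
      obtain ⟨k, hk⟩ := u.2.exists_mem a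
      obtain ⟨j, hj⟩ := List.mem_iff_get.1 hk
      exact ⟨⟨k, j.cast (hlen k).symm⟩, hj⟩
  let e := Equiv.ofBijective f hf
  have he : EachOnce fun i => [e i] := EachOnce.singleton.map hf
  have hu : (fill F u).places.sub (fun i => [e i]) he = u := by
    refine Subtype.ext (funext fun k => ?_)
    refine (List.flatMap_map _ _ _).trans (List.map_eq_flatMap.symm.trans ?_)
    refine List.ext_getElem (by simpa using hlen k) fun j h₁ h₂ => ?_
    simp [e, f]
  have h := cableLin_relabel K φ e he (fill F u).places
  rw [hu] at h
  rw [h, ← Finsupp.mapDomain_comp]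
  unfold diagCable
  congr 1
  funext v
  refine Subtype.ext (funext fun k => ?_)
  have ht : ∀ i : (fill F u).Place, (fill F u).forest.1 i = F.1 (e i) := fun i => by
    refine (List.getElem_map _ (l := u.1 i.1)).trans ?_
    rfl
  refine (List.map_congr_left fun i _ => ht i).trans ?_
  refine Eq.trans ?_ (congrArg (List.map F.1) List.map_eq_flatMap)
  exact (List.map_map (f := e)).symm

theorem diagCableLin_mapDomain (φ : FreeGroup (Fin n') →* FreeGroup (Fin n)) (F : Forest I β)
    (x : WordTuple I n →₀ K) :
    diagCableLin K φ (Finsupp.mapDomain (fill F) x) =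
      Finsupp.mapDomain (fill F) (cableLin K φ x) := by
  have : (diagCableLin K φ).comp (Finsupp.lmapDomain K K (fill F)) =
      (Finsupp.lmapDomain K K (fill F)).comp (cableLin K φ) := by
    refine finsupp_ext K fun u => ?_
    simp [Finsupp.mapDomain_single, diagCable_fill, cableLin_single]
  exact LinearMap.congr_fun this x

theorem diagCableLin_act [Fintype β] (φ : FreeGroup (Fin n') →* FreeGroup (Fin n))
    (F : Forest β γ) (x : Diagram β n →₀ K) :
    diagCableLin K φ (Finsupp.lmapDomain K K (fun D => D.act F) x) =
      Finsupp.lmapDomain K K (fun D => D.act F) (diagCableLin K φ x) := by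
  have : (diagCableLin K φ).comp (Finsupp.lmapDomain K K fun D => D.act F) =
      (Finsupp.lmapDomain K K fun D => D.act F).comp (diagCableLin K φ) := by
    refine finsupp_ext K fun D => ?_
    have h : D.act F = fill (F.comp D.forest) D.places := by rw [fill_comp, D.fill_places]
    simp only [LinearMap.comp_apply, Finsupp.lmapDomain_apply, Finsupp.mapDomain_single,
      diagCableLin_single]
    rw [h, diagCable_fill, diagCable, ← Finsupp.mapDomain_comp]
    congr 1
    funext v
    exact fill_comp _ _ _
  exact LinearMap.congr_fun this x

theorem diagCableLin_id :
    diagCableLin K (MonoidHom.id (FreeGroup (Fin n))) =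
      (LinearMap.id : (Diagram β n →₀ K) →ₗ[K] _) := by
  refine finsupp_ext K fun D => ?_
  rw [diagCableLin_single, diagCable, cable_id, Finsupp.mapDomain_single, D.fill_places]
  rfl

theorem diagCableLin_comp (φ : FreeGroup (Fin n') →* FreeGroup (Fin n))
    (ψ : FreeGroup (Fin n'') →* FreeGroup (Fin n')) :
    (diagCableLin K (φ.comp ψ) : (Diagram β n →₀ K) →ₗ[K] _) =
      (diagCableLin K ψ).comp (diagCableLin K φ) := by
  refine finsupp_ext K fun D => ?_
  rw [LinearMap.comp_apply, diagCableLin_single, diagCableLin_single, diagCable, diagCable,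
    diagCableLin_mapDomain]
  congr 1
  have := LinearMap.congr_fun (cableLin_comp K φ ψ) (Finsupp.single D.places 1)
  simpa [cableLin_single] using this

/-- If the tree `F p` is `s * t`, cut it into the two trees `s`, with index `p`, and `t`, with
the new index `none`. -/
def Forest.split (F : Forest I β) (p : I) (s t : FreeMagma β) (h : F.1 p = s * t) :
    Forest (Option I) β :=
  ⟨fun o => o.elim t fun i => if i = p then s else F.1 i, by
    intro b
    have hb : ∑ i, (leaves (F.1 i)).count b = 1 := F.2 b
    rw [← Finset.add_sum_erase _ _ (Finset.mem_univ p), h, leaves_mul, List.count_append] at hb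
    rw [Fintype.sum_option, ← Finset.add_sum_erase _ _ (Finset.mem_univ p)]
    have : ∀ i ∈ Finset.univ.erase p, (leaves (if i = p then s else F.1 i)).count b =
        (leaves (F.1 i)).count b := fun i hi => by rw [if_neg (Finset.ne_of_mem_erase hi)]
    simp only [Option.elim, if_true, Finset.sum_congr rfl this]
    omega⟩

theorem fill_splitLeft (F : Forest I β) (p : I) (s t : FreeMagma β) (h : F.1 p = s * t)
    (u : WordTuple I n) (k : Fin n) :
    (fill (F.split p s t h) (u.sub _ (splitLeft_eachOnce p))).1 k =
      (u.1 k).flatMap fun i => if i = p then [s, t] else [F.1 i] := by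
  refine List.map_flatMap.trans ?_
  congr 1; funext i
  simp only [splitLeft]
  split_ifs with hi <;> simp [Forest.split, hi]

theorem fill_splitRight (F : Forest I β) (p : I) (s t : FreeMagma β) (h : F.1 p = s * t)
    (u : WordTuple I n) (k : Fin n) :
    (fill (F.split p s t h) (u.sub _ (splitRight_eachOnce p))).1 k =
      (u.1 k).flatMap fun i => if i = p then [t, s] else [F.1 i] := by
  refine List.map_flatMap.trans ?_
  congr 1; funext i
  simp only [splitRight]
  split_ifs with hi <;> simp [Forest.split, hi]

theorem flatMap_ite_of_notMem {X : Type} (f : I → X) (L : List X) (p : I) {l : List I}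
    (h : p ∉ l) : (l.flatMap fun i => if i = p then L else [f i]) = l.map f := by
  rw [List.map_eq_flatMap]
  refine List.flatMap_congr fun i hi => ?_
  rw [if_neg]
  rintro rfl
  exact h hi

theorem flatMap_ite {X : Type} (f : I → X) (L : List X) (p : I) {l P Q : List I}
    (hl : l = P ++ p :: Q) (hn : l.Nodup) :
    (l.flatMap fun i => if i = p then L else [f i]) = P.map f ++ (L ++ Q.map f) := by
  subst hl
  rw [List.nodup_append] at hn
  obtain ⟨-, hQ, hP⟩ := hn
  have hP' : p ∉ P := fun h => hP p h p (by simp) rfl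
  rw [List.flatMap_append, List.flatMap_cons, flatMap_ite_of_notMem f L p hP',
    flatMap_ite_of_notMem f L p (List.nodup_cons.1 hQ).1, if_pos rfl]

/-- The STU relator at a labelled root. -/
theorem isSTU_split (F : Forest I β) (p : I) (s t : FreeMagma β) (h : F.1 p = s * t)
    (u : WordTuple I n) :
    IsSTU K (Finsupp.single (fill F u) 1 +
      Finsupp.single (fill (F.split p s t h) (u.sub _ (splitLeft_eachOnce p))) 1 -
      Finsupp.single (fill (F.split p s t h) (u.sub _ (splitRight_eachOnce p))) 1) := by
  obtain ⟨k, hk⟩ := u.2.exists_mem p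
  obtain ⟨P, Q, hPQ⟩ := List.append_of_mem hk
  have hj : ∀ j, j ≠ k → p ∉ u.1 j := fun j hj hp => hj (u.2.unique hp hk)
  refine .stu _ _ _ k (P.map F.1) (Q.map F.1) s t ?_ ?_ ?_ ?_ ?_
  · exact (congrArg (List.map F.1) hPQ).trans (by simp [h])
  · exact (fill_splitLeft F p s t h u k).trans (flatMap_ite _ _ p hPQ (u.2.nodup k))
  · exact (fill_splitRight F p s t h u k).trans (flatMap_ite _ _ p hPQ (u.2.nodup k))
  · exact fun j hjk => (fill_splitLeft F p s t h u j).trans (flatMap_ite_of_notMem _ _ p (hj j hjk))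
  · exact fun j hjk => (fill_splitRight F p s t h u j).trans
      (flatMap_ite_of_notMem _ _ p (hj j hjk))

theorem IsSTU.exists_split {x : Diagram β n →₀ K} (hx : IsSTU K x) :
    ∃ (D : Diagram β n) (p : D.Place) (s t : FreeMagma β) (h : D.forest.1 p = s * t),
      x = Finsupp.single (fill D.forest D.places) 1 +
      Finsupp.single (fill (D.forest.split p s t h) (D.places.sub _ (splitLeft_eachOnce p))) 1 -
      Finsupp.single (fill (D.forest.split p s t h) (D.places.sub _ (splitRight_eachOnce p))) 1
    := by
  obtain ⟨D, D₁, D₂, k, P, Q, s, t, hD, h₁, h₂, h₁', h₂'⟩ := hx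
  have hk := (D.places_map k).trans hD
  obtain ⟨P', R, hR, hP', hR'⟩ := List.map_eq_append_iff.1 hk
  obtain ⟨p, Q', rfl, hp, hQ'⟩ := List.map_eq_cons_iff.1 hR'
  refine ⟨D, p, s, t, hp, ?_⟩
  have hpk : p ∈ D.places.1 k := by rw [hR]; simp
  have hj : ∀ j, j ≠ k → p ∉ D.places.1 j := fun j hj hp => hj (D.places.2.unique hp hpk)
  have e₁ : fill (D.forest.split p s t hp) (D.places.sub _ (splitLeft_eachOnce p)) = D₁ := by
    refine Subtype.ext (funext fun j => (fill_splitLeft _ p s t hp _ j).trans ?_)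
    by_cases hjk : j = k
    · subst hjk
      refine (flatMap_ite _ _ p hR (D.places.2.nodup j)).trans ?_
      rw [h₁, ← hP', ← hQ']
      rfl
    · refine (flatMap_ite_of_notMem _ _ p (hj j hjk)).trans ?_
      rw [h₁' j hjk]
      exact D.places_map j
  have e₂ : fill (D.forest.split p s t hp) (D.places.sub _ (splitRight_eachOnce p)) = D₂ := by
    refine Subtype.ext (funext fun j => (fill_splitRight _ p s t hp _ j).trans ?_)
    by_cases hjk : j = k
    · subst hjk
      refine (flatMap_ite _ _ p hR (D.places.2.nodup j)).trans ?_
      rw [h₂, ← hP', ← hQ']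
      rfl
    · refine (flatMap_ite_of_notMem _ _ p (hj j hjk)).trans ?_
      rw [h₂' j hjk]
      exact D.places_map j
  rw [e₁, e₂, D.fill_places]

theorem diagCable_stu (φ : FreeGroup (Fin n') →* FreeGroup (Fin n)) {x : Diagram β n →₀ K}
    (hx : IsSTU K x) : diagCableLin K φ x ∈ diagRelations K β n' := by
  obtain ⟨D, p, s, t, h, rfl⟩ := hx.exists_split
  simp only [map_add, map_sub, diagCableLin_single, diagCable_fill]
  rw [add_sub_assoc, ← Finsupp.lmapDomain_apply K K, ← Finsupp.lmapDomain_apply K K,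
    ← Finsupp.lmapDomain_apply K K, ← map_sub, cable_split]
  generalize cable K φ D.places = c
  induction c using Finsupp.induction_linear with
  | zero => simp
  | add c d hc hd =>
    convert (diagRelations K β n').add_mem hc hd using 1
    simp only [map_add, map_sub, Finsupp.mapDomain_add]
    abel
  | single v r =>
    rw [← mul_one r, ← smul_eq_mul, ← Finsupp.smul_single]
    simp only [Finsupp.mapDomain_smul, map_smul, ← smul_sub, ← smul_add]
    refine Submodule.smul_mem _ _ (Submodule.subset_span (Or.inr ?_))
    simp only [Finsupp.lmapDomain_apply, Finsupp.mapDomain_single, map_sub]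
    rw [← add_sub_assoc]
    exact isSTU_split K D.forest p s t h v

theorem diagRelations_cable (φ : FreeGroup (Fin n') →* FreeGroup (Fin n)) :
    diagRelations K β n ≤ (diagRelations K β n').comap (diagCableLin K φ) := by
  refine Submodule.span_le.2 ?_
  rintro _ (⟨l, r, E, hr, rfl⟩ | hx)
  · have h : ∀ r : Forest (Fin l) β →₀ K,
        diagCableLin K φ (Finsupp.lmapDomain K K (fun F => E.act F) r) =
        Finsupp.linearCombination K (fun E' : Diagram (Fin l) n' =>
          Finsupp.lmapDomain K K (fun F => E'.act F) r) (diagCable K φ E) := by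
      intro r
      induction r using Finsupp.induction_linear with
      | zero => simp [Finsupp.linearCombination_apply]
      | add r r' h h' =>
        simp only [map_add, h, h', Finsupp.linearCombination_apply, smul_add, Finsupp.sum_add]
      | single F a =>
        rw [← mul_one a, ← smul_eq_mul, ← Finsupp.smul_single]
        simp only [map_smul, Finsupp.lmapDomain_apply, Finsupp.mapDomain_single]
        have := diagCableLin_act K φ F (Finsupp.single E 1)
        simp only [Finsupp.lmapDomain_apply, Finsupp.mapDomain_single, diagCableLin_single] at this
        rw [diagCableLin_single, this, Finsupp.linearCombination_apply, Finsupp.mapDomain,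
          Finsupp.smul_sum]
        refine Finsupp.sum_congr fun E' _ => ?_
        simp [mul_comm]
    rw [SetLike.mem_coe, Submodule.mem_comap, h, Finsupp.linearCombination_apply]
    exact Submodule.sum_mem _ fun E' _ => Submodule.smul_mem _ _
      (Submodule.subset_span (Or.inl ⟨l, r, E', hr, rfl⟩))
  · exact diagCable_stu K φ hx

end DiagramCabling

section LieToAss
variable (K : Type u) [CommRing K] {I J β γ : Type} [Fintype I] [DecidableEq I] [Fintype J]
  [DecidableEq J] [Fintype β] [DecidableEq β] [DecidableEq γ] {m n n' : ℕ}

/-- The noncommutative polynomial of a tree, every vertex being read as a commutator. -/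
noncomputable def lieExp : FreeMagma β → MonoidAlgebra K (FreeMonoid β)
  | .of a => MonoidAlgebra.single (FreeMonoid.of a) 1
  | .mul s t => lieExp s * lieExp t - lieExp t * lieExp s

@[simp] theorem lieExp_of (a : β) :
    lieExp K (FreeMagma.of a) = MonoidAlgebra.single (FreeMonoid.of a) 1 := rfl

@[simp] theorem lieExp_mul (s t : FreeMagma β) :
    lieExp K (s * t) = lieExp K s * lieExp K t - lieExp K t * lieExp K s := rfl

/-- The tuple of one-letter words. -/
def WordTuple.id (n : ℕ) : WordTuple (Fin n) n := ⟨fun i => [i], EachOnce.singleton⟩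

/-- The coefficient of a word in a noncommutative polynomial. -/
noncomputable def wordCoeff (l : List β) : MonoidAlgebra K (FreeMonoid β) →ₗ[K] K :=
  (Finsupp.lapply (FreeMonoid.ofList l)).comp (MonoidAlgebra.coeffLinearEquiv K).toLinearMap

/-- The associative operation of a Lie operation: the product of the commutators given by the
trees of the forest, as a combination of tuples of words. -/
noncomputable def forestExp (F : Forest (Fin n) β) : WordTuple β n →₀ K :=
  Finsupp.equivFunOnFinite.symm fun w => ∏ k, wordCoeff K (w.1 k) (lieExp K (F.1 k))

/-- Substitution of noncommutative polynomials in a tuple of words (multilinear part). -/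
noncomputable def wordSubst (u : WordTuple I n) (X : I → MonoidAlgebra K (FreeMonoid β)) :
    WordTuple β n →₀ K :=
  Finsupp.equivFunOnFinite.symm fun w => ∏ k, wordCoeff K (w.1 k) ((u.1 k).map X).prod

theorem wordSubst_apply (u : WordTuple I n) (X : I → MonoidAlgebra K (FreeMonoid β))
    (w : WordTuple β n) :
    wordSubst K u X w = ∏ k, wordCoeff K (w.1 k) ((u.1 k).map X).prod := rfl

theorem forestExp_apply (F : Forest (Fin n) β) (w : WordTuple β n) :
    forestExp K F w = ∏ k, wordCoeff K (w.1 k) (lieExp K (F.1 k)) := rfl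

theorem wordSubst_linear (u : WordTuple I n) (w : WordTuple β n)
    (X : I → MonoidAlgebra K (FreeMonoid β)) (p : I) :
    ∃ ℓ : MonoidAlgebra K (FreeMonoid β) →ₗ[K] K,
      ∀ a, wordSubst K u (Function.update X p a) w = ℓ a := by
  obtain ⟨k, hk⟩ := u.2.exists_mem p
  obtain ⟨P, Q, hPQ⟩ := List.append_of_mem hk
  have hn := u.2.nodup k
  rw [hPQ, List.nodup_append] at hn
  have hup : ∀ (l : List I), p ∉ l → ∀ a, l.map (Function.update X p a) = l.map X := by
    intro l hl a
    refine List.map_congr_left fun i hi => Function.update_of_ne ?_ _ _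
    rintro rfl
    exact hl hi
  refine ⟨(∏ j ∈ Finset.univ.erase k, wordCoeff K (w.1 j) ((u.1 j).map X).prod) •
    (wordCoeff K (w.1 k)).comp ((LinearMap.mulLeft K (P.map X).prod).comp
      (LinearMap.mulRight K (Q.map X).prod)), fun a => ?_⟩
  rw [wordSubst_apply, ← Finset.prod_erase_mul _ _ (Finset.mem_univ k), hPQ]
  simp only [LinearMap.smul_apply, LinearMap.comp_apply, LinearMap.mulLeft_apply,
    LinearMap.mulRight_apply, smul_eq_mul, List.map_append, List.map_cons, List.prod_append,
    List.prod_cons, Function.update_self]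
  rw [hup P (fun h => hn.2.2 p h p (by simp) rfl), hup Q (List.nodup_cons.1 hn.2.1).1]
  congr 1
  refine Finset.prod_congr rfl fun j hj => ?_
  rw [hup _ fun h => Finset.ne_of_mem_erase hj (u.2.unique h hk)]

theorem multilinear_ext {M : Type*} [AddCommGroup M] [Module K M] {κ : Type*}
    (b : Module.Basis κ K M) {f g : (I → M) → K}
    (hf : ∀ X i, ∃ ℓ : M →ₗ[K] K, ∀ a, f (Function.update X i a) = ℓ a)
    (hg : ∀ X i, ∃ ℓ : M →ₗ[K] K, ∀ a, g (Function.update X i a) = ℓ a)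
    (h : ∀ v : I → κ, f (fun i => b (v i)) = g fun i => b (v i)) : f = g := by
  let mk : ∀ f : (I → M) → K, (∀ X i, ∃ ℓ : M →ₗ[K] K, ∀ a, f (Function.update X i a) = ℓ a) →
      MultilinearMap K (fun _ : I => M) K := fun f hf =>
    MultilinearMap.mk' f
      (fun X i x y => by obtain ⟨ℓ, hℓ⟩ := hf X i; simp only [hℓ, map_add])
      (fun X i c x => by obtain ⟨ℓ, hℓ⟩ := hf X i; simp only [hℓ, map_smul])
  have := Module.Basis.ext_multilinear (f := mk f hf) (g := mk g hg) (fun _ => b) h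
  exact congrArg DFunLike.coe this

theorem wordCoeff_single (l y : List β) :
    wordCoeff K l (MonoidAlgebra.single (FreeMonoid.ofList y) 1) = if y = l then 1 else 0 := by
  refine Eq.trans (b := (Finsupp.single (FreeMonoid.ofList y) (1 : K)) (FreeMonoid.ofList l)) ?_ ?_
  · simp [wordCoeff, MonoidAlgebra.coeffLinearEquiv]
  · classical
    rw [Finsupp.single_apply]
    exact if_congr Iff.rfl rfl rfl

theorem prod_map_single (l : List I) (y : I → List β) :
    (l.map fun i => (MonoidAlgebra.single (FreeMonoid.ofList (y i)) 1 :
      MonoidAlgebra K (FreeMonoid β))).prod =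
        MonoidAlgebra.single (FreeMonoid.ofList (l.flatMap y)) 1 := by
  induction l with
  | nil => rfl
  | cons i l ih =>
    rw [List.map_cons, List.prod_cons, ih, MonoidAlgebra.single_mul_single, one_mul,
      List.flatMap_cons, FreeMonoid.ofList_append]

theorem EachOnce.of_flatMap {κ : Type} [Fintype κ] {w : κ → List I} (hw : EachOnce w)
    {v : I → List J} (h : EachOnce fun k => (w k).flatMap v) : EachOnce v := by
  intro b
  have hl : ∀ l : List I, (l.flatMap v).count b = ∑ i, l.count i * (v i).count b := by
    intro l
    rw [List.count_flatMap, Finset.sum_list_map_count]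
    simp only [Function.comp, smul_eq_mul]
    refine Finset.sum_subset (Finset.subset_univ _) fun i _ hi => ?_
    rw [List.count_eq_zero_of_not_mem (by simpa using hi), zero_mul]
  have hb := h b
  simp only [hl] at hb
  rw [Finset.sum_comm] at hb
  simpa only [← Finset.sum_mul, hw _, one_mul] using hb

theorem wordSubst_single_apply (u : WordTuple I n) (y : I → List β) (w : WordTuple β n) :
    wordSubst K u (fun i => MonoidAlgebra.single (FreeMonoid.ofList (y i)) 1) w =
      if (fun k => (u.1 k).flatMap y) = w.1 then 1 else 0 := by
  rw [wordSubst_apply]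
  simp only [prod_map_single, wordCoeff_single]
  split_ifs with h
  · exact Finset.prod_eq_one fun k _ => if_pos (congrFun h k)
  · obtain ⟨k, hk⟩ := Function.ne_iff.1 h
    exact Finset.prod_eq_zero (Finset.mem_univ k) (if_neg hk)

theorem wordSubst_single (u : WordTuple I n) (y : I → List β) (hy : EachOnce y) :
    wordSubst K u (fun i => MonoidAlgebra.single (FreeMonoid.ofList (y i)) 1) =
      Finsupp.single (u.sub y hy) 1 := by
  ext w
  rw [wordSubst_single_apply, Finsupp.single_apply]
  exact if_congr (Subtype.ext_iff (a1 := u.sub y hy) (a2 := w)).symm rfl rfl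

/-- Substitution can be done after expanding the polynomials. -/
theorem wordSubst_eq (u : WordTuple (Fin m) n) (F : Forest (Fin m) β) :
    wordSubst K u (fun i => lieExp K (F.1 i)) =
      Finsupp.lmapDomain K K (fun x : WordTuple β m => u.sub x.1 x.2) (forestExp K F) := by
  ext w
  let g : (Fin m → MonoidAlgebra K (FreeMonoid β)) → K := fun X =>
    ∑ x : WordTuple β m, if u.sub x.1 x.2 = w then ∏ j, wordCoeff K (x.1 j) (X j) else 0
  have hg : ∀ X i, ∃ ℓ : MonoidAlgebra K (FreeMonoid β) →ₗ[K] K,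
      ∀ a, g (Function.update X i a) = ℓ a := by
    intro X i
    refine ⟨∑ x : WordTuple β m, if u.sub x.1 x.2 = w then
      (∏ j ∈ Finset.univ.erase i, wordCoeff K (x.1 j) (X j)) • wordCoeff K (x.1 i) else 0,
      fun a => ?_⟩
    simp only [g, LinearMap.sum_apply]
    refine Finset.sum_congr rfl fun x _ => ?_
    split_ifs
    · rw [← Finset.prod_erase_mul _ _ (Finset.mem_univ i), Function.update_self]
      rw [LinearMap.smul_apply, smul_eq_mul]
      congr 1
      refine Finset.prod_congr rfl fun j hj => ?_
      rw [Function.update_of_ne (Finset.ne_of_mem_erase hj)]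
    · rfl
  have key : (fun X => wordSubst K u X w) = g := by
    refine multilinear_ext K (MonoidAlgebra.basis (FreeMonoid β) K)
      (fun X i => wordSubst_linear K u w X i) hg fun y => ?_
    have hb : ∀ i, MonoidAlgebra.basis (FreeMonoid β) K (y i) =
        MonoidAlgebra.single (FreeMonoid.ofList (FreeMonoid.toList (y i))) 1 := fun i => by
      simp
    simp only [hb, wordSubst_single_apply, g, wordCoeff_single]
    split_ifs with h
    · have hy : EachOnce fun i => FreeMonoid.toList (y i) :=
        u.2.of_flatMap (by rw [h]; exact w.2)
      refine ((Finset.sum_eq_single (⟨_, hy⟩ : WordTuple β m) ?_ ?_).trans ?_).symm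
      rotate_left 2
      · refine (if_pos (Subtype.ext h)).trans (Finset.prod_eq_one fun j _ => if_pos rfl)
      · intro x _ hx
        split_ifs with hxw
        · obtain ⟨j, hj⟩ := Function.ne_iff.1 fun e => hx (Subtype.ext e)
          exact Finset.prod_eq_zero (Finset.mem_univ j) (if_neg fun e => hj e.symm)
        · rfl
      · exact fun hx => absurd (Finset.mem_univ (α := WordTuple β m) _) hx
    · refine (Finset.sum_eq_zero fun x _ => ?_).symm
      split_ifs with hxw
      · by_contra hne
        refine h ?_
        have : x.1 = fun i => FreeMonoid.toList (y i) := by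
          funext j
          by_contra hj
          exact hne (Finset.prod_eq_zero (Finset.mem_univ j) (if_neg fun e => hj e.symm))
        rw [← this, ← hxw]
        rfl
      · rfl
  refine (congrFun key _).trans ?_
  rw [Finsupp.lmapDomain_apply, Finsupp.mapDomain, Finsupp.sum_fintype _ _ (by simp),
    Finsupp.finsetSum_apply]
  simp only [g, Finsupp.single_apply, forestExp_apply]

theorem lieExp_support (t : FreeMagma β) (l : List β) (h : wordCoeff K l (lieExp K t) ≠ 0) :
    l.Perm (leaves t) := by
  classical
  induction t generalizing l with
  | ih1 a =>
    rw [lieExp_of] at h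
    have := wordCoeff_single K l [a]
    rw [show FreeMonoid.ofList [a] = FreeMonoid.of a from rfl] at this
    rw [this] at h
    have : [a] = l := by
      by_contra hne
      exact h (if_neg hne)
    rw [← this]
    rfl
  | ih2 s t hs ht =>
    have hmul : ∀ x y : MonoidAlgebra K (FreeMonoid β), wordCoeff K l (x * y) ≠ 0 →
        ∃ l₁ l₂, l = l₁ ++ l₂ ∧ wordCoeff K l₁ x ≠ 0 ∧ wordCoeff K l₂ y ≠ 0 := by
      intro x y hxy
      by_contra! hne
      refine hxy ?_
      show (x * y).coeff (FreeMonoid.ofList l) = 0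
      rw [MonoidAlgebra.coeff_mul]
      refine Finset.sum_eq_zero fun l₁ h₁ => Finset.sum_eq_zero fun l₂ _ => ?_
      refine ite_eq_right_iff.2 fun e => ?_
      have h0 := hne l₁.toList l₂.toList (by
        rw [← FreeMonoid.toList_mul, e, FreeMonoid.toList_ofList]) (Finsupp.mem_support_iff.1 h₁)
      exact mul_eq_zero_of_right _ h0
    rw [lieExp_mul, map_sub] at h
    by_cases h1 : wordCoeff K l (lieExp K s * lieExp K t) = 0
    · rw [h1, zero_sub, neg_ne_zero] at h
      obtain ⟨l₁, l₂, rfl, h₁, h₂⟩ := hmul _ _ h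
      exact ((ht _ h₁).append (hs _ h₂)).trans List.perm_append_comm
    · obtain ⟨l₁, l₂, rfl, h₁, h₂⟩ := hmul _ _ h1
      exact (hs _ h₁).append (ht _ h₂)

theorem lieExp_graft (F : β → FreeMagma γ) (t : FreeMagma β) :
    lieExp K (graft F t) = (lieExp K t).coeff.sum fun l r =>
      r • (l.toList.map fun b => lieExp K (F b)).prod := by
  have h : lieExp K (graft F t) =
      MonoidAlgebra.lift K _ _ (FreeMonoid.lift fun b => lieExp K (F b)) (lieExp K t) := by
    induction t with
    | ih1 a => simp
    | ih2 s t hs ht => simp only [graft_mul, lieExp_mul, hs, ht, map_sub, map_mul]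
  rw [h, MonoidAlgebra.lift_apply]
  refine Finsupp.sum_congr fun l _ => ?_
  rw [FreeMonoid.lift_apply]

theorem forestExp_comp (F : Forest (Fin m) β) (G : Forest (Fin n) (Fin m)) :
    forestExp K (F.comp G) = Finsupp.linearCombination K
      (fun u : WordTuple (Fin m) n => wordSubst K u fun i => lieExp K (F.1 i))
        (forestExp K G) := by
  ext w
  rw [Finsupp.linearCombination_apply, Finsupp.sum_fintype _ _ (by simp), Finsupp.finsetSum_apply]
  simp only [Finsupp.smul_apply, wordSubst_apply, forestExp_apply, smul_eq_mul,
    ← Finset.prod_mul_distrib]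
  let f : Fin n → List (Fin m) → K := fun k l =>
    wordCoeff K l (lieExp K (G.1 k)) *
      wordCoeff K (w.1 k) (l.map fun i => lieExp K (F.1 i)).prod
  let S : Fin n → Finset (List (Fin m)) := fun k => (lieExp K (G.1 k)).coeff.support
  have e1 : ∀ k, wordCoeff K (w.1 k) (lieExp K ((F.comp G).1 k)) = ∑ l ∈ S k, f k l := by
    intro k
    refine (congrArg _ (lieExp_graft K F.1 (G.1 k))).trans ?_
    rw [Finsupp.sum, map_sum]
    refine Finset.sum_congr rfl fun l _ => ?_
    rw [map_smul]
    rfl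
  rw [Finset.prod_congr rfl fun k _ => e1 k, Finset.prod_univ_sum]
  have hS : ∀ L ∈ Fintype.piFinset S, EachOnce L := by
    intro L hL a
    rw [← G.2 a]
    refine Finset.sum_congr rfl fun k _ => ?_
    exact (lieExp_support K (G.1 k) (L k)
      (Finsupp.mem_support_iff.1 (Fintype.mem_piFinset.1 hL k))).count_eq a
  let emb : WordTuple (Fin m) n ↪ (Fin n → List (Fin m)) := ⟨fun u => u.1, Subtype.val_injective⟩
  have e2 : ∑ u : WordTuple (Fin m) n, ∏ k, f k (u.1 k) =
      ∑ L ∈ Finset.univ.map emb, ∏ k, f k (L k) :=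
    (Finset.sum_map Finset.univ emb fun L => ∏ k, f k (L k)).symm
  refine Eq.trans ?_ e2.symm
  refine Finset.sum_subset (fun L hL => ?_) fun L _ hL => ?_
  · exact Finset.mem_map.2 ⟨⟨L, hS L hL⟩, Finset.mem_univ _, rfl⟩
  · rw [Fintype.mem_piFinset] at hL
    push Not at hL
    obtain ⟨k, hk⟩ := hL
    refine Finset.prod_eq_zero (Finset.mem_univ k) ?_
    exact mul_eq_zero_of_left (Finsupp.notMem_support_iff.1 hk) _

theorem forestExp_id : forestExp K (Forest.id (Fin n)) =
    Finsupp.single (WordTuple.id n) 1 := by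
  ext w
  rw [Finsupp.single_apply, forestExp_apply]
  have h : ∀ k, wordCoeff K (w.1 k) (lieExp K ((Forest.id (Fin n)).1 k)) =
      if [k] = w.1 k then 1 else 0 := fun k => wordCoeff_single K (w.1 k) [k]
  rw [Finset.prod_congr rfl fun k _ => h k]
  split_ifs with hw
  · subst hw
    exact Finset.prod_eq_one fun k _ => if_pos rfl
  · obtain ⟨k, hk⟩ := Function.ne_iff.1 fun e => hw (Subtype.ext e)
    exact Finset.prod_eq_zero (Finset.mem_univ k) (if_neg hk)

theorem forestExp_relator {r : Forest (Fin n) β →₀ K} (hr : IsRelator K r) :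
    Finsupp.linearCombination K (forestExp K) r = 0 := by
  have key : ∀ (F F' : Forest (Fin n) β) (p : Fin n) (w : WordTuple β n),
      (∀ i, i ≠ p → F'.1 i = F.1 i) → forestExp K F' w =
        wordCoeff K (w.1 p) (lieExp K (F'.1 p)) *
          ∏ k ∈ Finset.univ.erase p, wordCoeff K (w.1 k) (lieExp K (F.1 k)) := by
    intro F F' p w h
    rw [forestExp_apply, ← Finset.mul_prod_erase _ _ (Finset.mem_univ p)]
    congr 1
    exact Finset.prod_congr rfl fun k hk => by rw [h k (Finset.ne_of_mem_erase hk)]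
  cases hr with
  | as F F' p a b hF hF' h =>
    simp only [map_add, Finsupp.linearCombination_single, one_smul]
    ext w
    rw [Finsupp.add_apply, key F F p w fun _ _ => rfl, key F F' p w h, ← add_mul, ← map_add, hF,
      hF']
    simp
  | ihx F F' F'' p a b c hF hF' hF'' h h' =>
    simp only [map_add, Finsupp.linearCombination_single, one_smul]
    ext w
    rw [Finsupp.add_apply, Finsupp.add_apply, key F F p w fun _ _ => rfl, key F F' p w h,
      key F F'' p w h', ← add_mul, ← add_mul, ← map_add, ← map_add, hF, hF', hF'']
    have : lieExp K (a * b * c) + lieExp K (b * c * a) + lieExp K (c * a * b) = 0 := by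
      simp only [lieExp_mul]
      noncomm_ring
    rw [this]
    simp

theorem forestExp_relations (n : ℕ) :
    lieRelations K (Fin n) β ≤ (Finsupp.linearCombination K (forestExp K)).ker := by
  refine Submodule.span_le.2 ?_
  rintro _ ⟨l, r, G, hr, rfl⟩
  let T : (WordTuple β l →₀ K) →ₗ[K] (WordTuple β n →₀ K) := ∑ u : WordTuple (Fin l) n,
    forestExp K G u • Finsupp.lmapDomain K K fun x : WordTuple β l => u.sub x.1 x.2
  have hT : ∀ F : Forest (Fin l) β, forestExp K (F.comp G) = T (forestExp K F) := by
    intro F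
    rw [forestExp_comp, Finsupp.linearCombination_apply, Finsupp.sum_fintype _ _ (by simp)]
    simp only [wordSubst_eq, T, LinearMap.sum_apply, LinearMap.smul_apply]
  have h : (Finsupp.linearCombination K (forestExp K)).comp
      (Finsupp.lmapDomain K K fun F : Forest (Fin l) β => F.comp G) =
      T.comp (Finsupp.linearCombination K (forestExp K)) := by
    refine finsupp_ext K fun F => ?_
    simp [Finsupp.mapDomain_single, hT]
  rw [SetLike.mem_coe, LinearMap.mem_ker]
  refine (LinearMap.congr_fun h r).trans ?_
  rw [LinearMap.comp_apply, forestExp_relator K hr, map_zero]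

/-- The number of vertices of a tree which are not leaves. -/
def nodes : FreeMagma β → ℕ
  | .of _ => 0
  | .mul s t => nodes s + nodes t + 1

theorem wordSubst_split (F : Forest I β) (p : I) (s t : FreeMagma β) (h : F.1 p = s * t)
    (u : WordTuple I n) :
    wordSubst K u (fun i => lieExp K (F.1 i)) =
      wordSubst K (u.sub _ (splitLeft_eachOnce p)) (fun i => lieExp K ((F.split p s t h).1 i)) -
      wordSubst K (u.sub _ (splitRight_eachOnce p)) fun i => lieExp K ((F.split p s t h).1 i) := by
  let X : I → MonoidAlgebra K (FreeMonoid β) := fun i => lieExp K (F.1 i)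
  let Y : Option I → MonoidAlgebra K (FreeMonoid β) := fun i => lieExp K ((F.split p s t h).1 i)
  have hY : ∀ i, i ≠ p → Y (some i) = X i := fun i hi =>
    congrArg (lieExp K) (if_neg hi : (if i = p then s else F.1 i) = F.1 i)
  have hYp : Y (some p) = lieExp K s :=
    congrArg (lieExp K) (if_pos rfl : (if p = p then s else F.1 p) = s)
  have hYn : Y none = lieExp K t := rfl
  have hsub : ∀ (v : I → List (Option I)) (hv : EachOnce v) (w : WordTuple β n),
      wordSubst K (u.sub v hv) Y w = wordSubst K u (fun i => ((v i).map Y).prod) w := by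
    intro v hv w
    rw [wordSubst_apply, wordSubst_apply]
    refine Finset.prod_congr rfl fun k _ => congrArg _ ?_
    show (((u.1 k).flatMap v).map Y).prod = _
    generalize u.1 k = l
    induction l with
    | nil => rfl
    | cons i l ih => rw [List.flatMap_cons, List.map_append, List.prod_append, ih]; simp
  ext w
  rw [Finsupp.sub_apply, hsub, hsub]
  obtain ⟨ℓ, hℓ⟩ := wordSubst_linear K u w X p
  have e1 : (fun i => ((splitLeft p i).map Y).prod) =
      Function.update X p (lieExp K s * lieExp K t) := by
    funext i
    by_cases hi : i = p
    · subst hi; simp [splitLeft, hYp, hYn]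
    · simp [splitLeft, hi, hY i hi]
  have e2 : (fun i => ((splitRight p i).map Y).prod) =
      Function.update X p (lieExp K t * lieExp K s) := by
    funext i
    by_cases hi : i = p
    · subst hi; simp [splitRight, hYp, hYn]
    · simp [splitRight, hi, hY i hi]
  have e3 : X = Function.update X p (lieExp K s * lieExp K t - lieExp K t * lieExp K s) := by
    rw [← lieExp_mul, ← h]
    exact (Function.update_eq_self p X).symm
  rw [e1, e2, hℓ, hℓ, ← map_sub, ← hℓ, ← e3]

/-- Cabling commutes with substitution of commutators. -/
theorem cable_wordSubst (φ : FreeGroup (Fin n') →* FreeGroup (Fin n)) (F : Forest I β)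
    (u : WordTuple I n) :
    cableLin K φ (wordSubst K u fun i => lieExp K (F.1 i)) =
      Finsupp.linearCombination K (fun v : WordTuple I n' =>
        wordSubst K v fun i => lieExp K (F.1 i)) (cable K φ u) := by
  induction hN : ∑ i, nodes (F.1 i) using Nat.strong_induction_on generalizing I with
  | _ N ih =>
  subst hN
  by_cases hF : ∀ i, nodes (F.1 i) = 0
  · have hF' : ∀ i, ∃ b, F.1 i = FreeMagma.of b := by
      intro i
      have := hF i
      cases hi : F.1 i with
      | of b => exact ⟨b, rfl⟩
      | mul s t => rw [hi] at this; exact absurd this (Nat.succ_ne_zero _)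
    choose e he using hF'
    have hE : EachOnce fun i => [e i] := by
      have := F.2
      simpa only [he, leaves_of] using this
    have hb : e.Bijective := by
      constructor
      · intro i j hij
        exact hE.unique (a := e i) (by simp) (by simp [hij])
      · intro b
        obtain ⟨i, hi⟩ := hE.exists_mem b
        exact ⟨i, by simpa [eq_comm] using hi⟩
    have hs : ∀ {n : ℕ} (v : WordTuple I n), wordSubst K v (fun i => lieExp K (F.1 i)) =
        Finsupp.single (v.sub (fun i => [e i]) hE) 1 := by
      intro n v
      rw [← wordSubst_single]
      simp only [he]
      rfl
    simp only [hs]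
    rw [cableLin_single, one_smul]
    refine (cableLin_relabel K φ (Equiv.ofBijective e hb) hE u).trans ?_
    rw [Finsupp.linearCombination_apply, Finsupp.mapDomain]
    simp
  · push Not at hF
    obtain ⟨p, hp⟩ := hF
    obtain ⟨s, t, h⟩ : ∃ s t, F.1 p = s * t := by
      cases hi : F.1 p with
      | of b => rw [hi] at hp; exact absurd rfl hp
      | mul s t => exact ⟨s, t, rfl⟩
    have hlt : ∑ o, nodes ((F.split p s t h).1 o) < ∑ i, nodes (F.1 i) := by
      rw [Fintype.sum_option, ← Finset.add_sum_erase _ _ (Finset.mem_univ p),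
        ← Finset.add_sum_erase _ (fun i => nodes (F.1 i)) (Finset.mem_univ p), h]
      have h1 : ∑ i ∈ Finset.univ.erase p, nodes ((F.split p s t h).1 (some i)) =
          ∑ i ∈ Finset.univ.erase p, nodes (F.1 i) := Finset.sum_congr rfl fun i hi =>
        congrArg nodes (if_neg (Finset.ne_of_mem_erase hi) : (if i = p then s else F.1 i) = F.1 i)
      have h2 : nodes ((F.split p s t h).1 (some p)) = nodes s :=
        congrArg nodes (if_pos rfl : (if p = p then s else F.1 p) = s)
      have h3 : nodes ((F.split p s t h).1 none) = nodes t := rfl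
      have h4 : nodes (s * t) = nodes s + nodes t + 1 := rfl
      rw [h1, h2, h3, h4]
      omega
    have ih' := fun v => ih _ hlt (F.split p s t h) v rfl
    rw [wordSubst_split K F p s t h u, map_sub, ih', ih', ← map_sub, cable_split, map_sub]
    simp only [wordSubst_split K F p s t h, Finsupp.linearCombination_mapDomain]
    simp only [Finsupp.linearCombination_apply, smul_sub, Finsupp.sum_sub]
    rfl

end LieToAss

section Categories

/-- The objects of the opposite `gr^op` of the category of finitely generated free groups. -/
structure GrOp where
  /-- The rank of the free group. -/
  rank : ℕ

/-- A morphism `m ⟶ n` of `gr^op` is a homomorphism `F_n → F_m`. -/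
instance : Category GrOp where
  Hom m n := FreeGroup (Fin n.rank) →* FreeGroup (Fin m.rank)
  id m := MonoidHom.id (FreeGroup (Fin m.rank))
  comp f g := MonoidHom.comp f g

/-- The objects of the PROP of unital associative algebras in sets. -/
structure AssOp where
  /-- The number of tensor factors. -/
  arity : ℕ

theorem WordTuple.sub_id {m n : ℕ} (u : WordTuple (Fin m) n) : u.sub _ (WordTuple.id m).2 = u :=
  Subtype.ext (funext fun _ => List.flatMap_singleton' _)

theorem WordTuple.id_sub {m n : ℕ} (u : WordTuple (Fin m) n) :
    (WordTuple.id n).sub u.1 u.2 = u :=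
  Subtype.ext (funext fun _ => List.append_nil _)

theorem WordTuple.sub_sub {J : Type} [Fintype J] [DecidableEq J] {m n p : ℕ} (u : WordTuple (Fin n) p) (v : WordTuple (Fin m) n) (w : Fin m → List J)
    (hw : EachOnce w) : (u.sub v.1 v.2).sub w hw = u.sub (v.sub w hw).1 (v.sub w hw).2 :=
  Subtype.ext (funext fun _ => List.flatMap_assoc)

/-- A morphism `m ⟶ n` is an `n`-tuple of words in which each of the inputs `1, …, m` occurs
exactly once, i.e. the operation `a_1 ⊗ … ⊗ a_m ↦ (product of the first word) ⊗ …`; the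
composition is substitution of words. -/
instance : Category AssOp where
  Hom m n := WordTuple (Fin m.arity) n.arity
  id m := WordTuple.id m.arity
  comp f g := WordTuple.sub g f.1 f.2
  id_comp f := WordTuple.sub_id f
  comp_id f := WordTuple.id_sub f
  assoc f g h := (WordTuple.sub_sub h g f.1 f.2).symm

/-- The `K`-linearization of `gr^op`. -/
abbrev KGrOp (K : Type u) : Type := Free K GrOp

/-- The `K`-linear PROP of unital associative algebras; the tuples of words are a basis of its
hom-spaces. -/
abbrev CatAss (K : Type u) : Type := Free K AssOp

/-- The objects of the `K`-linear PROP of Lie algebras. -/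
structure CatLie (K : Type u) where
  /-- The number of tensor factors. -/
  arity : ℕ

instance (K : Type u) : DecidableEq (CatLie K) := fun a b =>
  decidable_of_iff (a.arity = b.arity)
    ⟨fun h => by cases a; cases b; cases h; rfl, fun h => congrArg _ h⟩

variable (K : Type u) [CommRing K]

/-- Linear combinations of `n`-tuples of trees with leaves labelled bijectively by `1, …, m`,
modulo antisymmetry and IHX. -/
abbrev LieTrees (m n : ℕ) : Type u :=
  (Forest (Fin n) (Fin m) →₀ K) ⧸ lieRelations K (Fin n) (Fin m)

/-- The composition of the PROP of Lie algebras: the trees of the first morphism are grafted on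
the leaves of the second one. -/
noncomputable def lieComp (l m n : ℕ) :
    LieTrees K l m →ₗ[K] LieTrees K m n →ₗ[K] LieTrees K l n :=
  bilinQ (fun (F : Forest (Fin m) (Fin l)) (G : Forest (Fin n) (Fin m)) => F.comp G)
    (fun F => lieRelations_comp_left F) (fun G => lieRelations_comp_right G)

/-- The class of a forest. -/
noncomputable def lieMk {m n : ℕ} (F : Forest (Fin n) (Fin m)) : LieTrees K m n :=
  Submodule.mkQ _ (Finsupp.single F 1)

variable {K} in
theorem lie_ind {m n : ℕ} {P : LieTrees K m n → Prop} (zero : P 0) (single : ∀ F, P (lieMk K F))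
    (add : ∀ x y, P x → P y → P (x + y)) (smul : ∀ (r : K) x, P x → P (r • x))
    (x : LieTrees K m n) : P x := quot_ind zero single add smul x

theorem lieComp_mk {l m n : ℕ} (F : Forest (Fin m) (Fin l)) (G : Forest (Fin n) (Fin m)) :
    lieComp K l m n (lieMk K F) (lieMk K G) = lieMk K (F.comp G) :=
  bilinQ_single _ _ _ _ _

theorem lieComp_id_left {m n : ℕ} (f : LieTrees K m n) :
    lieComp K m m n (lieMk K (Forest.id (Fin m))) f = f := by
  induction f using lie_ind with
  | zero => rw [map_zero]
  | single F => rw [lieComp_mk, Forest.id_comp]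
  | add f g hf hg => rw [map_add, hf, hg]
  | smul r f hf => rw [map_smul, hf]

theorem lieComp_id_right {m n : ℕ} (f : LieTrees K m n) :
    lieComp K m n n f (lieMk K (Forest.id (Fin n))) = f := by
  induction f using lie_ind with
  | zero => rw [map_zero, LinearMap.zero_apply]
  | single F => rw [lieComp_mk, Forest.comp_id]
  | add f g hf hg => rw [map_add, LinearMap.add_apply, hf, hg]
  | smul r f hf => rw [map_smul, LinearMap.smul_apply, hf]

theorem lieComp_assoc {l m n p : ℕ} (f : LieTrees K l m) (g : LieTrees K m n)
    (h : LieTrees K n p) :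
    lieComp K l n p (lieComp K l m n f g) h = lieComp K l m p f (lieComp K m n p g h) := by
  induction f using lie_ind with
  | zero => simp only [map_zero, LinearMap.zero_apply]
  | add f f' hf hf' => simp only [map_add, LinearMap.add_apply, hf, hf']
  | smul r f hf => simp only [map_smul, LinearMap.smul_apply, hf]
  | single F =>
    induction g using lie_ind with
    | zero => simp only [map_zero, LinearMap.zero_apply]
    | add f f' hf hf' => simp only [map_add, LinearMap.add_apply, hf, hf']
    | smul r f hf => simp only [map_smul, LinearMap.smul_apply, hf]
    | single G =>
      induction h using lie_ind with
      | zero => simp only [map_zero]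
      | add f f' hf hf' => simp only [map_add, hf, hf']
      | smul r f hf => simp only [map_smul, hf]
      | single H => simp only [lieComp_mk, Forest.comp_assoc]

noncomputable instance : Category (CatLie K) where
  Hom m n := LieTrees K m.arity n.arity
  id m := lieMk K (Forest.id (Fin m.arity))
  comp {l m n} f g := lieComp K l.arity m.arity n.arity f g
  id_comp f := lieComp_id_left K f
  comp_id f := lieComp_id_right K f
  assoc f g h := lieComp_assoc K f g h

noncomputable instance : Preadditive (CatLie K) where
  homGroup m n := inferInstanceAs (AddCommGroup (LieTrees K m.arity n.arity))
  add_comp l m n f f' g := LinearMap.map_add₂ (lieComp K l.arity m.arity n.arity) f f' g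
  comp_add l m n f g g' := LinearMap.map_add (lieComp K l.arity m.arity n.arity f) g g'

noncomputable instance : Linear K (CatLie K) where
  homModule m n := inferInstanceAs (Module K (LieTrees K m.arity n.arity))
  smul_comp l m n r f g := LinearMap.map_smul₂ (lieComp K l.arity m.arity n.arity) r f g
  comp_smul l m n f r g := LinearMap.map_smul (lieComp K l.arity m.arity n.arity f) r g

/-- The linear map induced by `forestExp`. -/
noncomputable def lieExpand (m n : ℕ) : LieTrees K m n →ₗ[K] (WordTuple (Fin m) n →₀ K) :=
  (lieRelations K (Fin n) (Fin m)).liftQ (Finsupp.linearCombination K (forestExp K))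
    (forestExp_relations K n)

theorem lieExpand_mk {m n : ℕ} (F : Forest (Fin n) (Fin m)) :
    lieExpand K m n (lieMk K F) = forestExp K F := by
  simp [lieExpand, lieMk]

/-- The composition of linear combinations of tuples of words. -/
noncomputable def assComp (l m n : ℕ) : (WordTuple (Fin l) m →₀ K) →ₗ[K]
    (WordTuple (Fin m) n →₀ K) →ₗ[K] (WordTuple (Fin l) n →₀ K) :=
  CategoryTheory.Linear.comp (S := K) (Free.of K (AssOp.mk l)) (Free.of K (AssOp.mk m)) (Free.of K (AssOp.mk n))

theorem assComp_apply {l m n : ℕ} (f : WordTuple (Fin l) m →₀ K) (g : WordTuple (Fin m) n →₀ K) :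
    assComp K l m n f g = Finsupp.linearCombination K (fun u : WordTuple (Fin m) n =>
      Finsupp.lmapDomain K K (fun x : WordTuple (Fin l) m => u.sub x.1 x.2) f) g := by
  have h : assComp K l m n f g = f.sum fun x s => g.sum fun u t =>
    (Finsupp.single (u.sub x.1 x.2) (s * t) : WordTuple (Fin l) n →₀ K) := rfl
  rw [h, Finsupp.sum_comm, Finsupp.linearCombination_apply]
  refine Finsupp.sum_congr fun u _ => ?_
  rw [Finsupp.lmapDomain_apply, Finsupp.mapDomain, Finsupp.smul_sum]
  refine Finsupp.sum_congr fun x _ => ?_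
  rw [Finsupp.smul_single, smul_eq_mul, mul_comm]

theorem lieExpand_comp {l m n : ℕ} (f : LieTrees K l m) (g : LieTrees K m n) :
    lieExpand K l n (lieComp K l m n f g) =
      assComp K l m n (lieExpand K l m f) (lieExpand K m n g) := by
  induction f using lie_ind with
  | zero => simp only [map_zero, LinearMap.zero_apply]
  | add f f' hf hf' => simp only [map_add, LinearMap.add_apply, hf, hf']
  | smul r f hf => simp only [map_smul, LinearMap.smul_apply, hf]
  | single F =>
    induction g using lie_ind with
    | zero => simp only [map_zero]
    | add f f' hf hf' => simp only [map_add, hf, hf']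
    | smul r f hf => simp only [map_smul, hf]
    | single G =>
      rw [lieComp_mk, lieExpand_mk, lieExpand_mk, lieExpand_mk, assComp_apply, forestExp_comp]
      simp only [wordSubst_eq]

/-- The morphism of `K`-linear PROPs from the one for Lie algebras to the one for associative
algebras which sends the bracket to the commutator. -/
noncomputable def lieToAss : CatLie K ⥤ CatAss K where
  obj m := Free.of K ⟨m.arity⟩
  map {m n} f := lieExpand K m.arity n.arity f
  map_id _ := (lieExpand_mk K _).trans (forestExp_id K)
  map_comp f g := lieExpand_comp K f g

end Categories

section Bimodules
open scoped TensorProduct DirectSum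
variable (K : Type u) [CommRing K] (C D : Type) [Category.{u} C] [Preadditive C] [Linear K C]
  [Category.{u} D] [Preadditive D] [Linear K D]

/-- A `(C, D)`-bimodule for two `K`-linear categories, i.e. a `K`-linear functor from
`D^op ⊗ C` to the category of `K`-modules. -/
structure Bimod where
  /-- The value at a pair of objects. -/
  obj : D → C → ModuleCat.{u} K
  /-- The covariant action of `C`. -/
  left (d : D) {c c' : C} : (c ⟶ c') →ₗ[K] obj d c →ₗ[K] obj d c'
  /-- The contravariant action of `D`. -/
  right (c : C) {d' d : D} : (d' ⟶ d) →ₗ[K] obj d c →ₗ[K] obj d' c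
  left_id (d : D) (c : C) (x : obj d c) : left d (𝟙 c) x = x
  left_comp (d : D) {c c' c'' : C} (g : c ⟶ c') (h : c' ⟶ c'') (x : obj d c) :
    left d (g ≫ h) x = left d h (left d g x)
  right_id (c : C) (d : D) (x : obj d c) : right c (𝟙 d) x = x
  right_comp (c : C) {d'' d' d : D} (e : d'' ⟶ d') (f : d' ⟶ d) (x : obj d c) :
    right c (e ≫ f) x = right c e (right c f x)
  left_right {c c' : C} {d' d : D} (g : c ⟶ c') (f : d' ⟶ d) (x : obj d c) :
    left d' g (right c f x) = right c' f (left d g x)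

variable {K C D}

/-- An isomorphism of bimodules. -/
structure BimodIso (B B' : Bimod K C D) where
  /-- The components. -/
  equiv (d : D) (c : C) : B.obj d c ≃ₗ[K] B'.obj d c
  map_left (d : D) {c c' : C} (g : c ⟶ c') (x : B.obj d c) :
    equiv d c' (B.left d g x) = B'.left d g (equiv d c x)
  map_right (c : C) {d' d : D} (f : d' ⟶ d) (x : B.obj d c) :
    equiv d' c (B.right c f x) = B'.right c f (equiv d c x)

variable (K C) in
/-- `K`-linear functors to the category of `K`-modules. -/
def IsLinear : ObjectProperty (C ⥤ ModuleCat.{u} K) := fun F => F.Additive ∧ F.Linear K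

variable (K C) in
/-- The category of modules over a `K`-linear category `C`: the `K`-linear functors from `C` to
the category of `K`-modules. -/
abbrev LinMod := (IsLinear K C).FullSubcategory

theorem LinMod.map_add (M : LinMod K C) {c c' : C} (f g : c ⟶ c') :
    M.obj.map (f + g) = M.obj.map f + M.obj.map g := by
  have := M.property.1
  exact M.obj.map_add

theorem LinMod.map_smul (M : LinMod K C) {c c' : C} (r : K) (f : c ⟶ c') :
    M.obj.map (r • f) = r • M.obj.map f := by
  have := M.property.2
  exact M.obj.map_smul r f

namespace Bimod
variable (B : Bimod K C D)

/-- The `C`-module `B(d, -)`. -/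
def row (d : D) : LinMod K C where
  obj :=
    { obj := B.obj d
      map g := ModuleCat.ofHom (B.left d g)
      map_id c := by ext x; exact B.left_id d c x
      map_comp g h := by ext x; exact B.left_comp d g h x }
  property :=
    ⟨⟨fun {c c'} g h => by ext x; exact LinearMap.congr_fun ((B.left d).map_add g h) x⟩,
     ⟨fun {c c'} g r => by ext x; exact LinearMap.congr_fun ((B.left d).map_smul r g) x⟩⟩

/-- The `C`-modules `B(d, -)` depend contravariantly on `d`. -/
def rows : D ⥤ (LinMod K C)ᵒᵖ where
  obj d := Opposite.op (B.row d)
  map {d' d} f := Quiver.Hom.op (ObjectProperty.homMk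
    { app c := ModuleCat.ofHom (B.right c f)
      naturality c c' g := by ext x; exact (B.left_right g f x).symm } : B.row d ⟶ B.row d')
  map_id d := by
    apply Quiver.Hom.unop_inj
    ext c x
    exact B.right_id c d x
  map_comp {d'' d' d} e f := by
    apply Quiver.Hom.unop_inj
    ext c x
    exact B.right_comp c e f x

/-- The functor `Hom_C(B, -)`, with values `d ↦ Hom_C(B(d, -), N)`. -/
noncomputable def homFunctor : LinMod K C ⥤ LinMod K D where
  obj N :=
    { obj := B.rows ⋙ (linearYoneda K (LinMod K C)).obj N
      property := by
        refine ⟨⟨fun {d' d} f g => ?_⟩, ⟨fun {d' d} f r => ?_⟩⟩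
        · refine ModuleCat.hom_ext (LinearMap.ext fun (φ : B.row d' ⟶ N) => ?_)
          refine Eq.trans (congrArg (· ≫ φ) ?_)
            (Preadditive.add_comp _ _ _ (B.rows.map f).unop (B.rows.map g).unop φ)
          ext c x
          exact LinearMap.congr_fun ((B.right c).map_add f g) x
        · refine ModuleCat.hom_ext (LinearMap.ext fun (φ : B.row d' ⟶ N) => ?_)
          refine Eq.trans (congrArg (· ≫ φ) ?_)
            (Linear.smul_comp _ _ _ r (B.rows.map f).unop φ)
          ext c x
          exact LinearMap.congr_fun ((B.right c).map_smul r f) x }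
  map α := ObjectProperty.homMk (Functor.whiskerLeft B.rows ((linearYoneda K (LinMod K C)).map α))
  map_id N := by
    ext d φ
    rfl
  map_comp α β := by
    ext d φ
    rfl

variable [DecidableEq D]

/-- The submodule of `⨁ d, B(d, c) ⊗ M(d)` generated by the elements `b f ⊗ y - b ⊗ f y`. -/
def balance (M : LinMod K D) (c : C) : Submodule K (⨁ d, B.obj d c ⊗[K] M.obj.obj d) :=
  Submodule.span K {z | ∃ (d' d : D) (f : d' ⟶ d) (b : B.obj d c) (y : M.obj.obj d'),
    z = DirectSum.lof K D (fun d => B.obj d c ⊗[K] M.obj.obj d) d' (B.right c f b ⊗ₜ[K] y) -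
      DirectSum.lof K D (fun d => B.obj d c ⊗[K] M.obj.obj d) d (b ⊗ₜ[K] M.obj.map f y)}

/-- The value at `c` of the tensor product `B ⊗_D M`. -/
abbrev TensorObj (M : LinMod K D) (c : C) : Type u :=
  (⨁ d, B.obj d c ⊗[K] M.obj.obj d) ⧸ B.balance M c

/-- The class of `b ⊗ y` in `B ⊗_D M`. -/
noncomputable def tmul (M : LinMod K D) (c : C) (d : D) :
    B.obj d c →ₗ[K] M.obj.obj d →ₗ[K] B.TensorObj M c :=
  (TensorProduct.mk K (B.obj d c) (M.obj.obj d)).compr₂ ((B.balance M c).mkQ.comp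
    (DirectSum.lof K D (fun d => B.obj d c ⊗[K] M.obj.obj d) d))

theorem tmul_balance (M : LinMod K D) (c : C) {d' d : D} (f : d' ⟶ d) (b : B.obj d c)
    (y : M.obj.obj d') : B.tmul M c d' (B.right c f b) y = B.tmul M c d b (M.obj.map f y) :=
  (Submodule.Quotient.eq _).2 (Submodule.subset_span ⟨d', d, f, b, y, rfl⟩)

theorem tensor_ext {M : LinMod K D} {c : C} {V : Type*} [AddCommGroup V] [Module K V]
    {f g : B.TensorObj M c →ₗ[K] V}
    (h : ∀ d b y, f (B.tmul M c d b y) = g (B.tmul M c d b y)) : f = g := by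
  refine Submodule.linearMap_qext _ (DirectSum.linearMap_ext K fun d => ?_)
  exact TensorProduct.ext' (h d)

/-- The universal property of the tensor product. -/
noncomputable def tensorLift (M : LinMod K D) (c : C) {V : Type*} [AddCommGroup V] [Module K V]
    (φ : ∀ d, B.obj d c →ₗ[K] M.obj.obj d →ₗ[K] V)
    (hφ : ∀ (d' d : D) (f : d' ⟶ d) b y, φ d' (B.right c f b) y = φ d b (M.obj.map f y)) :
    B.TensorObj M c →ₗ[K] V :=
  (B.balance M c).liftQ (DirectSum.toModule K D V fun d => TensorProduct.lift (φ d)) (by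
    refine Submodule.span_le.2 ?_
    rintro _ ⟨d', d, f, b, y, rfl⟩
    simp [hφ])

@[simp] theorem tensorLift_tmul (M : LinMod K D) (c : C) {V : Type*} [AddCommGroup V] [Module K V]
    (φ : ∀ d, B.obj d c →ₗ[K] M.obj.obj d →ₗ[K] V)
    (hφ : ∀ (d' d : D) (f : d' ⟶ d) b y, φ d' (B.right c f b) y = φ d b (M.obj.map f y))
    (d : D) (b : B.obj d c) (y : M.obj.obj d) :
    B.tensorLift M c φ hφ (B.tmul M c d b y) = φ d b y := by
  show DirectSum.toModule K D V (fun d => TensorProduct.lift (φ d))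
    (DirectSum.lof K D (fun d => B.obj d c ⊗[K] M.obj.obj d) d (b ⊗ₜ[K] y)) = _
  rw [DirectSum.toModule_lof, TensorProduct.lift.tmul]

/-- `g (b ⊗ y) = g b ⊗ y`. -/
noncomputable def tensorMap (M : LinMod K D) {c c' : C} (g : c ⟶ c') :
    B.TensorObj M c →ₗ[K] B.TensorObj M c' :=
  B.tensorLift M c (fun d => (B.tmul M c' d).comp (B.left d g)) fun d' d f b y => by
    rw [LinearMap.comp_apply, B.left_right, B.tmul_balance, LinearMap.comp_apply]

@[simp] theorem tensorMap_tmul (M : LinMod K D) {c c' : C} (g : c ⟶ c') (d : D) (b : B.obj d c)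
    (y : M.obj.obj d) : B.tensorMap M g (B.tmul M c d b y) = B.tmul M c' d (B.left d g b) y :=
  B.tensorLift_tmul M c _ _ d b y

/-- `α (b ⊗ y) = b ⊗ α y`. -/
noncomputable def tensorMapRight {M M' : LinMod K D} (α : M ⟶ M') (c : C) :
    B.TensorObj M c →ₗ[K] B.TensorObj M' c :=
  B.tensorLift M c (fun d => (B.tmul M' c d).compl₂ (α.hom.app d).hom) fun d' d f b y => by
    rw [LinearMap.compl₂_apply, LinearMap.compl₂_apply, B.tmul_balance]
    congr 1
    exact (NatTrans.naturality_apply α.hom f y).symm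

@[simp] theorem tensorMapRight_tmul {M M' : LinMod K D} (α : M ⟶ M') (c : C) (d : D)
    (b : B.obj d c) (y : M.obj.obj d) :
    B.tensorMapRight α c (B.tmul M c d b y) = B.tmul M' c d b (α.hom.app d y) :=
  B.tensorLift_tmul M c _ _ d b y

/-- The functor `B ⊗_D -`. -/
noncomputable def tensorFunctor : LinMod K D ⥤ LinMod K C where
  obj M :=
    { obj :=
        { obj c := ModuleCat.of K (B.TensorObj M c)
          map g := ModuleCat.ofHom (B.tensorMap M g)
          map_id c := ModuleCat.hom_ext (B.tensor_ext fun d b y => by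
            simp [B.left_id])
          map_comp g h := ModuleCat.hom_ext (B.tensor_ext fun d b y => by
            simp [B.left_comp]) }
      property :=
        ⟨⟨fun {c c'} g h => ModuleCat.hom_ext (B.tensor_ext fun d b y => by simp)⟩,
         ⟨fun {c c'} g r => ModuleCat.hom_ext (B.tensor_ext fun d b y => by simp)⟩⟩ }
  map α := ObjectProperty.homMk
    { app c := ModuleCat.ofHom (B.tensorMapRight α c)
      naturality c c' g := ModuleCat.hom_ext (B.tensor_ext fun d b y => by simp) }
  map_id M := by
    ext c : 3
    exact ModuleCat.hom_ext (B.tensor_ext fun d b y => by simp)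
  map_comp α β := by
    ext c : 3
    exact ModuleCat.hom_ext (B.tensor_ext fun d b y => by simp)

end Bimod
end Bimodules

section Concrete
variable (K : Type u) [CommRing K]

/-- The composition of linear combinations of group homomorphisms. -/
noncomputable def grComp (l m n : ℕ) : ((FreeGroup (Fin m) →* FreeGroup (Fin l)) →₀ K) →ₗ[K]
    ((FreeGroup (Fin n) →* FreeGroup (Fin m)) →₀ K) →ₗ[K]
      ((FreeGroup (Fin n) →* FreeGroup (Fin l)) →₀ K) :=
  CategoryTheory.Linear.comp (S := K) (Free.of K (GrOp.mk l)) (Free.of K (GrOp.mk m))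
    (Free.of K (GrOp.mk n))

theorem grComp_single {l m n : ℕ} (φ : FreeGroup (Fin m) →* FreeGroup (Fin l))
    (ψ : FreeGroup (Fin n) →* FreeGroup (Fin m)) :
    grComp K l m n (Finsupp.single φ 1) (Finsupp.single ψ 1) =
      Finsupp.single (φ.comp ψ) 1 := by
  have := Free.single_comp_single K GrOp (X := GrOp.mk l) (Y := GrOp.mk m)
    (Z := GrOp.mk n) φ ψ 1 1
  rw [mul_one] at this
  exact this

/-- A functor on `gr^op` extended to linear combinations of morphisms. -/
noncomputable def grAct {V : ℕ → Type u} [∀ n, AddCommGroup (V n)] [∀ n, Module K (V n)]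
    (a : ∀ {n n' : ℕ}, (FreeGroup (Fin n') →* FreeGroup (Fin n)) → V n →ₗ[K] V n') (n n' : ℕ) :
    ((FreeGroup (Fin n') →* FreeGroup (Fin n)) →₀ K) →ₗ[K] V n →ₗ[K] V n' :=
  Finsupp.linearCombination K a

theorem grAct_single {V : ℕ → Type u} [∀ n, AddCommGroup (V n)] [∀ n, Module K (V n)]
    (a : ∀ {n n' : ℕ}, (FreeGroup (Fin n') →* FreeGroup (Fin n)) → V n →ₗ[K] V n') {n n' : ℕ}
    (φ : FreeGroup (Fin n') →* FreeGroup (Fin n)) :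
    grAct K a n n' (Finsupp.single φ 1) = a φ := by
  simp [grAct]

theorem grAct_comp {V : ℕ → Type u} [∀ n, AddCommGroup (V n)] [∀ n, Module K (V n)]
    (a : ∀ {n n' : ℕ}, (FreeGroup (Fin n') →* FreeGroup (Fin n)) → V n →ₗ[K] V n')
    (ha : ∀ {l m n : ℕ} (φ : FreeGroup (Fin m) →* FreeGroup (Fin l))
      (ψ : FreeGroup (Fin n) →* FreeGroup (Fin m)), a (φ.comp ψ) = (a ψ).comp (a φ))
    {l m n : ℕ} (f : (FreeGroup (Fin m) →* FreeGroup (Fin l)) →₀ K)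
    (g : (FreeGroup (Fin n) →* FreeGroup (Fin m)) →₀ K) :
    grAct K a l n (grComp K l m n f g) = (grAct K a m n g).comp (grAct K a l m f) := by
  have h : ((LinearMap.llcomp K (V l) (V m) (V n)).comp (grAct K a m n)).flip.comp
      (grAct K a l m) = (grComp K l m n).compr₂ (grAct K a l n) := by
    refine finsupp_ext K fun φ => finsupp_ext K fun ψ => ?_
    rw [LinearMap.compr₂_apply, grComp_single, grAct_single, ha]
    simp only [LinearMap.comp_apply, LinearMap.flip_apply, grAct_single]
    rfl
  exact (LinearMap.congr_fun₂ h f g).symm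

/-- The action of `gr^op` on the hom-spaces `⟨m⟩ ⟶ ⟨n⟩` of the PROP of associative algebras. It
corresponds to the Hopf algebra structure with `μ` and `η` acting by composition, `Δ` by sums of
unshuffles of words, `ε` by zero on nonempty words, and `S` by reversal of words with sign
`(-1) ^ length`. -/
noncomputable def powellLeft (m n n' : ℕ) :
    ((FreeGroup (Fin n') →* FreeGroup (Fin n)) →₀ K) →ₗ[K]
      (WordTuple (Fin m) n →₀ K) →ₗ[K] (WordTuple (Fin m) n' →₀ K) :=
  grAct K (V := fun n => WordTuple (Fin m) n →₀ K) (cableLin K) n n'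

theorem cableLin_assComp {l m n n' : ℕ} (φ : FreeGroup (Fin n') →* FreeGroup (Fin n))
    (f : LieTrees K l m) (x : WordTuple (Fin m) n →₀ K) :
    cableLin K φ (assComp K l m n (lieExpand K l m f) x) =
      assComp K l m n' (lieExpand K l m f) (cableLin K φ x) := by
  induction f using lie_ind with
  | zero => simp only [map_zero, LinearMap.zero_apply]
  | add f f' hf hf' => simp only [map_add, LinearMap.add_apply, hf, hf']
  | smul r f hf => simp only [map_smul, LinearMap.smul_apply, hf]
  | single F =>
    have h : (cableLin K φ).comp (assComp K l m n (lieExpand K l m (lieMk K F))) =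
        (assComp K l m n' (lieExpand K l m (lieMk K F))).comp (cableLin K φ) := by
      refine finsupp_ext K fun u => ?_
      rw [LinearMap.comp_apply, LinearMap.comp_apply, assComp_apply, assComp_apply,
        Finsupp.linearCombination_single, one_smul, lieExpand_mk, ← wordSubst_eq,
        cable_wordSubst, cableLin_single, one_smul]
      simp only [wordSubst_eq]
    exact LinearMap.congr_fun h x

theorem powell_comm {l m n n' : ℕ} (g : (FreeGroup (Fin n') →* FreeGroup (Fin n)) →₀ K)
    (f : LieTrees K l m) (x : WordTuple (Fin m) n →₀ K) :
    powellLeft K l n n' g (assComp K l m n (lieExpand K l m f) x) =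
      assComp K l m n' (lieExpand K l m f) (powellLeft K m n n' g x) := by
  have h : (powellLeft K l n n').flip (assComp K l m n (lieExpand K l m f) x) =
      (assComp K l m n' (lieExpand K l m f)).comp ((powellLeft K m n n').flip x) := by
    refine finsupp_ext K fun φ => ?_
    simp only [powellLeft, LinearMap.flip_apply, LinearMap.comp_apply, grAct_single,
      cableLin_assComp]
  exact LinearMap.congr_fun h g

/-- Powell's bimodule: the hom-spaces of the PROP of associative algebras, with the action of
`gr^op` described at `powellLeft`, and with the Lie operations acting by precomposition. -/
noncomputable def powell : Bimod K (KGrOp K) (CatLie K) where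
  obj m n := ModuleCat.of K ((lieToAss K).obj m ⟶ Free.of K (AssOp.mk (GrOp.rank n)))
  left m n n' := powellLeft K m.arity (GrOp.rank n) (GrOp.rank n')
  right n m' m := (assComp K m'.arity m.arity (GrOp.rank n)).comp
    (lieExpand K m'.arity m.arity)
  left_id m n x := by
    refine (LinearMap.congr_fun (grAct_single K
      (V := fun n => WordTuple (Fin m.arity) n →₀ K) (cableLin K) _) x).trans ?_
    exact LinearMap.congr_fun (cableLin_id K) x
  left_comp m n n' n'' g h x := LinearMap.congr_fun
    (grAct_comp K (V := fun n => WordTuple (Fin m.arity) n →₀ K) (cableLin K)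
      (fun φ ψ => cableLin_comp K φ ψ) g h) x
  right_id n m x := (congrArg (· ≫ x) ((lieToAss K).map_id m)).trans (Category.id_comp x)
  right_comp n m'' m' m e f x := (congrArg (· ≫ x) ((lieToAss K).map_comp e f)).trans
    (Category.assoc _ _ x)
  left_right g f x := powell_comm K g f x

/-- The space of diagrams with `m` leaves attached to `n` arcs, modulo AS, IHX and STU. -/
abbrev DiagSpace (m n : ℕ) : Type u :=
  (Diagram (Fin m) n →₀ K) ⧸ diagRelations K (Fin m) n

/-- The class of a diagram. -/
noncomputable def diagMk {m n : ℕ} (D : Diagram (Fin m) n) : DiagSpace K m n :=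
  Submodule.mkQ _ (Finsupp.single D 1)

/-- The action of `gr^op` on diagrams by cabling. -/
noncomputable def diagLeft (m n n' : ℕ) :
    ((FreeGroup (Fin n') →* FreeGroup (Fin n)) →₀ K) →ₗ[K]
      DiagSpace K m n →ₗ[K] DiagSpace K m n' :=
  grAct K (V := DiagSpace K m)
    (fun φ => Submodule.mapQ _ _ (diagCableLin K φ) (diagRelations_cable K φ)) n n'

/-- The action of Lie operations on diagrams by grafting. -/
noncomputable def diagRight (m' m n : ℕ) :
    LieTrees K m' m →ₗ[K] DiagSpace K m n →ₗ[K] DiagSpace K m' n :=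
  bilinQ (fun (F : Forest (Fin m) (Fin m')) (D : Diagram (Fin m) n) => D.act F)
    (fun F => diagRelations_act F) (fun D => diagRelations_lie D)

theorem diagLeft_single {m n n' : ℕ} (φ : FreeGroup (Fin n') →* FreeGroup (Fin n))
    (x : Diagram (Fin m) n →₀ K) : diagLeft K m n n' (Finsupp.single φ 1) (Submodule.mkQ _ x) =
      Submodule.mkQ _ (diagCableLin K φ x) := by
  rw [diagLeft, grAct_single]
  rfl

theorem diagRight_mk {m' m n : ℕ} (F : Forest (Fin m) (Fin m')) (x : Diagram (Fin m) n →₀ K) :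
    diagRight K m' m n (lieMk K F) (Submodule.mkQ _ x) =
      Submodule.mkQ _ (Finsupp.lmapDomain K K (fun D => D.act F) x) := by
  have h : (diagRight K m' m n (lieMk K F)).comp (Submodule.mkQ _) =
      (Submodule.mkQ _).comp (Finsupp.lmapDomain K K fun D => D.act F) := by
    refine finsupp_ext K fun D => ?_
    simp only [LinearMap.comp_apply, Finsupp.lmapDomain_apply, Finsupp.mapDomain_single]
    exact bilinQ_single _ _ _ _ _
  exact LinearMap.congr_fun h x

theorem diag_id_left {m n : ℕ} (x : DiagSpace K m n) :
    diagLeft K m n n (Finsupp.single (MonoidHom.id _) 1) x = x := by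
  obtain ⟨x, rfl⟩ := Submodule.mkQ_surjective _ x
  rw [diagLeft_single, diagCableLin_id]
  rfl

theorem diag_comp_left {m l n p : ℕ} (f : (FreeGroup (Fin n) →* FreeGroup (Fin l)) →₀ K)
    (g : (FreeGroup (Fin p) →* FreeGroup (Fin n)) →₀ K) (x : DiagSpace K m l) :
    diagLeft K m l p (grComp K l n p f g) x = diagLeft K m n p g (diagLeft K m l n f x) := by
  refine LinearMap.congr_fun (grAct_comp K (V := DiagSpace K m) _ (fun φ ψ => ?_) f g) x
  refine Submodule.linearMap_qext _ (LinearMap.ext fun y => ?_)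
  exact congrArg (Submodule.mkQ _) (LinearMap.congr_fun (diagCableLin_comp K φ ψ) y)

theorem diag_id_right {m n : ℕ} (x : DiagSpace K m n) :
    diagRight K m m n (lieMk K (Forest.id (Fin m))) x = x := by
  obtain ⟨x, rfl⟩ := Submodule.mkQ_surjective _ x
  rw [diagRight_mk]
  simp only [Diagram.act_id]
  exact congrArg _ Finsupp.mapDomain_id

theorem diag_comp_right {l m n p : ℕ} (e : LieTrees K l m) (f : LieTrees K m n)
    (x : DiagSpace K n p) :
    diagRight K l n p (lieComp K l m n e f) x =
      diagRight K l m p e (diagRight K m n p f x) := by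
  induction e using lie_ind with
  | zero => simp only [map_zero, LinearMap.zero_apply]
  | add f f' hf hf' => simp only [map_add, LinearMap.add_apply, hf, hf']
  | smul r f hf => simp only [map_smul, LinearMap.smul_apply, hf]
  | single F =>
    induction f using lie_ind with
    | zero => simp only [map_zero, LinearMap.zero_apply]
    | add f f' hf hf' => simp only [map_add, LinearMap.add_apply, hf, hf']
    | smul r f hf => simp only [map_smul, LinearMap.smul_apply, hf]
    | single G =>
      obtain ⟨x, rfl⟩ := Submodule.mkQ_surjective _ x
      rw [lieComp_mk, diagRight_mk, diagRight_mk, diagRight_mk, lmap_lmap]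
      simp only [Diagram.act_act]

theorem diag_comm {l m n n' : ℕ} (g : (FreeGroup (Fin n') →* FreeGroup (Fin n)) →₀ K)
    (f : LieTrees K l m) (x : DiagSpace K m n) :
    diagLeft K l n n' g (diagRight K l m n f x) =
      diagRight K l m n' f (diagLeft K m n n' g x) := by
  induction f using lie_ind with
  | zero => simp only [map_zero, LinearMap.zero_apply]
  | add f f' hf hf' => simp only [map_add, LinearMap.add_apply, hf, hf']
  | smul r f hf => simp only [map_smul, LinearMap.smul_apply, hf]
  | single F =>
    have h : (diagLeft K l n n').flip (diagRight K l m n (lieMk K F) x) =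
        (diagRight K l m n' (lieMk K F)).comp ((diagLeft K m n n').flip x) := by
      refine finsupp_ext K fun φ => ?_
      obtain ⟨x, rfl⟩ := Submodule.mkQ_surjective _ x
      rw [LinearMap.flip_apply, LinearMap.comp_apply, LinearMap.flip_apply, diagRight_mk,
        diagLeft_single, diagLeft_single, diagRight_mk, diagCableLin_act]
    exact LinearMap.congr_fun h g

/-- The bimodule `A^L_0(L^{⊗ m}, H^{⊗ n})`. -/
noncomputable def AL0 : Bimod K (KGrOp K) (CatLie K) where
  obj m n := ModuleCat.of K (DiagSpace K m.arity (GrOp.rank n))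
  left m n n' := diagLeft K m.arity (GrOp.rank n) (GrOp.rank n')
  right n m' m := diagRight K m'.arity m.arity (GrOp.rank n)
  left_id _ _ x := diag_id_left K x
  left_comp _ _ _ _ g h x := diag_comp_left K g h x
  right_id _ _ x := diag_id_right K x
  right_comp _ _ _ _ e f x := diag_comp_right K e f x
  left_right g f x := diag_comm K g f x

end Concrete

section Generators
variable (K : Type u) [CommRing K] {m n n' : ℕ}

theorem signedCount_negative {I : Type} [DecidableEq I] {l v : List I} (hl : l.Nodup) :
    signedCount (l.map fun a => (a, false)) v =
      if v.Sublist l then (-1) ^ v.length else 0 := by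
  induction l generalizing v with
  | nil =>
    cases v with
    | nil => simp
    | cons b v => simp [signedCount]
  | cons a l ih =>
    obtain ⟨ha, hl⟩ := List.nodup_cons.1 hl
    cases v with
    | nil => simp
    | cons b v =>
      rw [List.map_cons, signedCount_cons, ih hl, ih hl]
      by_cases hab : a = b
      · subst hab
        have : ¬ (a :: v).Sublist l := fun h => ha (h.subset (List.mem_cons_self))
        simp [this, pow_succ]
      · have : (b :: v).Sublist (a :: l) ↔ (b :: v).Sublist l := by
          constructor
          · intro h
            cases h with
            | cons _ h => exact h
            | cons_cons _ h => exact absurd rfl hab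
          · exact fun h => h.cons _
        simp [hab, this]

/-- `μ` and `η` (and all morphisms of the PROP of associative algebras) act by composition. -/
theorem powellLeft_comp (u : WordTuple (Fin m) n) (v : WordTuple (Fin n) n') :
    powellLeft K m n n' (Finsupp.single (FreeGroup.lift (spell v.1)) 1) (Finsupp.single u 1) =
      Finsupp.single (v.sub u.1 u.2) 1 := by
  rw [powellLeft, grAct_single, cableLin_single, one_smul, cable, ← multilinearPart_spell]
  congr 1
  funext k
  rw [FreeGroup.lift_apply_of]
  exact congrFun (subGroup_spell v u.1 u.2) k

/-- The iterated coproducts, the counits and the permutations, i.e. the homomorphisms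
`x_k ↦ x_{f k}`, act by sums over unshuffles: the `j`-th word is distributed among the places `k`
with `f k = j` in all ways in which its letters keep their order. -/
theorem powellLeft_map (f : Fin n' → Fin n) (u : WordTuple (Fin m) n) :
    powellLeft K m n n' (Finsupp.single (FreeGroup.map f) 1) (Finsupp.single u 1) =
      ∑ v : WordTuple (Fin m) n', if ∀ k, (v.1 k).Sublist (u.1 (f k)) then
        Finsupp.single v 1 else 0 := by
  rw [powellLeft, grAct_single, cableLin_single, one_smul]
  ext w
  rw [Finsupp.finsetSum_apply, Finset.sum_eq_single w]
  · have h : (fun k => FreeGroup.lift (spell u.1) (FreeGroup.map f (FreeGroup.of k))) =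
        fun k => FreeGroup.mk ((u.1 (f k)).map fun a => (a, true)) :=
      funext fun k => by rw [FreeGroup.map.of, FreeGroup.lift_apply_of]; exact list_prod_of _
    rw [cable, h, multilinearPart_apply, multCoeff_mk _ w.2]
    simp only [signedCount_positive (u.2.nodup _)]
    split_ifs with hw
    · simp [hw]
    · push Not at hw
      obtain ⟨k, hk⟩ := hw
      rw [Finset.prod_eq_zero (Finset.mem_univ k) (if_neg hk)]
      simp
  · intro v _ hv
    split_ifs
    · exact Finsupp.single_eq_of_ne (Ne.symm hv)
    · rfl
  · simp

/-- The tuple in which the words with index in `e` are reversed. -/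
def WordTuple.reverse {I : Type} [DecidableEq I] (e : Fin n → Bool) (u : WordTuple I n) :
    WordTuple I n :=
  ⟨fun k => if e k then (u.1 k).reverse else u.1 k, fun a => by
    rw [← u.2 a]
    exact Finset.sum_congr rfl fun k _ => by by_cases hk : e k = true <;> simp [hk]⟩

/-- The antipodes act by reversal of words, with the sign `(-1) ^ length`. -/
theorem powellLeft_antipode (e : Fin n → Bool) (u : WordTuple (Fin m) n) :
    powellLeft K m n n (Finsupp.single (FreeGroup.lift fun k =>
        if e k then (FreeGroup.of k)⁻¹ else FreeGroup.of k) 1) (Finsupp.single u 1) =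
      Finsupp.single (u.reverse e) (∏ k, if e k then (-1) ^ (u.1 k).length else 1) := by
  rw [powellLeft, grAct_single, cableLin_single, one_smul]
  ext w
  have hmk : ∀ l : List (Fin m), (FreeGroup.mk (l.map fun a => (a, true)))⁻¹ =
      FreeGroup.mk (l.reverse.map fun a => (a, false)) := fun l => by
    rw [FreeGroup.inv_mk, FreeGroup.invRev]
    simp [Function.comp_def]
  have h : (fun k => FreeGroup.lift (spell u.1) (FreeGroup.lift (fun k =>
      if e k then (FreeGroup.of k)⁻¹ else FreeGroup.of k) (FreeGroup.of k))) =
      fun k => FreeGroup.mk (((u.reverse e).1 k).map fun a => (a, !e k)) := funext fun k => by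
    rw [FreeGroup.lift_apply_of]
    by_cases hk : e k = true
    · simp only [hk, if_true, map_inv, FreeGroup.lift_apply_of, WordTuple.reverse, Bool.not_true]
      rw [spell, list_prod_of, hmk]
    · simp only [Bool.not_eq_true] at hk
      simp only [hk, WordTuple.reverse, Bool.not_false]
      refine Eq.trans ?_ (list_prod_of (u.1 k))
      exact FreeGroup.lift_apply_of
  have hs : ∀ k, signedCount (((u.reverse e).1 k).map fun a => (a, !e k)) (w.1 k) =
      if (w.1 k).Sublist ((u.reverse e).1 k) then
        (if e k then (-1) ^ (w.1 k).length else 1) else 0 := fun k => by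
    by_cases hk : e k = true
    · simp only [hk, if_true, Bool.not_true]
      exact signedCount_negative ((u.reverse e).2.nodup k)
    · simp only [Bool.not_eq_true] at hk
      simp only [hk, Bool.not_false]
      exact signedCount_positive ((u.reverse e).2.nodup k)
  rw [cable, h, multilinearPart_apply, multCoeff_mk _ w.2, Finset.prod_congr rfl fun k _ => hs k,
    Finsupp.single_apply]
  split_ifs with hw
  · subst hw
    push_cast
    refine Finset.prod_congr rfl fun k _ => ?_
    simp only [List.Sublist.refl, if_true, WordTuple.reverse]
    split_ifs <;> simp
  · by_contra hne
    have h1 : ∀ k, (w.1 k).Sublist ((u.reverse e).1 k) := by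
      intro k
      by_contra hk
      refine hne ?_
      rw [Finset.prod_eq_zero (Finset.mem_univ k) (if_neg hk), Int.cast_zero]
    have h2 : ∑ k, (w.1 k).length = ∑ k, ((u.reverse e).1 k).length := by
      rw [w.2.sum_length, (u.reverse e).2.sum_length]
    have h3 := (Finset.sum_eq_sum_iff_of_le fun k _ => (h1 k).length_le).1 h2
    exact hw (Subtype.ext (funext fun k =>
      ((h1 k).eq_of_length (h3 k (Finset.mem_univ k))).symm))

end Generators

section Comparison
variable (K : Type u) [CommRing K]

theorem lift_spell_sub {l m n : ℕ} (u : WordTuple (Fin l) m) (v : WordTuple (Fin m) n) :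
    FreeGroup.lift (spell (v.sub u.1 u.2).1) =
      (FreeGroup.lift (spell u.1)).comp (FreeGroup.lift (spell v.1)) := by
  ext k
  rw [FreeGroup.lift_apply_of, MonoidHom.comp_apply, FreeGroup.lift_apply_of]
  exact (congrFun (subGroup_spell v u.1 u.2) k).symm

/-- The embedding of the PROP of associative algebras in the linearization of `gr^op`: a tuple
of words `(w_1, …, w_n)` is sent to the homomorphism `F_n → F_m`, `x_k ↦ w_k`. -/
noncomputable def assToGr : CatAss K ⥤ KGrOp K where
  obj n := Free.of K ⟨AssOp.arity n⟩
  map {m n} f := Finsupp.lmapDomain K K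
    (fun u : WordTuple (Fin (AssOp.arity m)) (AssOp.arity n) => FreeGroup.lift (spell u.1)) f
  map_id m := by
    refine Finsupp.mapDomain_single.trans ?_
    refine congrArg (fun φ => Finsupp.single φ (1 : K)) ?_
    refine FreeGroup.ext_hom _ _ fun k => ?_
    rw [FreeGroup.lift_apply_of]
    exact mul_one _
  map_comp {l m n} f g := by
    have h : (assComp K (AssOp.arity l) (AssOp.arity m) (AssOp.arity n)).compr₂
        (Finsupp.lmapDomain K K fun u => FreeGroup.lift (spell u.1)) =
        (grComp K (AssOp.arity l) (AssOp.arity m) (AssOp.arity n)).compl₁₂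
          (Finsupp.lmapDomain K K fun u => FreeGroup.lift (spell u.1))
          (Finsupp.lmapDomain K K fun u => FreeGroup.lift (spell u.1)) := by
      refine finsupp_ext K fun u => finsupp_ext K fun v => ?_
      rw [LinearMap.compr₂_apply, LinearMap.compl₁₂_apply, assComp_apply]
      simp only [Finsupp.linearCombination_single, one_smul, Finsupp.lmapDomain_apply,
        Finsupp.mapDomain_single, grComp_single, lift_spell_sub]
    exact LinearMap.congr_fun₂ h f g

/-- The chord diagram of a tuple of words: the end on the arcs of the chord that starts at the
upper point `a` is at the place of the letter `a`. -/
def chordDiagram {m n : ℕ} (u : WordTuple (Fin m) n) : Diagram (Fin m) n :=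
  fill (Forest.id (Fin m)) u

/-- The morphism `i^{⊗ m} : L^{⊗ m} ⟶ H^{⊗ m}`: one chord on each of the `m` arcs. -/
noncomputable def iPow (m : ℕ) : DiagSpace K m m :=
  diagMk K (chordDiagram (WordTuple.id m))

/-- The map `f ↦ f ∘ i^{⊗ m}` from the PROP of associative algebras, embedded in the
linearization of `gr^op`, to the diagrams. -/
noncomputable def iStar (m n : ℕ) :
    (Free.of K (AssOp.mk m) ⟶ Free.of K (AssOp.mk n)) →ₗ[K] DiagSpace K m n where
  toFun f := (AL0 K).left ⟨m⟩ ((assToGr K).map f) (iPow K m)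
  map_add' f g := by
    have : (assToGr K).map (f + g) = (assToGr K).map f + (assToGr K).map g :=
      map_add (Finsupp.lmapDomain K K _) f g
    rw [this, map_add]; rfl
  map_smul' r f := by
    have : (assToGr K).map (r • f) = r • (assToGr K).map f :=
      map_smul (Finsupp.lmapDomain K K _) r f
    rw [this, map_smul]; rfl

/-- The endomorphism of `F_n` that kills the generators in the block `i` of a partition of the
generators into blocks, and fixes the other generators. -/
def killBlock {n d : ℕ} (p : Fin n → Fin (d + 1)) (i : Fin (d + 1)) :
    FreeGroup (Fin n) →* FreeGroup (Fin n) :=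
  FreeGroup.lift fun j => if p j = i then 1 else FreeGroup.of j

variable {K} in
/-- A functor on `gr^op` is polynomial of degree at most `d` if its cross effects of order `d + 1`
vanish: an element of its value at a free product of `d + 1` free groups is zero if it is killed
by all endomorphisms that kill one of the factors. -/
def IsPolynomial (N : LinMod K (KGrOp K)) (d : ℕ) : Prop :=
  ∀ (n : ℕ) (p : Fin n → Fin (d + 1)) (x : N.obj.obj ((Free.embedding K GrOp).obj ⟨n⟩)),
    (∀ i, N.obj.map ((Free.embedding K GrOp).map (X := ⟨n⟩) (Y := ⟨n⟩) (killBlock p i)) x = 0) →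
      x = 0

/-- A functor on `gr^op` is analytic if it is the colimit, i.e. the union, of its polynomial
subfunctors. -/
def IsAnalytic : ObjectProperty (LinMod K (KGrOp K)) := fun N =>
  ∀ (c : KGrOp K) (x : N.obj.obj c), ∃ (P : LinMod K (KGrOp K)) (j : P ⟶ N) (d : ℕ),
    Mono j ∧ IsPolynomial P d ∧ x ∈ Set.range (j.hom.app c)

variable {K} in
/-- The hom-tensor adjunction of a bimodule, given by `f ↦ (y ↦ (b ↦ f (b ⊗ y)))`, restricts to
an equivalence between the modules over the PROP of Lie algebras and the analytic functors on
`gr^op`. -/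
def Bimod.InducesAnalyticEquivalence (B : Bimod K (KGrOp K) (CatLie K)) : Prop :=
  ∃ adj : B.tensorFunctor ⊣ B.homFunctor,
    (∀ (M : LinMod K (CatLie K)) (N : LinMod K (KGrOp K)) (f : B.tensorFunctor.obj M ⟶ N)
      (d : CatLie K) (y : M.obj.obj d) (φ : B.row d ⟶ N),
      (adj.homEquiv M N f).hom.app d y = φ →
        ∀ (c : KGrOp K) (b : B.obj d c), φ.hom.app c b = f.hom.app c (B.tmul M c d b y)) ∧
    (∀ M, IsIso (adj.unit.app M)) ∧
    (∀ N, IsAnalytic K N → IsIso (adj.counit.app N)) ∧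
    ∃ h : ∀ M, IsAnalytic K (B.tensorFunctor.obj M),
      ((IsAnalytic K).lift B.tensorFunctor h).IsEquivalence ∧
      ((IsAnalytic K).ι ⋙ B.homFunctor).IsEquivalence

end Comparison

end JacobiDiagrams

open JacobiDiagrams

/-! Words and diagrams. STU writes a diagram with a vertex at a root as the difference of two
diagrams without that vertex, so the chord diagrams span. They are independent because every vertex
can be read as a commutator, which gives a combination of tuples of words. STU says that a vertex is
`ts - st` while the commutator is `st - ts`, so this reading respects the relation only after
multiplication by `(-1)` to the number of trees (`signedExp_stu`). A chord diagram with `m` chords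
has `m` trees, and this is the origin of the sign `(-1) ^ m` in the isomorphism of bimodules.
Compatibility with cabling is checked on the map from words to diagrams, where both sides obey the
same formula (`wordsToDiag_left`). Compatibility with Lie operations is checked on the inverse map,
where grafting becomes substitution of commutators (`diagToWords_right`).

The equivalence. The hom-tensor adjunction is formal. That it restricts to an equivalence is proved
for Powell's bimodule and carried over along the isomorphism (`transfer_homTensorAdj`). The central
notion is that of a primitive element of `N(F_n)`: duplicating a variable `a` into `a` and `z` gives
the sum of the two elements that only use one of them, as for primitive elements of a Hopf algebra
in each of `n` tensor factors. A row of Powell's bimodule is generated by one primitive element, the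
tuple of one-letter words, and it represents primitive elements: by the expansion of primitive
functions in multilinear words, a morphism from the row to `N` is the same as a primitive element of
`N` (`rowHom`, `row_hom_ext`). Thus the right adjoint sends `N` to its primitive elements.

Two facts make this functor an equivalence on analytic functors. In characteristic zero there is a
natural projection to primitive elements: on an element of finite degree, `x_a ↦ x_a ^ r` acts by a
polynomial in `r`, and its coefficient of `r` is primitive in `a` (`proj_primMod`). This is the
first Eulerian idempotent. Moreover, analytic functors are controlled by their primitive elements: a
subfunctor `S` contains a subfunctor `T` as soon as it contains all elements of `T` that are
primitive modulo `S` (`mem_of_primMod`). The reason is that the defect of primitivity of an element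
of a cross effect lies in a cross effect of one order more, and these vanish in the end.

A multilinear form of Friedrichs' criterion identifies the primitive elements of a row with the Lie
operations (`lieExpand_lieRetract`). Primitivity amounts to shuffle relations, by which an element
is determined by its coefficients at words that start with their smallest letters. Left combs that
start with their smallest letters span the Lie operations, and have a unit matrix of coefficients at
those words.

The unit is then an isomorphism: the projection of `b ⊗ y` only affects `b` and turns it into a Lie
operation, which can be moved to `y`; so the primitive elements of the tensor product are the `g ⊗
y` with `g` the generator of the row, and `primPart` shows that `y` is unique. The counit is
injective because its kernel has no nonzero primitive elements, and surjective onto analytic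
functors because its image contains all primitive elements and an element that is primitive modulo
the image can be corrected by the projection. -/

namespace JacobiDiagrams

/-! ### Diagrams modulo STU and tuples of words -/

section DiagramExpansion
variable (K : Type u) [CommRing K] {I β γ : Type} [Fintype I] [DecidableEq I] [Fintype β]
  [DecidableEq β] [DecidableEq γ] {l m n : ℕ}

/-- The combination of tuples of words obtained from a diagram by reading every vertex as a
commutator. -/
noncomputable def treeExp (D : Diagram β n) : WordTuple β n →₀ K :=
  Finsupp.equivFunOnFinite.symm fun w => ∏ k, wordCoeff K (w.1 k) ((D.1 k).map (lieExp K)).prod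

theorem treeExp_apply (D : Diagram β n) (w : WordTuple β n) :
    treeExp K D w = ∏ k, wordCoeff K (w.1 k) ((D.1 k).map (lieExp K)).prod := rfl

/-- The number of trees of a diagram. -/
def Diagram.size (D : Diagram β n) : ℕ := ∑ k, (D.1 k).length

theorem Diagram.size_act (F : Forest β γ) (D : Diagram β n) : (D.act F).size = D.size :=
  Finset.sum_congr rfl fun _ _ => List.length_map _

theorem treeExp_fill (F : Forest I β) (u : WordTuple I n) :
    treeExp K (fill F u) = wordSubst K u fun i => lieExp K (F.1 i) := by
  ext w
  rw [treeExp_apply, wordSubst_apply]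
  refine Finset.prod_congr rfl fun k _ => ?_
  simp [fill, Function.comp_def]

theorem wordCoeff_mul_ne_zero {x y : MonoidAlgebra K (FreeMonoid β)} {l : List β}
    (h : wordCoeff K l (x * y) ≠ 0) :
    ∃ l₁ l₂, l = l₁ ++ l₂ ∧ wordCoeff K l₁ x ≠ 0 ∧ wordCoeff K l₂ y ≠ 0 := by
  classical
  by_contra! hne
  refine h ?_
  show (x * y).coeff (FreeMonoid.ofList l) = 0
  rw [MonoidAlgebra.coeff_mul]
  refine Finset.sum_eq_zero fun l₁ h₁ => Finset.sum_eq_zero fun l₂ _ => ?_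
  refine ite_eq_right_iff.2 fun e => ?_
  have h0 := hne l₁.toList l₂.toList (by
    rw [← FreeMonoid.toList_mul, e, FreeMonoid.toList_ofList]) (Finsupp.mem_support_iff.1 h₁)
  exact mul_eq_zero_of_right _ h0

theorem lieExp_prod_support (L : List (FreeMagma β)) (l : List β)
    (h : wordCoeff K l (L.map (lieExp K)).prod ≠ 0) : l.Perm (L.flatMap leaves) := by
  induction L generalizing l with
  | nil =>
    have := wordCoeff_single K l ([] : List β)
    rw [List.map_nil, List.prod_nil] at h
    by_cases hl : [] = l
    · rw [← hl]; rfl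
    · rw [if_neg hl] at this
      exact absurd this h
  | cons t L ih =>
    rw [List.map_cons, List.prod_cons] at h
    obtain ⟨l₁, l₂, rfl, h₁, h₂⟩ := wordCoeff_mul_ne_zero K h
    rw [List.flatMap_cons]
    exact (lieExp_support K t _ h₁).append (ih _ h₂)

theorem lieExp_graft_prod (F : β → FreeMagma γ) (L : List (FreeMagma β)) :
    ((L.map (graft F)).map (lieExp K)).prod = (L.map (lieExp K)).prod.coeff.sum fun l r =>
      r • (l.toList.map fun b => lieExp K (F b)).prod := by
  have h : ∀ t : FreeMagma β, lieExp K (graft F t) =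
      MonoidAlgebra.lift K _ _ (FreeMonoid.lift fun b => lieExp K (F b)) (lieExp K t) := by
    intro t
    induction t with
    | ih1 a => simp
    | ih2 s t hs ht => simp only [graft_mul, lieExp_mul, hs, ht, map_sub, map_mul]
  have h' : ((L.map (graft F)).map (lieExp K)).prod =
      MonoidAlgebra.lift K _ _ (FreeMonoid.lift fun b => lieExp K (F b))
        (L.map (lieExp K)).prod := by
    induction L with
    | nil => simp
    | cons t L ih => simp only [List.map_cons, List.prod_cons, ih, h, map_mul]
  rw [h', MonoidAlgebra.lift_apply]
  refine Finsupp.sum_congr fun l _ => ?_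
  rw [FreeMonoid.lift_apply]

/-- Substitution is multiplicative, so each arc can be expanded separately. Distributivity then
gives a sum over all choices of one word per arc, and only tuples using every leaf once contribute,
since commutators merely permute leaves. -/
theorem treeExp_act (F : Forest (Fin m) β) (D : Diagram (Fin m) n) :
    treeExp K (D.act F) = Finsupp.linearCombination K
      (fun u : WordTuple (Fin m) n => wordSubst K u fun i => lieExp K (F.1 i))
        (treeExp K D) := by
  ext w
  rw [Finsupp.linearCombination_apply, Finsupp.sum_fintype _ _ (by simp), Finsupp.finsetSum_apply]
  simp only [Finsupp.smul_apply, wordSubst_apply, treeExp_apply, smul_eq_mul,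
    ← Finset.prod_mul_distrib]
  let f : Fin n → List (Fin m) → K := fun k l =>
    wordCoeff K l ((D.1 k).map (lieExp K)).prod *
      wordCoeff K (w.1 k) (l.map fun i => lieExp K (F.1 i)).prod
  let S : Fin n → Finset (List (Fin m)) := fun k => ((D.1 k).map (lieExp K)).prod.coeff.support
  have e1 : ∀ k, wordCoeff K (w.1 k) (((D.act F).1 k).map (lieExp K)).prod = ∑ l ∈ S k, f k l := by
    intro k
    refine (congrArg _ (lieExp_graft_prod K F.1 (D.1 k))).trans ?_
    rw [Finsupp.sum, map_sum]
    refine Finset.sum_congr rfl fun l _ => ?_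
    rw [map_smul]
    rfl
  rw [Finset.prod_congr rfl fun k _ => e1 k, Finset.prod_univ_sum]
  -- Words with nonzero coefficient are permutations of the leaves on their arc, so a choice of one
  -- for every arc is automatically multilinear.
  have hS : ∀ L ∈ Fintype.piFinset S, EachOnce L := by
    intro L hL a
    rw [← D.2 a]
    refine Finset.sum_congr rfl fun k _ => ?_
    exact (lieExp_prod_support K (D.1 k) (L k)
      (Finsupp.mem_support_iff.1 (Fintype.mem_piFinset.1 hL k))).count_eq a
  let emb : WordTuple (Fin m) n ↪ (Fin n → List (Fin m)) := ⟨fun u => u.1, Subtype.val_injective⟩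
  have e2 : ∑ u : WordTuple (Fin m) n, ∏ k, f k (u.1 k) =
      ∑ L ∈ Finset.univ.map emb, ∏ k, f k (L k) :=
    (Finset.sum_map Finset.univ emb fun L => ∏ k, f k (L k)).symm
  refine Eq.trans ?_ e2.symm
  refine Finset.sum_subset (fun L hL => ?_) fun L _ hL => ?_
  · exact Finset.mem_map.2 ⟨⟨L, hS L hL⟩, Finset.mem_univ _, rfl⟩
  · rw [Fintype.mem_piFinset] at hL
    push Not at hL
    obtain ⟨k, hk⟩ := hL
    refine Finset.prod_eq_zero (Finset.mem_univ k) ?_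
    exact mul_eq_zero_of_left (Finsupp.notMem_support_iff.1 hk) _

/-- `treeExp` with the sign `(-1) ^ size`. -/
noncomputable def signedExp (D : Diagram β n) : WordTuple β n →₀ K :=
  (-1 : K) ^ D.size • treeExp K D

/-- Grafting on leaves does not change the number of trees, so the sign plays no role here. -/
theorem signedExp_act (F : Forest (Fin m) (Fin l)) (D : Diagram (Fin m) n) :
    signedExp K (D.act F) = assComp K l m n (forestExp K F) (signedExp K D) := by
  rw [signedExp, signedExp, Diagram.size_act, treeExp_act, map_smul, assComp_apply]
  simp only [wordSubst_eq]

/-- The diagrams `D₁` and `D₂` have one tree more than `D`. The sign therefore turns the relator `D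
+ D₁ - D₂` into `D - D₁ + D₂` up to a common factor, and this vanishes when the vertex is read as
`st - ts`. -/
theorem signedExp_stu {x : Diagram β n →₀ K} (hx : IsSTU K x) :
    Finsupp.linearCombination K (signedExp K) x = 0 := by
  obtain ⟨D, D₁, D₂, k, p, q, s, t, hD, h₁, h₂, h₁', h₂'⟩ := hx
  simp only [map_add, map_sub, Finsupp.linearCombination_single, one_smul]
  have size : ∀ E : Diagram β n, (∀ j, j ≠ k → E.1 j = D.1 j) →
      (E.1 k).length = (D.1 k).length + 1 → E.size = D.size + 1 := by
    intro E hE hk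
    rw [Diagram.size, Diagram.size, ← Finset.add_sum_erase _ _ (Finset.mem_univ k),
      ← Finset.add_sum_erase _ (fun k => (D.1 k).length) (Finset.mem_univ k), hk,
      Finset.sum_congr rfl fun j hj => by rw [hE j (Finset.ne_of_mem_erase hj)]]
    omega
  have expand : ∀ (E : Diagram β n) (w : WordTuple β n), (∀ j, j ≠ k → E.1 j = D.1 j) →
      treeExp K E w = wordCoeff K (w.1 k) ((E.1 k).map (lieExp K)).prod *
        ∏ j ∈ Finset.univ.erase k, wordCoeff K (w.1 j) ((D.1 j).map (lieExp K)).prod := by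
    intro E w hE
    rw [treeExp_apply, ← Finset.mul_prod_erase _ _ (Finset.mem_univ k)]
    congr 1
    exact Finset.prod_congr rfl fun j hj => by rw [hE j (Finset.ne_of_mem_erase hj)]
  rw [signedExp, signedExp, signedExp, size D₁ h₁' (by rw [h₁, hD]; simp; omega),
    size D₂ h₂' (by rw [h₂, hD]; simp; omega), pow_succ, mul_neg_one, neg_smul, neg_smul,
    sub_neg_eq_add, ← sub_eq_add_neg, ← smul_sub, ← smul_add]
  refine (congrArg _ ?_).trans (smul_zero _)
  ext w
  rw [Finsupp.add_apply, Finsupp.sub_apply, expand D w fun _ _ => rfl, expand D₁ w h₁',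
    expand D₂ w h₂', hD, h₁, h₂, ← sub_mul, ← add_mul, ← map_sub, ← map_add]
  refine mul_eq_zero_of_left ?_ _
  simp only [List.map_append, List.map_cons, List.prod_append, List.prod_cons, lieExp_mul]
  refine (congrArg _ ?_).trans (map_zero _)
  noncomm_ring

theorem signedExp_relations :
    diagRelations K (Fin m) n ≤ (Finsupp.linearCombination K (signedExp K)).ker := by
  refine Submodule.span_le.2 ?_
  rintro _ (⟨l, r, E, hr, rfl⟩ | hx)
  -- For a fixed diagram `E`, the expansion of `E` with grafted trees depends linearly on
  -- `forestExp` of the grafted forest, and `forestExp` already respects antisymmetry and IHX.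
  · have h : (Finsupp.linearCombination K (signedExp K)).comp
        (Finsupp.lmapDomain K K fun F : Forest (Fin l) (Fin m) => E.act F) =
        ((assComp K m l n).flip (signedExp K E)).comp
          (Finsupp.linearCombination K (forestExp K)) := by
      refine finsupp_ext K fun F => ?_
      simp [Finsupp.mapDomain_single, signedExp_act]
    rw [SetLike.mem_coe, LinearMap.mem_ker]
    refine (LinearMap.congr_fun h r).trans ?_
    rw [LinearMap.comp_apply, forestExp_relator K hr, map_zero]
  · exact signedExp_stu K hx

/-- The inverse of the isomorphism from words to diagrams. -/
noncomputable def diagToWords (m n : ℕ) : DiagSpace K m n →ₗ[K] (WordTuple (Fin m) n →₀ K) :=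
  (diagRelations K (Fin m) n).liftQ (Finsupp.linearCombination K (signedExp K))
    (signedExp_relations K)

theorem diagToWords_mk (D : Diagram (Fin m) n) :
    diagToWords K m n (diagMk K D) = signedExp K D := by
  simp [diagToWords, diagMk]

/-- Each of the `m` chords is a tree of its own: here the sign `(-1) ^ m` of the isomorphism
appears. -/
theorem diagToWords_chord (w : WordTuple (Fin m) n) :
    diagToWords K m n (diagMk K (chordDiagram w)) = Finsupp.single w ((-1) ^ m) := by
  rw [diagToWords_mk, signedExp]
  have h1 : (chordDiagram w).size = m := by
    have : (chordDiagram w).size = ∑ k, (w.1 k).length :=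
      Finset.sum_congr rfl fun k _ => List.length_map _
    rw [this, w.2.sum_length, Fintype.card_fin]
  have h2 : treeExp K (chordDiagram w) = Finsupp.single w 1 :=
    (treeExp_fill K _ w).trans ((wordSubst_single K w _ (WordTuple.id m).2).trans
      (congrArg (Finsupp.single · 1) w.sub_id))
  rw [h1, h2, Finsupp.smul_single, smul_eq_mul, mul_one]

/-- Induction on the total number of vertices. STU at the root of a nontrivial tree gives two
diagrams in which this vertex is gone and the tree is cut in two. The labelling of the roots by an
arbitrary `I` is needed since each cut adds one root. -/
theorem diagMk_fill_mem_span (F : Forest I (Fin m)) (u : WordTuple I n) :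
    diagMk K (fill F u) ∈ Submodule.span K
      (Set.range fun w : WordTuple (Fin m) n => diagMk K (chordDiagram w)) := by
  induction hN : ∑ i, nodes (F.1 i) using Nat.strong_induction_on generalizing I with
  | _ N ih =>
  subst hN
  by_cases hF : ∀ i, nodes (F.1 i) = 0
  · have hF' : ∀ i, ∃ b, F.1 i = FreeMagma.of b := by
      intro i
      have := hF i
      cases hi : F.1 i with
      | of b => exact ⟨b, rfl⟩
      | mul s t => rw [hi] at this; exact absurd this (Nat.succ_ne_zero _)
    choose e he using hF'
    have hE : EachOnce fun i => [e i] := by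
      have := F.2
      simpa only [he, leaves_of] using this
    -- Without vertices, the forest is only a bijective labelling by upper points, and the diagram
    -- is the chord diagram of the relabelled words.
    refine Submodule.subset_span ⟨u.sub (fun i => [e i]) hE, congrArg (diagMk K) ?_⟩
    refine Subtype.ext (funext fun k => ?_)
    show ((u.1 k).flatMap fun i => [e i]).map FreeMagma.of = (u.1 k).map F.1
    rw [← List.map_eq_flatMap, List.map_map]
    exact List.map_congr_left fun i _ => (he i).symm
  · push Not at hF
    obtain ⟨p, hp⟩ := hF
    obtain ⟨s, t, h⟩ : ∃ s t, F.1 p = s * t := by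
      cases hi : F.1 p with
      | of b => rw [hi] at hp; exact absurd rfl hp
      | mul s t => exact ⟨s, t, rfl⟩
    have hlt : ∑ o, nodes ((F.split p s t h).1 o) < ∑ i, nodes (F.1 i) := by
      rw [Fintype.sum_option, ← Finset.add_sum_erase _ _ (Finset.mem_univ p),
        ← Finset.add_sum_erase _ (fun i => nodes (F.1 i)) (Finset.mem_univ p), h]
      have h1 : ∑ i ∈ Finset.univ.erase p, nodes ((F.split p s t h).1 (some i)) =
          ∑ i ∈ Finset.univ.erase p, nodes (F.1 i) := Finset.sum_congr rfl fun i hi =>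
        congrArg nodes (if_neg (Finset.ne_of_mem_erase hi) : (if i = p then s else F.1 i) = F.1 i)
      have h2 : nodes ((F.split p s t h).1 (some p)) = nodes s :=
        congrArg nodes (if_pos rfl : (if p = p then s else F.1 p) = s)
      have h3 : nodes ((F.split p s t h).1 none) = nodes t := rfl
      have h4 : nodes (s * t) = nodes s + nodes t + 1 := rfl
      rw [h1, h2, h3, h4]
      omega
    -- STU at the root of the tree `p`, to be solved for the diagram that contains the vertex.
    have hrel := (Submodule.Quotient.mk_eq_zero _).2
      (Submodule.subset_span (s := _ ∪ {x | IsSTU K x}) (Or.inr (isSTU_split K F p s t h u)) :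
        _ ∈ diagRelations K (Fin m) n)
    rw [Submodule.Quotient.mk_sub, Submodule.Quotient.mk_add, sub_eq_zero, ← eq_sub_iff_add_eq]
      at hrel
    have : diagMk K (fill F u) = _ := hrel
    rw [this]
    exact Submodule.sub_mem _ (ih _ hlt (F.split p s t h) _ rfl) (ih _ hlt (F.split p s t h) _ rfl)

theorem diagMk_mem_span (D : Diagram (Fin m) n) :
    diagMk K D ∈ Submodule.span K
      (Set.range fun w : WordTuple (Fin m) n => diagMk K (chordDiagram w)) := by
  rw [← D.fill_places]
  exact diagMk_fill_mem_span K D.forest D.places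

/-- The isomorphism from words to diagrams, with the sign `(-1) ^ m`. -/
noncomputable def wordsToDiag (m n : ℕ) : (WordTuple (Fin m) n →₀ K) →ₗ[K] DiagSpace K m n :=
  Finsupp.linearCombination K fun w => (-1 : K) ^ m • diagMk K (chordDiagram w)

theorem neg_one_pow_mul_self (m : ℕ) : (-1 : K) ^ m * (-1) ^ m = 1 := by
  rw [← mul_pow]; simp

theorem diagToWords_wordsToDiag (x : WordTuple (Fin m) n →₀ K) :
    diagToWords K m n (wordsToDiag K m n x) = x := by
  have : (diagToWords K m n).comp (wordsToDiag K m n) = LinearMap.id := by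
    refine finsupp_ext K fun w => ?_
    simp [wordsToDiag, diagToWords_chord, neg_one_pow_mul_self]
  exact LinearMap.congr_fun this x

theorem wordsToDiag_diagToWords (x : DiagSpace K m n) :
    wordsToDiag K m n (diagToWords K m n x) = x := by
  suffices h : x ∈ Submodule.span K
      (Set.range fun w : WordTuple (Fin m) n => diagMk K (chordDiagram w)) by
    induction h using Submodule.span_induction with
    | mem x hx =>
      obtain ⟨w, rfl⟩ := hx
      simp [wordsToDiag, diagToWords_chord, smul_smul, neg_one_pow_mul_self]
    | zero => simp
    | add x y _ _ hx hy => rw [map_add, map_add, hx, hy]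
    | smul r x _ hx => rw [map_smul, map_smul, hx]
  induction x using quot_ind with
  | zero => exact Submodule.zero_mem _
  | single D => exact diagMk_mem_span K D
  | add x y hx hy => exact Submodule.add_mem _ hx hy
  | smul r x hx => exact Submodule.smul_mem _ r hx

/-- Words and diagrams. -/
noncomputable def wordsEquivDiag (m n : ℕ) : (WordTuple (Fin m) n →₀ K) ≃ₗ[K] DiagSpace K m n :=
  LinearEquiv.ofLinearMap (wordsToDiag K m n) (diagToWords K m n)
    (LinearMap.ext (wordsToDiag_diagToWords K)) (LinearMap.ext (diagToWords_wordsToDiag K))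

theorem lift_spell_id (m : ℕ) : FreeGroup.lift (spell (WordTuple.id m).1) = MonoidHom.id _ := by
  refine FreeGroup.ext_hom _ _ fun k => ?_
  rw [FreeGroup.lift_apply_of]
  exact mul_one _

/-- Cabling the arcs of `i^{⊗ m}`, with one chord each, along `x_k ↦ w_k` strings the chords on the
`k`-th arc in the order `w_k`. Nothing else occurs, since the multilinear part of a multilinear
tuple of positive words is that tuple. -/
theorem iStar_single (w : WordTuple (Fin m) n) :
    iStar K m n (Finsupp.single w 1) = diagMk K (chordDiagram w) := by
  have h1 : (assToGr K).map (X := Free.of K (AssOp.mk m)) (Y := Free.of K (AssOp.mk n))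
      (Finsupp.single w (1 : K)) =
      (Finsupp.single (FreeGroup.lift (spell w.1)) 1 :
        (FreeGroup (Fin n) →* FreeGroup (Fin m)) →₀ K) := Finsupp.mapDomain_single
  refine (congrArg (fun f => (AL0 K).left ⟨m⟩ f (iPow K m)) h1).trans ?_
  have h2 : diagLeft K m m n (Finsupp.single (FreeGroup.lift (spell w.1)) 1) (iPow K m) = _ :=
    diagLeft_single K _ _
  refine h2.trans ?_
  rw [diagCableLin_single, chordDiagram, diagCable_fill, cable, lift_spell_id]
  have : (fun k => (MonoidHom.id (FreeGroup (Fin m))) ((FreeGroup.lift (spell w.1))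
      (FreeGroup.of k))) = spell w.1 := by funext k; simp
  rw [this, multilinearPart_spell, Finsupp.mapDomain_single]
  rfl

theorem wordsToDiag_eq (x : WordTuple (Fin m) n →₀ K) :
    wordsToDiag K m n x = (-1 : K) ^ m • iStar K m n x := by
  let i : (WordTuple (Fin m) n →₀ K) →ₗ[K] DiagSpace K m n := iStar K m n
  have : wordsToDiag K m n = (-1 : K) ^ m • i := by
    refine finsupp_ext K fun w => ?_
    rw [LinearMap.smul_apply]
    refine Eq.trans ?_ (congrArg _ (iStar_single K w).symm)
    simp [wordsToDiag]
  exact LinearMap.congr_fun this x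

theorem iStar_eq (x : WordTuple (Fin m) n →₀ K) :
    iStar K m n x = (-1 : K) ^ m • wordsToDiag K m n x := by
  rw [wordsToDiag_eq, smul_smul, neg_one_pow_mul_self, one_smul]

theorem iStar_bijective (m n : ℕ) : Function.Bijective (iStar K m n) := by
  refine ⟨fun x y h => ?_, fun y => ⟨(-1 : K) ^ m • diagToWords K m n y, ?_⟩⟩
  · refine (wordsEquivDiag K m n).injective ?_
    exact (wordsToDiag_eq K x).trans ((congrArg _ h).trans (wordsToDiag_eq K y).symm)
  · refine (iStar_eq K _).trans ?_
    rw [map_smul, wordsToDiag_diagToWords, smul_smul, neg_one_pow_mul_self, one_smul]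

theorem iStar_comp {m n p : ℕ} (f : Free.of K (AssOp.mk m) ⟶ Free.of K (AssOp.mk n))
    (g : Free.of K (AssOp.mk n) ⟶ Free.of K (AssOp.mk p)) :
    iStar K m p (f ≫ g) = (AL0 K).left ⟨m⟩ ((assToGr K).map g) (iStar K m n f) := by
  refine (congrArg (fun f => (AL0 K).left ⟨m⟩ f (iPow K m)) ((assToGr K).map_comp f g)).trans ?_
  exact (AL0 K).left_comp ⟨m⟩ _ _ _

theorem exists_chord_basis (m n : ℕ) :
    ∃ b : Module.Basis (WordTuple (Fin m) n) K (DiagSpace K m n),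
      ∀ w, b w = diagMk K (chordDiagram w) ∧ iStar K m n (Finsupp.single w 1) = b w := by
  refine ⟨Module.Basis.ofRepr (LinearEquiv.ofBijective _ (iStar_bijective K m n)).symm,
    fun w => ?_⟩
  have h : (Module.Basis.ofRepr (LinearEquiv.ofBijective _ (iStar_bijective K m n)).symm) w =
      iStar K m n (Finsupp.single w 1) := by
    rw [Module.Basis.coe_ofRepr, LinearEquiv.symm_symm]
    rfl
  exact ⟨h.trans (iStar_single K w), h.symm⟩

/-- Chord diagrams are cabled by cabling their words (`diagCableLin_mapDomain`), and the sign
depends on `m` only, which `gr^op` does not change. -/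
theorem wordsToDiag_left {n' : ℕ} (g : (FreeGroup (Fin n') →* FreeGroup (Fin n)) →₀ K)
    (x : WordTuple (Fin m) n →₀ K) :
    wordsToDiag K m n' (powellLeft K m n n' g x) = diagLeft K m n n' g (wordsToDiag K m n x) := by
  have hmk : ∀ (n : ℕ) (x : WordTuple (Fin m) n →₀ K), wordsToDiag K m n x =
      (-1 : K) ^ m • Submodule.mkQ (diagRelations K (Fin m) n)
        (Finsupp.mapDomain (fill (Forest.id (Fin m))) x) := by
    intro n x
    have : wordsToDiag K m n = (-1 : K) ^ m • (Submodule.mkQ (diagRelations K (Fin m) n)).comp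
        (Finsupp.lmapDomain K K (fill (Forest.id (Fin m)))) := by
      refine finsupp_ext K fun w => ?_
      simp [wordsToDiag, Finsupp.mapDomain_single, diagMk, chordDiagram]
    exact LinearMap.congr_fun this x
  have h : (wordsToDiag K m n').comp ((powellLeft K m n n').flip x) =
      (diagLeft K m n n').flip (wordsToDiag K m n x) := by
    refine finsupp_ext K fun φ => ?_
    rw [LinearMap.comp_apply, LinearMap.flip_apply, LinearMap.flip_apply, powellLeft, grAct_single,
      hmk, hmk, map_smul, diagLeft_single, diagCableLin_mapDomain]
  exact LinearMap.congr_fun h g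

/-- In this direction grafting is substitution of commutators by `signedExp_act`. In the opposite
direction commutators would have to be reassembled to trees by repeated use of STU. -/
theorem diagToWords_right (f : LieTrees K l m) (x : DiagSpace K m n) :
    diagToWords K l n (diagRight K l m n f x) =
      assComp K l m n (lieExpand K l m f) (diagToWords K m n x) := by
  induction f using lie_ind with
  | zero => simp only [map_zero, LinearMap.zero_apply]
  | add f f' hf hf' => simp only [map_add, LinearMap.add_apply, hf, hf']
  | smul r f hf => simp only [map_smul, LinearMap.smul_apply, hf]
  | single F =>
    induction x using quot_ind with
    | zero => simp only [map_zero]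
    | add f f' hf hf' => simp only [map_add, hf, hf']
    | smul r f hf => simp only [map_smul, hf]
    | single D =>
      rw [diagRight_mk, lieExpand_mk, Finsupp.lmapDomain_apply, Finsupp.mapDomain_single]
      refine (diagToWords_mk K _).trans ?_
      rw [signedExp_act]
      exact congrArg _ (diagToWords_mk K D).symm

/-- The isomorphism of bimodules. -/
noncomputable def powellIso : BimodIso (powell K) (AL0 K) where
  equiv d c := wordsEquivDiag K d.arity (GrOp.rank c)
  map_left d c c' g x := wordsToDiag_left K g x
  map_right c d' d f x := by
    -- Compatibility with Lie operations is transported to the inverse map.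
    refine (LinearEquiv.eq_symm_apply (wordsEquivDiag K d'.arity (GrOp.rank c))).1 ?_
    refine Eq.trans ?_ (diagToWords_right K f _).symm
    exact congrArg (assComp K _ _ _ (lieExpand K _ _ f)) (diagToWords_wordsToDiag K x).symm

end DiagramExpansion

/-! ### Functors induced by an isomorphism of bimodules -/

section BimoduleIso
open scoped TensorProduct DirectSum
variable {K : Type u} [CommRing K] {C D : Type} [Category.{u} C] [Preadditive C] [Linear K C]
  [Category.{u} D] [Preadditive D] [Linear K D] {B B' : Bimod K C D}

/-- The inverse of an isomorphism of bimodules. -/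
def BimodIso.symm (e : BimodIso B B') : BimodIso B' B where
  equiv d c := (e.equiv d c).symm
  map_left d c c' g x := by
    rw [LinearEquiv.symm_apply_eq, e.map_left, LinearEquiv.apply_symm_apply]
  map_right c d' d f x := by
    rw [LinearEquiv.symm_apply_eq, e.map_right, LinearEquiv.apply_symm_apply]

/-- The map of modules `B(d, -) ⟶ B'(d, -)`. -/
def BimodIso.rowHom (e : BimodIso B B') (d : D) : B.row d ⟶ B'.row d :=
  ObjectProperty.homMk
    { app c := ModuleCat.ofHom (e.equiv d c).toLinearMap
      naturality c c' g := by ext x; exact e.map_left d g x }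

/-- The functor `Hom(B, -)` is natural in `B`. -/
noncomputable def BimodIso.homTrans (e : BimodIso B B') : B'.homFunctor ⟶ B.homFunctor where
  app N := ObjectProperty.homMk
    { app d := ModuleCat.ofHom (Linear.leftComp K N (e.rowHom d))
      naturality d' d f := by
        ext φ
        refine ObjectProperty.hom_ext _ (NatTrans.ext (funext fun c => ?_))
        ext x
        exact congrArg (φ.hom.app c) (e.map_right c f x).symm }
  naturality N N' α := by
    ext d φ
    rfl

/-- The isomorphism of functors `Hom(B, -)` that is induced by an isomorphism of bimodules. -/
noncomputable def BimodIso.homIso (e : BimodIso B B') : B.homFunctor ≅ B'.homFunctor where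
  hom := e.symm.homTrans
  inv := e.homTrans
  hom_inv_id := by
    ext N d φ
    refine ObjectProperty.hom_ext _ (NatTrans.ext (funext fun c => ?_))
    ext x
    exact congrArg (φ.hom.app c) ((e.equiv d c).symm_apply_apply x)
  inv_hom_id := by
    ext N d φ
    refine ObjectProperty.hom_ext _ (NatTrans.ext (funext fun c => ?_))
    ext x
    exact congrArg (φ.hom.app c) ((e.equiv d c).apply_symm_apply x)

variable [DecidableEq D]

/-- `b ⊗ y ↦ e b ⊗ y`. -/
noncomputable def BimodIso.tensorTransMap (e : BimodIso B B') (M : LinMod K D) (c : C) :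
    B.TensorObj M c →ₗ[K] B'.TensorObj M c :=
  B.tensorLift M c (fun d => (B'.tmul M c d).comp (e.equiv d c).toLinearMap) fun d' d f b y => by
    simp only [LinearMap.comp_apply, LinearEquiv.coe_coe, e.map_right, B'.tmul_balance]

@[simp] theorem BimodIso.tensorTransMap_tmul (e : BimodIso B B') (M : LinMod K D) (c : C) (d : D)
    (b : B.obj d c) (y : M.obj.obj d) :
    e.tensorTransMap M c (B.tmul M c d b y) = B'.tmul M c d (e.equiv d c b) y :=
  B.tensorLift_tmul M c _ _ d b y

/-- The functor `B ⊗ -` is natural in `B`. -/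
noncomputable def BimodIso.tensorTrans (e : BimodIso B B') :
    B.tensorFunctor ⟶ B'.tensorFunctor where
  app M := ObjectProperty.homMk
    { app c := ModuleCat.ofHom (e.tensorTransMap M c)
      naturality c c' g := ModuleCat.hom_ext (B.tensor_ext fun d b y => by
        refine (congrArg (e.tensorTransMap M c') (B.tensorMap_tmul M g d b y)).trans ?_
        refine Eq.trans ?_ (congrArg (B'.tensorMap M g) (e.tensorTransMap_tmul M c d b y)).symm
        rw [tensorTransMap_tmul, Bimod.tensorMap_tmul, e.map_left]) }
  naturality M M' α := by
    ext c : 3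
    refine ModuleCat.hom_ext (B.tensor_ext fun d b y => ?_)
    refine (congrArg (e.tensorTransMap M' c) (B.tensorMapRight_tmul α c d b y)).trans ?_
    refine Eq.trans ?_ (congrArg (B'.tensorMapRight α c) (e.tensorTransMap_tmul M c d b y)).symm
    rw [tensorTransMap_tmul, Bimod.tensorMapRight_tmul]

theorem BimodIso.tensorTrans_tmul (e : BimodIso B B') (M : LinMod K D) (c : C) (d : D)
    (b : B.obj d c) (y : M.obj.obj d) :
    (e.tensorTrans.app M).hom.app c (B.tmul M c d b y) = B'.tmul M c d (e.equiv d c b) y :=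
  e.tensorTransMap_tmul M c d b y

/-- The isomorphism of functors `B ⊗ -` that is induced by an isomorphism of bimodules. -/
noncomputable def BimodIso.tensorIso (e : BimodIso B B') :
    B.tensorFunctor ≅ B'.tensorFunctor where
  hom := e.tensorTrans
  inv := e.symm.tensorTrans
  hom_inv_id := by
    ext M c : 5
    refine ModuleCat.hom_ext (B.tensor_ext fun d b y => ?_)
    refine (congrArg ((e.symm.tensorTrans.app M).hom.app c) (e.tensorTrans_tmul M c d b y)).trans ?_
    refine (e.symm.tensorTrans_tmul M c d _ y).trans ?_
    exact congrArg (fun b => B.tmul M c d b y) ((e.equiv d c).symm_apply_apply b)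
  inv_hom_id := by
    ext M c : 5
    refine ModuleCat.hom_ext (B'.tensor_ext fun d b y => ?_)
    refine (congrArg ((e.tensorTrans.app M).hom.app c)
      (e.symm.tensorTrans_tmul M c d b y)).trans ?_
    refine (e.tensorTrans_tmul M c d _ y).trans ?_
    exact congrArg (fun b => B'.tmul M c d b y) ((e.equiv d c).apply_symm_apply b)

end BimoduleIso

/-! ### The hom-tensor adjunction -/

section HomTensor
open scoped TensorProduct DirectSum
variable {K : Type u} [CommRing K] {C D : Type} [Category.{u} C] [Preadditive C] [Linear K C]
  [Category.{u} D] [Preadditive D] [Linear K D] [DecidableEq D] (B : Bimod K C D)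

/-- The map `b ↦ f (b ⊗ y)`. -/
noncomputable def Bimod.curryAt {M : LinMod K D} {N : LinMod K C} (f : B.tensorFunctor.obj M ⟶ N)
    (d : D) (y : M.obj.obj d) : B.row d ⟶ N :=
  ObjectProperty.homMk
    { app c := ModuleCat.ofHom ((f.hom.app c).hom.comp ((B.tmul M c d).flip y))
      naturality c c' g := by
        ext b
        refine Eq.trans ?_ (NatTrans.naturality_apply f.hom g (B.tmul M c d b y))
        exact congrArg (f.hom.app c') (B.tensorMap_tmul M g d b y).symm }

/-- The map `y ↦ (b ↦ f (b ⊗ y))`. -/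
noncomputable def Bimod.curry {M : LinMod K D} {N : LinMod K C} (f : B.tensorFunctor.obj M ⟶ N) :
    M ⟶ B.homFunctor.obj N :=
  ObjectProperty.homMk
    { app d := ModuleCat.ofHom
        { toFun := fun y => B.curryAt f d y
          map_add' := fun y y' => by
            refine ObjectProperty.hom_ext _ (NatTrans.ext (funext fun c => ?_))
            ext b
            refine (congrArg (f.hom.app c) (map_add (B.tmul M c d b) y y')).trans ?_
            exact map_add (f.hom.app c).hom _ _
          map_smul' := fun r y => by
            refine ObjectProperty.hom_ext _ (NatTrans.ext (funext fun c => ?_))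
            ext b
            refine (congrArg (f.hom.app c) (map_smul (B.tmul M c d b) r y)).trans ?_
            exact map_smul (f.hom.app c).hom _ _ }
      naturality d' d g := by
        ext y
        refine ObjectProperty.hom_ext _ (NatTrans.ext (funext fun c => ?_))
        ext b
        exact congrArg (f.hom.app c) (B.tmul_balance M c g b y).symm }

/-- The element `g y` of `Hom(B(d, -), N)`. -/
noncomputable def Bimod.homAt {M : LinMod K D} {N : LinMod K C} (g : M ⟶ B.homFunctor.obj N) (d : D)
    (y : M.obj.obj d) : B.row d ⟶ N := g.hom.app d y

/-- The map `(b, y) ↦ g y b`. -/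
noncomputable def Bimod.pairing {M : LinMod K D} {N : LinMod K C} (g : M ⟶ B.homFunctor.obj N)
    (c : C) (d : D) : B.obj d c →ₗ[K] M.obj.obj d →ₗ[K] N.obj.obj c :=
  LinearMap.flip
    { toFun := fun y => ((B.homAt g d y).hom.app c).hom
      map_add' := fun y y' => congrArg (fun φ : B.row d ⟶ N => (φ.hom.app c).hom)
        (map_add (g.hom.app d).hom y y')
      map_smul' := fun r y => congrArg (fun φ : B.row d ⟶ N => (φ.hom.app c).hom)
        (map_smul (g.hom.app d).hom r y) }

/-- This is the naturality of `g` along `f`, evaluated at `b`: the action on `Hom(B, N)` is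
precomposition with the right action on `B`. -/
theorem Bimod.pairing_balance {M : LinMod K D} {N : LinMod K C} (g : M ⟶ B.homFunctor.obj N)
    (c : C) (d' d : D) (f : d' ⟶ d) (b : B.obj d c) (y : M.obj.obj d') :
    B.pairing g c d' (B.right c f b) y = B.pairing g c d b (M.obj.map f y) := by
  have h : B.homAt g d (M.obj.map f y) = (B.rows.map f).unop ≫ B.homAt g d' y :=
    NatTrans.naturality_apply g.hom f y
  exact (congrArg (fun φ : B.row d ⟶ N => φ.hom.app c b) h).symm

/-- The map `b ⊗ y ↦ g y b` at an object. -/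
noncomputable def Bimod.uncurryMap {M : LinMod K D} {N : LinMod K C} (g : M ⟶ B.homFunctor.obj N)
    (c : C) : B.TensorObj M c →ₗ[K] N.obj.obj c :=
  B.tensorLift M c (B.pairing g c) (B.pairing_balance g c)

theorem Bimod.uncurryMap_tmul {M : LinMod K D} {N : LinMod K C} (g : M ⟶ B.homFunctor.obj N)
    (c : C) (d : D) (b : B.obj d c) (y : M.obj.obj d) :
    B.uncurryMap g c (B.tmul M c d b y) = (B.homAt g d y).hom.app c b :=
  B.tensorLift_tmul M c _ _ d b y

/-- The map `b ⊗ y ↦ g y b`. -/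
noncomputable def Bimod.uncurry {M : LinMod K D} {N : LinMod K C} (g : M ⟶ B.homFunctor.obj N) :
    B.tensorFunctor.obj M ⟶ N :=
  ObjectProperty.homMk
    { app c := ModuleCat.ofHom (B.uncurryMap g c)
      naturality c c' h := ModuleCat.hom_ext (B.tensor_ext fun d b y => by
        refine (congrArg (B.uncurryMap g c') (B.tensorMap_tmul M h d b y)).trans ?_
        refine (B.uncurryMap_tmul g c' d _ y).trans ?_
        refine Eq.trans ?_ (congrArg (N.obj.map h) (B.uncurryMap_tmul g c d b y).symm)
        exact NatTrans.naturality_apply (B.homAt g d y).hom h b) }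

theorem Bimod.uncurry_tmul {M : LinMod K D} {N : LinMod K C} (g : M ⟶ B.homFunctor.obj N) (c : C)
    (d : D) (b : B.obj d c) (y : M.obj.obj d) :
    (B.uncurry g).hom.app c (B.tmul M c d b y) = (B.homAt g d y).hom.app c b :=
  B.uncurryMap_tmul g c d b y

theorem Bimod.tensorHom_ext {M : LinMod K D} {N : LinMod K C} {f g : B.tensorFunctor.obj M ⟶ N}
    (h : ∀ c d (b : B.obj d c) (y : M.obj.obj d),
      f.hom.app c (B.tmul M c d b y) = g.hom.app c (B.tmul M c d b y)) : f = g := by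
  refine ObjectProperty.hom_ext _ (NatTrans.ext (funext fun c => ?_))
  exact ModuleCat.hom_ext (B.tensor_ext (h c))

/-- The hom-tensor adjunction. -/
noncomputable def Bimod.homTensorAdj : B.tensorFunctor ⊣ B.homFunctor :=
  Adjunction.mkOfHomEquiv
    { homEquiv := fun M N =>
        { toFun := B.curry
          invFun := B.uncurry
          left_inv := fun f => B.tensorHom_ext fun c d b y => B.uncurry_tmul _ c d b y
          right_inv := fun g => by
            refine ObjectProperty.hom_ext _ (NatTrans.ext (funext fun d => ?_))
            ext y
            refine ObjectProperty.hom_ext _ (NatTrans.ext (funext fun c => ?_))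
            ext b
            exact B.uncurry_tmul g c d b y }
      homEquiv_naturality_left_symm := fun {M M' N} α g => B.tensorHom_ext fun c d b y => by
        refine (B.uncurry_tmul _ c d b y).trans ?_
        refine Eq.trans ?_ (congrArg ((B.uncurry g).hom.app c)
          (B.tensorMapRight_tmul α c d b y).symm)
        exact (B.uncurry_tmul g c d b _).symm
      homEquiv_naturality_right := fun {M N N'} f γ => rfl }

theorem Bimod.homTensorAdj_homEquiv {M : LinMod K D} {N : LinMod K C}
    (f : B.tensorFunctor.obj M ⟶ N) : B.homTensorAdj.homEquiv M N f = B.curry f := by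
  simp [Bimod.homTensorAdj]

end HomTensor

/-! ### Restriction of an adjunction to a full subcategory -/

section Restriction

/-- If the unit of an adjunction is an isomorphism, and the counit is an isomorphism on a full
subcategory which contains the image of the left adjoint, then the adjunction restricts to an
equivalence with this subcategory. -/
theorem restrict_isEquivalence {A E : Type*} [Category A] [Category E] {F : A ⥤ E} {G : E ⥤ A}
    (adj : F ⊣ G) (P : ObjectProperty E) (hu : ∀ M, IsIso (adj.unit.app M))
    (hc : ∀ N, P N → IsIso (adj.counit.app N)) (h : ∀ M, P (F.obj M)) :
    (P.lift F h).IsEquivalence ∧ (P.ι ⋙ G).IsEquivalence := by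
  have : IsIso adj.unit := NatIso.isIso_of_isIso_app _
  have hF := adj.fullyFaithfulLOfIsIsoUnit
  have := hF.full
  have := hF.faithful
  -- An invertible unit makes `F` fully faithful, and the counit at an object of the subcategory
  -- exhibits it as an object in the image.
  have h1 : (P.lift F h).IsEquivalence :=
    { essSurj := ⟨fun N => by
        have := hc N.obj N.property
        exact ⟨G.obj N.obj, ⟨P.isoMk (asIso (adj.counit.app N.obj))⟩⟩⟩ }
  refine ⟨h1, ?_⟩
  -- The restricted right adjoint becomes the identity after composition with the equivalence
  -- `P.lift F h`, so it is an equivalence by cancellation.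
  have i : P.lift F h ⋙ P.ι ⋙ G ≅ 𝟭 A := (asIso adj.unit).symm
  have : (P.lift F h ⋙ P.ι ⋙ G).IsEquivalence := Functor.isEquivalence_of_iso i.symm
  exact Functor.isEquivalence_of_comp_left (P.lift F h) _

end Restriction

/-! ### Reduction to Powell's bimodule -/

section Transfer
variable {K : Type u} [CommRing K]

theorem inducesAnalyticEquivalence_of_homTensorAdj (B : Bimod K (KGrOp K) (CatLie K))
    (hu : ∀ M, IsIso (B.homTensorAdj.unit.app M))
    (hc : ∀ N, IsAnalytic K N → IsIso (B.homTensorAdj.counit.app N))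
    (h : ∀ M, IsAnalytic K (B.tensorFunctor.obj M)) : B.InducesAnalyticEquivalence := by
  refine ⟨B.homTensorAdj, fun M N f d y φ hφ c b => ?_, hu, hc, h,
    restrict_isEquivalence B.homTensorAdj (IsAnalytic K) hu hc h⟩
  subst hφ
  rw [Bimod.homTensorAdj_homEquiv]
  rfl

theorem isAnalytic_of_iso {N N' : LinMod K (KGrOp K)} (i : N ≅ N') (h : IsAnalytic K N) :
    IsAnalytic K N' := by
  intro c x
  obtain ⟨P, j, d, hj, hP, y, hy⟩ := h c (i.inv.hom.app c x)
  refine ⟨P, j ≫ i.hom, d, mono_comp _ _, hP, y, ?_⟩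
  refine (congrArg (i.hom.hom.app c) hy).trans ?_
  exact congrArg (fun f : N' ⟶ N' => f.hom.app c x) i.inv_hom_id

/-- Isomorphic left adjoints are fully faithful at the same time and have the same essential image.
Full faithfulness is equivalent to the invertibility of the unit. Once it holds, the counit is
invertible precisely on the essential image. -/
theorem transfer_homTensorAdj {B B' : Bimod K (KGrOp K) (CatLie K)} (e : BimodIso B B')
    (hu : ∀ M, IsIso (B.homTensorAdj.unit.app M))
    (hc : ∀ N, IsAnalytic K N → IsIso (B.homTensorAdj.counit.app N))
    (h : ∀ M, IsAnalytic K (B.tensorFunctor.obj M)) : B'.InducesAnalyticEquivalence := by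
  have : IsIso B.homTensorAdj.unit := NatIso.isIso_of_isIso_app _
  have hF := B.homTensorAdj.fullyFaithfulLOfIsIsoUnit
  have hF' := hF.ofIso e.tensorIso
  have := hF.full
  have := hF.faithful
  have := hF'.full
  have := hF'.faithful
  refine inducesAnalyticEquivalence_of_homTensorAdj B' (fun M => inferInstance) (fun N hN => ?_)
    fun M => isAnalytic_of_iso (e.tensorIso.app M) (h M)
  rw [Adjunction.isIso_counit_app_iff_mem_essImage]
  have := hc N hN
  rw [Adjunction.isIso_counit_app_iff_mem_essImage] at this
  exact this.ofNatIso e.tensorIso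

end Transfer

/-- A functor from `gr^op` to modules. -/
structure GrRep (K : Type u) [CommRing K] (V : ℕ → Type u) [∀ n, AddCommGroup (V n)]
    [∀ n, Module K (V n)] where
  /-- The action of a homomorphism `F_{n'} → F_n`. -/
  act {n n' : ℕ} : (FreeGroup (Fin n') →* FreeGroup (Fin n)) → V n →ₗ[K] V n'
  act_id {n : ℕ} (x : V n) : act (MonoidHom.id _) x = x
  act_comp {l m n : ℕ} (φ : FreeGroup (Fin m) →* FreeGroup (Fin l))
    (ψ : FreeGroup (Fin n) →* FreeGroup (Fin m)) (x : V l) :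
    act (φ.comp ψ) x = act ψ (act φ x)

/-! ### Killing blocks of generators -/

section Kill
variable {ι κ : Type} [DecidableEq ι] [DecidableEq κ] {n : ℕ}

/-- The endomorphism of `F_n` that kills the generators in the blocks with index in `A`. -/
def killSet (p : Fin n → ι) (A : Finset ι) : FreeGroup (Fin n) →* FreeGroup (Fin n) :=
  FreeGroup.lift fun j => if p j ∈ A then 1 else FreeGroup.of j

theorem killSet_of (p : Fin n → ι) (A : Finset ι) (j : Fin n) :
    killSet p A (FreeGroup.of j) = if p j ∈ A then 1 else FreeGroup.of j :=
  FreeGroup.lift_apply_of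

theorem killSet_empty (p : Fin n → ι) : killSet p ∅ = MonoidHom.id _ := by
  ext j; simp [killSet_of]

theorem killSet_comp (p : Fin n → ι) (A B : Finset ι) :
    (killSet p A).comp (killSet p B) = killSet p (A ∪ B) := by
  ext j
  rw [MonoidHom.comp_apply, killSet_of, killSet_of]
  by_cases hB : p j ∈ B
  · simp [hB]
  · simp [hB, killSet_of]

theorem killSet_comp_of_mem (p : Fin n → ι) {A : Finset ι} {i : ι} (h : i ∈ A) :
    (killSet p {i}).comp (killSet p A) = killSet p A := by
  rw [killSet_comp, Finset.union_eq_right.2 (Finset.singleton_subset_iff.2 h)]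

/-- The block `i` is contained in the coarser block `g i`, whose generators are already dead. -/
theorem killSet_comp_map (p : Fin n → ι) (g : ι → κ) (i : ι) :
    (killSet p {i}).comp (killSet (g ∘ p) {g i}) = killSet (g ∘ p) {g i} := by
  ext j
  rw [MonoidHom.comp_apply, killSet_of]
  by_cases h : g (p j) = g i
  · simp [h]
  · have : p j ≠ i := fun e => h (by rw [e])
    simp [h, killSet_of, this]

theorem killBlock_eq {d : ℕ} (p : Fin n → Fin (d + 1)) (i : Fin (d + 1)) :
    killBlock p i = killSet p {i} := by
  ext j
  simp [killBlock, killSet_of]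

end Kill

/-! ### Cross effects, degree, and primitivity modulo a subfunctor -/

namespace GrRep
variable {K : Type u} [CommRing K] {V : ℕ → Type u} [∀ n, AddCommGroup (V n)]
  [∀ n, Module K (V n)] (R : GrRep K V) {ι κ : Type} [DecidableEq ι] [DecidableEq κ] {n m D : ℕ}

/-- The projection to the cross effect: the product of the `1 - e_i`, where `e_i` kills the block
with index `i ∈ T`. -/
noncomputable def cross (p : Fin n → ι) (T : Finset ι) : V n →ₗ[K] V n :=
  ∑ A ∈ T.powerset, (-1 : K) ^ A.card • R.act (killSet p A)

theorem cross_apply (p : Fin n → ι) (T : Finset ι) (x : V n) :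
    R.cross p T x = ∑ A ∈ T.powerset, (-1 : K) ^ A.card • R.act (killSet p A) x := by
  simp [cross]

theorem act_killSet_eq_zero {p : Fin n → ι} {A : Finset ι} {i : ι} (h : i ∈ A) {x : V n}
    (hx : R.act (killSet p {i}) x = 0) : R.act (killSet p A) x = 0 := by
  rw [← killSet_comp_of_mem p h, R.act_comp, hx, map_zero]

/-- Every summand with nonempty `A` factors through the killing of one block, so only `A = ∅` is
left. -/
theorem cross_eq_self {p : Fin n → ι} {T : Finset ι} {x : V n}
    (hx : ∀ i ∈ T, R.act (killSet p {i}) x = 0) : R.cross p T x = x := by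
  rw [cross_apply, Finset.sum_eq_single ∅]
  · simp [killSet_empty, R.act_id]
  · intro A hA hne
    obtain ⟨i, hi⟩ := Finset.nonempty_iff_ne_empty.2 hne
    rw [R.act_killSet_eq_zero hi (hx i (Finset.mem_powerset.1 hA hi)), smul_zero]
  · simp

/-- Splits off the factor `1 - e_i`; since `e_i` is idempotent, `e_i` therefore kills the cross
effects with `i ∈ T`. -/
theorem cross_insert (p : Fin n → ι) {T : Finset ι} {i : ι} (hi : i ∉ T) (x : V n) :
    R.cross p (insert i T) x = R.cross p T x - R.act (killSet p {i}) (R.cross p T x) := by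
  rw [cross_apply, cross_apply, Finset.sum_powerset_insert hi, sub_eq_add_neg, map_sum,
    ← Finset.sum_neg_distrib]
  congr 1
  refine Finset.sum_congr rfl fun A hA => ?_
  have hiA : i ∉ A := fun h => hi (Finset.mem_powerset.1 hA h)
  rw [Finset.card_insert_of_notMem hiA, pow_succ, mul_neg_one, neg_smul, map_smul, ← R.act_comp,
    killSet_comp, Finset.union_comm, Finset.insert_eq]

theorem act_killSet_cross (p : Fin n → ι) {T : Finset ι} {i : ι} (hi : i ∈ T) (x : V n) :
    R.act (killSet p {i}) (R.cross p T x) = 0 := by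
  rw [← Finset.insert_erase hi, R.cross_insert p (Finset.notMem_erase i T), map_sub, ← R.act_comp,
    killSet_comp, Finset.union_self, sub_self]

/-- The elements that generate a polynomial functor of degree at most `D`. -/
noncomputable def deg (D n : ℕ) : Submodule K (V n) where
  carrier := {x | ∀ (m : ℕ) (φ : FreeGroup (Fin m) →* FreeGroup (Fin n)) (p : Fin m → Fin (D + 1)),
    R.cross p Finset.univ (R.act φ x) = 0}
  add_mem' hx hy m φ p := by rw [map_add, map_add, hx, hy, add_zero]
  zero_mem' m φ p := by rw [map_zero, map_zero]
  smul_mem' r x hx m φ p := by rw [map_smul, map_smul, hx, smul_zero]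

/-- Subfunctors. -/
def IsStable (S : ∀ n, Submodule K (V n)) : Prop :=
  ∀ ⦃n n' : ℕ⦄ (φ : FreeGroup (Fin n') →* FreeGroup (Fin n)) ⦃x : V n⦄, x ∈ S n → R.act φ x ∈ S n'

/-- The condition is imposed on all images of `x` under `gr^op`, which makes it closed under the
action by construction. -/
theorem isStable_deg (D : ℕ) : R.IsStable (R.deg D) := fun n n' φ x hx m ψ p => by
  rw [← R.act_comp]
  exact hx m _ p

theorem isStable_bot : R.IsStable fun _ => ⊥ := fun n n' φ x hx => by
  rw [Submodule.mem_bot] at hx ⊢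
  rw [hx, map_zero]

theorem isStable_top : R.IsStable fun _ => ⊤ := fun _ _ _ _ _ => Submodule.mem_top

variable {R}

theorem IsStable.cross {S : ∀ n, Submodule K (V n)} (hS : R.IsStable S) (p : Fin n → ι)
    (T : Finset ι) {x : V n} (hx : x ∈ S n) : R.cross p T x ∈ S n := by
  rw [cross_apply]
  exact Submodule.sum_mem _ fun A _ => Submodule.smul_mem _ _ (hS _ hx)

/-- Cross effects of higher order vanish as well. The blocks are merged to `D + 1` coarse blocks,
each of which contains a block of `T`. The element `R.cross p T x` dies if any coarse block is
killed, so it equals its own cross effect of order `D + 1`, which is zero. -/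
theorem cross_eq_zero {x : V n} (hx : x ∈ R.deg D n) (p : Fin n → ι) {T : Finset ι}
    (hT : D + 1 ≤ T.card) : R.cross p T x = 0 := by
  have hy := (R.isStable_deg D).cross p T hx
  obtain ⟨e⟩ : Nonempty (Fin (D + 1) ↪ T) := by
    rw [Function.Embedding.nonempty_iff_card_le]
    simpa using hT
  let f : Fin (D + 1) → ι := fun j => (e j).1
  have hf : Function.Injective f := fun i j h => e.injective (Subtype.ext h)
  have : Nonempty (Fin (D + 1)) := ⟨0⟩
  -- The coarsening: the block `f j` goes to `j`, and it does not matter where the blocks outside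
  -- the range of `f` go.
  let g : ι → Fin (D + 1) := Function.invFun f
  have hgf : ∀ j, g (f j) = j := Function.leftInverse_invFun hf
  have h0 := hy n (MonoidHom.id _) (g ∘ p)
  rw [R.act_id, R.cross_eq_self] at h0
  · exact h0
  · intro j _
    rw [← hgf j, ← killSet_comp_map, R.act_comp, R.act_killSet_cross p (e j).2, map_zero]

theorem deg_mono {D' : ℕ} (h : D ≤ D') : R.deg D n ≤ R.deg D' n := fun x hx m φ p =>
  cross_eq_zero (R.isStable_deg D φ hx) p (by simpa using h)

variable (R)

/-- The element `x` is primitive in the variable `a`, modulo the subfunctor `S`. -/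
def PrimMod (S : ∀ n, Submodule K (V n)) (a : Fin n) (x : V n) : Prop :=
  ∀ (m : ℕ) (h : FreeGroup (Fin m) →* FreeGroup (Option (Fin n))),
    R.act ((subBoth a).comp h) x - R.act (subKill.comp h) x - R.act ((subMove a).comp h) x ∈ S m

/-- An extra letter. -/
def addLetter (n : ℕ) : FreeGroup (Fin (n + 1)) ≃* FreeGroup (Option (Fin n)) :=
  FreeGroup.freeGroupCongr (finSuccEquiv n)

variable {R}

/-- The identity of the free group with the extra letter is the universal test: every other `h`
factors through it, and `S` is stable. -/
theorem PrimMod.of_addLetter {S : ∀ n, Submodule K (V n)} (hS : R.IsStable S) {a : Fin n} {x : V n}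
    (h : R.act ((subBoth a).comp (addLetter n).toMonoidHom) x -
      R.act (subKill.comp (addLetter n).toMonoidHom) x -
      R.act ((subMove a).comp (addLetter n).toMonoidHom) x ∈ S (n + 1)) : R.PrimMod S a x := by
  intro m φ
  have e : ∀ f : FreeGroup (Option (Fin n)) →* FreeGroup (Fin n), f.comp φ =
      (f.comp (addLetter n).toMonoidHom).comp ((addLetter n).symm.toMonoidHom.comp φ) := by
    intro f
    ext i
    simp
  rw [e, e, e, R.act_comp, R.act_comp, R.act_comp, ← map_sub, ← map_sub]
  exact hS _ h

/-- The endomorphism that kills one letter. -/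
def killOpt (o : Option (Fin n)) : FreeGroup (Option (Fin n)) →* FreeGroup (Option (Fin n)) :=
  FreeGroup.lift fun o' => if o' = o then 1 else FreeGroup.of o'

theorem addLetter_comp_killSet (i : Fin (n + 1)) :
    (addLetter n).toMonoidHom.comp (killSet id {i}) =
      (killOpt (finSuccEquiv n i)).comp (addLetter n).toMonoidHom := by
  ext j
  simp only [MonoidHom.comp_apply, killSet_of, addLetter, killOpt]
  by_cases h : j = i <;> simp [h]

/-- If `x` lies in the cross effect, so does its defect of primitivity, with one more variable.
Killing the new letter makes the first two terms equal and the third zero. Killing `a` makes the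
first and third terms equal and the second zero. Killing any other letter annihilates all three
terms. -/
theorem act_killSet_defect {a : Fin n} {x : V n}
    (hx : ∀ i, R.act (killSet id {i}) x = 0) (i : Fin (n + 1)) :
    R.act (killSet id {i}) (R.act ((subBoth a).comp (addLetter n).toMonoidHom) x -
      R.act (subKill.comp (addLetter n).toMonoidHom) x -
      R.act ((subMove a).comp (addLetter n).toMonoidHom) x) = 0 := by
  simp only [map_sub, ← R.act_comp, MonoidHom.comp_assoc, addLetter_comp_killSet]
  simp only [← MonoidHom.comp_assoc]
  generalize finSuccEquiv n i = o
  -- The action is contravariant in group homomorphisms: the left factor `killSet id {b}` acts on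
  -- `x` first, and annihilates it.
  have hk : ∀ (b : Fin n) (f g : FreeGroup (Option (Fin n)) →* FreeGroup (Fin n)),
      f = (killSet id {b}).comp g → R.act (f.comp (addLetter n).toMonoidHom) x = 0 := by
    rintro b _ g rfl
    rw [MonoidHom.comp_assoc, R.act_comp, hx, map_zero]
  rcases o with _ | b
  · rw [hk a ((subMove a).comp (killOpt none)) subKill, sub_zero, sub_eq_zero]
    · refine congrArg (fun f : FreeGroup (Option (Fin n)) →* FreeGroup (Fin n) =>
        R.act (f.comp (addLetter n).toMonoidHom) x) ?_
      ext o
      cases o <;> simp [subBoth, subKill, killOpt]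
    · ext o
      rcases o with _ | b
      · simp [subMove, subKill, killOpt]
      · by_cases hb : b = a <;> simp [subMove, subKill, killOpt, killSet_of, hb]
  · by_cases hab : b = a
    · subst hab
      rw [hk b (subKill.comp (killOpt (some b))) subKill, sub_zero, sub_eq_zero]
      · refine congrArg (fun f : FreeGroup (Option (Fin n)) →* FreeGroup (Fin n) =>
          R.act (f.comp (addLetter n).toMonoidHom) x) ?_
        ext o
        rcases o with _ | c
        · simp [subBoth, subMove, killOpt]
        · by_cases hc : c = b <;> simp [subBoth, subMove, killOpt, hc]
      · ext o
        rcases o with _ | c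
        · simp [subKill, killOpt]
        · by_cases hc : c = b <;> simp [subKill, killOpt, killSet_of, hc]
    · have hba : a ≠ b := fun h => hab h.symm
      rw [hk b _ (subBoth a), hk b _ subKill, hk b _ (subMove a), sub_zero, sub_zero]
      · ext o
        rcases o with _ | c
        · simp [subMove, killOpt, killSet_of, hba]
        · by_cases hc : c = b
          · subst hc
            simp [subMove, killOpt, killSet_of, hab]
          · by_cases hca : c = a <;> simp [subMove, killOpt, killSet_of, hc, hca, hba]
      · ext o
        rcases o with _ | c
        · simp [subKill, killOpt]
        · by_cases hc : c = b <;> simp [subKill, killOpt, killSet_of, hc]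
      · ext o
        rcases o with _ | c
        · simp [subBoth, killOpt, killSet_of, hba]
        · by_cases hc : c = b <;> simp [subBoth, killOpt, killSet_of, hc]

/-- Killing one letter factors through a free group of smaller rank, which allows an induction on
the number of variables. -/
theorem killSet_succAbove (i : Fin (n + 1)) :
    killSet id {i} = (FreeGroup.map i.succAbove).comp
      (FreeGroup.lift (i.insertNth (α := fun _ => FreeGroup (Fin n)) 1 FreeGroup.of)) := by
  refine FreeGroup.ext_hom _ _ fun j => ?_
  rw [killSet_of, MonoidHom.comp_apply, FreeGroup.lift_apply_of]
  induction j using Fin.succAboveCases i with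
  | x => simp
  | p j => simp [Fin.succAbove_ne]

/-- A subfunctor `T` of an analytic functor is contained in the subfunctor `S` if `S` contains all
elements of `T` that are primitive modulo `S` in all variables. -/
theorem mem_of_primMod {S T : ∀ n, Submodule K (V n)} (hS : R.IsStable S) (hT : R.IsStable T)
    (hD : ∀ n, ∀ x ∈ T n, ∃ D, x ∈ R.deg D n)
    (hP : ∀ n, ∀ x ∈ T n, (∀ a, R.PrimMod S a x) → x ∈ S n) (n : ℕ) (x : V n) (hx : x ∈ T n) :
    x ∈ S n := by
  obtain ⟨D, hxD⟩ := hD n x hx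
  -- For elements of the cross effect, the induction goes downwards in the number of letters, `k`
  -- being at least the number that is missing to `D + 1`. With `D + 1` letters the element is zero.
  -- With fewer letters its defects of primitivity have one letter more and lie in `S` by induction,
  -- so the element is primitive modulo `S`.
  have claim : ∀ k j (x : V j), D + 1 ≤ j + k → x ∈ T j → x ∈ R.deg D j →
      (∀ i, R.act (killSet id {i}) x = 0) → x ∈ S j := by
    intro k
    induction k with
    | zero =>
      intro j x hj _ hx h
      rw [← R.cross_eq_self (p := id) (T := Finset.univ) fun i _ => h i,
        cross_eq_zero hx _ (by simpa using hj)]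
      exact Submodule.zero_mem _
    | succ k ih =>
      intro j x hj hxT hx h
      refine hP j x hxT fun a => PrimMod.of_addLetter hS ?_
      refine ih (j + 1) _ (by omega) ?_ ?_ (act_killSet_defect h)
      · exact Submodule.sub_mem _ (Submodule.sub_mem _ (hT _ hxT) (hT _ hxT)) (hT _ hxT)
      · have hd := R.isStable_deg D
        exact Submodule.sub_mem _ (Submodule.sub_mem _ (hd _ hx) (hd _ hx)) (hd _ hx)
  induction n with
  | zero => exact claim (D + 1) 0 x (by omega) hx hxD fun i => i.elim0
  | succ n ih =>
    have h1 : R.cross id Finset.univ x ∈ S (n + 1) :=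
      claim (D + 1) (n + 1) _ (by omega) (hT.cross _ _ hx) ((R.isStable_deg D).cross _ _ hxD)
        fun i => R.act_killSet_cross id (Finset.mem_univ i) x
    -- In the cross effect of a general `x`, the summand for `A = ∅` is `x`. The other summands come
    -- from fewer letters, where the induction on `n` applies.
    rw [cross_apply, ← Finset.add_sum_erase _ _ (Finset.empty_mem_powerset _)] at h1
    simp only [Finset.card_empty, pow_zero, killSet_empty, R.act_id, one_smul] at h1
    refine (Submodule.add_mem_iff_left _ (Submodule.sum_mem _ fun A hA => ?_)).1 h1
    obtain ⟨i, hi⟩ := Finset.nonempty_iff_ne_empty.2 (Finset.ne_of_mem_erase hA)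
    rw [← killSet_comp_of_mem id hi, R.act_comp, killSet_succAbove, R.act_comp]
    refine Submodule.smul_mem _ _ (hS _ (hS _ (ih _ (hT _ hx) ?_)))
    exact R.isStable_deg D _ hxD

end GrRep

/-! ### Extraction of coefficients of polynomial functions in characteristic zero -/

section PowerCoefficients
variable (K : Type u) [Field K] [CharZero K]

/-- The weights are a row of the inverse of the Vandermonde matrix with nodes `0, …, m - 1`, which
are distinct in characteristic zero. For `j ≥ m` there is nothing to extract, and zero weights do.
-/
theorem exists_powCoeff (m j : ℕ) : ∃ c : ℕ → K, ∀ i < m,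
    ∑ r ∈ Finset.range m, c r * (r : K) ^ i = if i = j then 1 else 0 := by
  by_cases hj : j < m
  · let v : Fin m → K := fun i => (i : ℕ)
    have hv : Function.Injective v := fun i k h => Fin.ext (Nat.cast_injective h)
    have hdet : IsUnit (Matrix.vandermonde v).det :=
      isUnit_iff_ne_zero.2 (Matrix.det_vandermonde_ne_zero_iff.2 hv)
    refine ⟨fun r => if h : r < m then (Matrix.vandermonde v)⁻¹ ⟨j, hj⟩ ⟨r, h⟩ else 0,
      fun i hi => ?_⟩
    have h := congrFun (congrFun (Matrix.nonsing_inv_mul _ hdet) ⟨j, hj⟩) ⟨i, hi⟩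
    rw [Matrix.mul_apply, Matrix.one_apply] at h
    rw [← Fin.sum_univ_eq_sum_range (fun r => (if h : r < m then
      (Matrix.vandermonde v)⁻¹ ⟨j, hj⟩ ⟨r, h⟩ else 0) * (r : K) ^ i)]
    simpa [Matrix.vandermonde, v, Fin.ext_iff, eq_comm] using h
  · refine ⟨0, fun i hi => ?_⟩
    rw [if_neg (by omega)]
    simp

/-- The numbers with `∑ c_r r ^ i = δ_{i j}` for `i < m`, the sum being over `r < m`. -/
noncomputable def powCoeff (m j : ℕ) : ℕ → K := Classical.choose (exists_powCoeff K m j)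

theorem sum_powCoeff {m i : ℕ} (j : ℕ) (hi : i < m) :
    ∑ r ∈ Finset.range m, powCoeff K m j r * (r : K) ^ i = if i = j then 1 else 0 :=
  Classical.choose_spec (exists_powCoeff K m j) i hi

variable {K} {W : Type*} [AddCommGroup W] [Module K W]

/-- The number `m` of nodes may exceed the number `n` of coefficients; this is what makes the later
projections independent of the bound on the degree. -/
theorem sum_powCoeff_smul {m n j : ℕ} (hj : j < n) (hn : n ≤ m) {f : ℕ → W} {v : ℕ → W}
    (hf : ∀ r, f r = ∑ i ∈ Finset.range n, (r : K) ^ i • v i) :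
    ∑ r ∈ Finset.range m, powCoeff K m j r • f r = v j := by
  simp only [hf, Finset.smul_sum, smul_smul]
  rw [Finset.sum_comm]
  simp only [← Finset.sum_smul]
  rw [Finset.sum_eq_single j]
  · rw [sum_powCoeff K j (by omega), if_pos rfl, one_smul]
  · intro i hi hij
    rw [sum_powCoeff K j (by have := Finset.mem_range.1 hi; omega), if_neg hij, zero_smul]
  · intro h
    exact absurd (Finset.mem_range.2 hj) h

theorem sum_pow_unique {n j : ℕ} (hj : j < n) {v w : ℕ → W}
    (h : ∀ r : ℕ, ∑ i ∈ Finset.range n, (r : K) ^ i • v i =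
      ∑ i ∈ Finset.range n, (r : K) ^ i • w i) : v j = w j := by
  rw [← sum_powCoeff_smul (K := K) hj le_rfl (f := fun r : ℕ => ∑ i ∈ Finset.range n, (r : K) ^ i • v i)
    fun _ => rfl]
  exact sum_powCoeff_smul hj le_rfl h

/-- If `f (r, r) = r p`, `f (r, 0) = r q` and `f (0, r) = r t` for a polynomial function `f` of two
variables, then `p = q + t`. -/
theorem linear_part_add {D : ℕ} {z : ℕ → ℕ → W} {p q t : W}
    (hp : ∀ r : ℕ, ∑ j ∈ Finset.range (D + 2), (r : K) ^ j •
      ∑ i ∈ Finset.range (D + 2), (r : K) ^ i • z i j = (r : K) • p)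
    (hq : ∀ r : ℕ, ∑ j ∈ Finset.range (D + 2), ((0 : ℕ) : K) ^ j •
      ∑ i ∈ Finset.range (D + 2), (r : K) ^ i • z i j = (r : K) • q)
    (ht : ∀ r : ℕ, ∑ j ∈ Finset.range (D + 2), (r : K) ^ j •
      ∑ i ∈ Finset.range (D + 2), ((0 : ℕ) : K) ^ i • z i j = (r : K) • t) : p = q + t := by
  -- A linear function, as a polynomial with the single coefficient `x` at index `1`. The range `D +
  -- 2` contains this index even for `D = 0`.
  have lin : ∀ x : W, ∀ r : ℕ, (r : K) • x =
      ∑ i ∈ Finset.range (D + 2), (r : K) ^ i • (if i = 1 then x else 0) := by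
    intro x r
    rw [Finset.sum_eq_single 1] <;> simp +contextual
  have h0 : ∀ x : ℕ → W, ∑ i ∈ Finset.range (D + 2), ((0 : ℕ) : K) ^ i • x i = x 0 := by
    intro x
    rw [Finset.sum_eq_single 0] <;> simp +contextual
  have hq' : z 1 0 = q := by
    have := sum_pow_unique (K := K) (n := D + 2) (j := 1) (by omega) (v := fun i => z i 0)
      (w := fun i => if i = 1 then q else 0) fun r => by rw [← lin, ← hq, h0]
    simpa using this
  have ht' : z 0 1 = t := by
    have := sum_pow_unique (K := K) (n := D + 2) (j := 1) (by omega) (v := fun i => z 0 i)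
      (w := fun i => if i = 1 then t else 0) fun r => by
        rw [← lin, ← ht]
        exact Finset.sum_congr rfl fun j _ => by rw [h0]
    simpa using this
  -- On the diagonal the exponents add up, so that up to `2 (D + 2)` nodes are used to extract the
  -- coefficient of `r`.
  have key := sum_powCoeff_smul (K := K) (m := D + 2 + (D + 2)) (n := D + 2) (j := 1) (by omega)
    (by omega) (f := fun r : ℕ => (r : K) • p) (lin p)
  rw [if_pos rfl] at key
  rw [← key]
  simp only [← hp, Finset.smul_sum, smul_smul, ← pow_add]
  rw [Finset.sum_comm]
  have inner : ∀ j ∈ Finset.range (D + 2), ∑ r ∈ Finset.range (D + 2 + (D + 2)),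
      ∑ i ∈ Finset.range (D + 2), (powCoeff K (D + 2 + (D + 2)) 1 r * (r : K) ^ (j + i)) • z i j =
      ∑ i ∈ Finset.range (D + 2), if j + i = 1 then z i j else 0 := by
    intro j hj
    rw [Finset.sum_comm]
    refine Finset.sum_congr rfl fun i hi => ?_
    have := Finset.mem_range.1 hi
    have := Finset.mem_range.1 hj
    rw [← Finset.sum_smul, sum_powCoeff K 1 (by omega)]
    split_ifs <;> simp
  -- Only the indices with `i + j = 1` survive, so the coefficient on the diagonal is `z 1 0 + z 0
  -- 1`.
  rw [Finset.sum_congr rfl inner, Finset.sum_range_succ', Finset.sum_range_succ',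
    Finset.sum_eq_zero]
  · rw [zero_add, Finset.sum_eq_single 0, Finset.sum_eq_single 1]
    · simp [hq', ht', add_comm]
    · intro i _ hi
      rw [if_neg (by omega)]
    · simp
    · intro i _ hi
      rw [if_neg (by omega)]
    · simp
  · intro j _
    refine Finset.sum_eq_zero fun i _ => ?_
    rw [if_neg (by omega)]

/-- A function with vanishing differences of order `D + 1` is polynomial. -/
theorem exists_pow_expansion {D : ℕ} {f : ℕ → W}
    (hf : ∀ r, ∑ k ∈ Finset.range (D + 2), ((-1 : K) ^ k * (D + 1).choose k) • f (r + (D + 1 - k)) = 0) :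
    ∃ v : ℕ → W, ∀ r, f r = ∑ j ∈ Finset.range (D + 2), (r : K) ^ j • v j := by
  -- The hypothesis is the vanishing of the iterated forward difference, with the order of summation
  -- reversed.
  have hd : (fwdDiff 1)^[D + 1] f = 0 := by
    funext r
    rw [fwdDiff_iter_eq_sum_shift, Pi.zero_apply, ← hf r, ← Finset.sum_flip]
    refine Finset.sum_congr rfl fun k hk => ?_
    have hk' : k ≤ D + 1 := by have := Finset.mem_range.1 hk; omega
    rw [Nat.choose_symm hk', Nat.sub_sub_self hk', ← Int.cast_smul_eq_zsmul K]
    push_cast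
    simp
  have hd' : ∀ k, D + 1 ≤ k → (fwdDiff 1)^[k] f 0 = 0 := by
    intro k hk
    obtain ⟨i, rfl⟩ := Nat.exists_eq_add_of_le' hk
    rw [Function.iterate_add_apply, hd]
    have : ∀ i, (fwdDiff 1)^[i] (0 : ℕ → W) = 0 := by
      intro i
      induction i with
      | zero => rfl
      | succ i ih =>
        rw [Function.iterate_succ_apply']
        rw [ih]
        funext r
        simp [fwdDiff]
    rw [this, Pi.zero_apply]
  -- The binomial coefficients are polynomials in `r` with `k!` as denominator, hence characteristic
  -- zero.
  have hc : ∀ k < D + 2, ∃ s : ℕ → K, ∀ r : ℕ,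
      (r.choose k : K) = ∑ j ∈ Finset.range (D + 2), s j * (r : K) ^ j := by
    intro k hk
    refine ⟨fun j => (k.factorial : K)⁻¹ * (descPochhammer K k).coeff j, fun r => ?_⟩
    simp only [mul_assoc, ← Finset.mul_sum]
    rw [← Polynomial.eval_eq_sum_range' (by rw [descPochhammer_natDegree]; exact hk),
      descPochhammer_eval_eq_descFactorial, Nat.descFactorial_eq_factorial_mul_choose, Nat.cast_mul,
      inv_mul_cancel_left₀ (Nat.cast_ne_zero.2 (Nat.factorial_ne_zero k))]
  choose! s hs using hc
  refine ⟨fun j => ∑ k ∈ Finset.range (D + 2), s k j • (fwdDiff 1)^[k] f 0, fun r => ?_⟩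
  -- Newton's expansion at `0`. The differences of order at least `D + 1` vanish, and binomial
  -- coefficients with `k > r` vanish too, so the summation ranges `r + 1` and `D + 2` give the same
  -- sum; they are compared inside a common range.
  have h1 : f r = ∑ k ∈ Finset.range (D + 2), r.choose k • (fwdDiff 1)^[k] f 0 := by
    have := shift_eq_sum_fwdDiff_iter 1 f r 0
    simp only [zero_add, smul_eq_mul, mul_one] at this
    rw [this]
    have e1 : Finset.range (r + 1) ⊆ Finset.range (r + 1 + (D + 2)) := Finset.range_mono (by omega)
    have e2 : Finset.range (D + 2) ⊆ Finset.range (r + 1 + (D + 2)) := Finset.range_mono (by omega)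
    rw [Finset.sum_subset e1, Finset.sum_subset e2]
    · intro k _ hk
      rw [hd' k (by have := mt Finset.mem_range.2 hk; omega), smul_zero]
    · intro k _ hk
      rw [Nat.choose_eq_zero_of_lt (by have := mt Finset.mem_range.2 hk; omega), zero_smul]
  rw [h1]
  simp only [Finset.smul_sum, smul_smul]
  rw [Finset.sum_comm]
  refine Finset.sum_congr rfl fun k hk => ?_
  rw [← Finset.sum_smul, ← Nat.cast_smul_eq_nsmul K, hs k (Finset.mem_range.1 hk)]
  simp only [mul_comm]

end PowerCoefficients

/-! ### The operations `x_a ↦ x_a ^ r` and the projection to primitive elements -/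

namespace GrRep

section PowerMaps
variable {n : ℕ}

/-- The endomorphism `x_a ↦ x_a ^ r`. -/
def powMap (a : Fin n) (r : ℕ) : FreeGroup (Fin n) →* FreeGroup (Fin n) :=
  FreeGroup.lift fun j => if j = a then FreeGroup.of a ^ r else FreeGroup.of j

theorem powMap_of (a : Fin n) (r : ℕ) (j : Fin n) : powMap a r (FreeGroup.of j) =
    if j = a then FreeGroup.of a ^ r else FreeGroup.of j := FreeGroup.lift_apply_of

theorem powMap_comp (a : Fin n) (r s : ℕ) :
    (powMap a r).comp (powMap a s) = powMap a (r * s) := by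
  ext j
  rw [MonoidHom.comp_apply, powMap_of, powMap_of]
  by_cases h : j = a
  · simp [h, powMap_of, pow_mul]
  · simp [h, powMap_of]

theorem powMap_one (a : Fin n) : powMap a 1 = MonoidHom.id _ := by
  ext j
  rw [powMap_of]
  by_cases h : j = a <;> simp [h]

/-- `x_o ↦ x_o ^ r`, with an extra letter. -/
def powOpt (o : Option (Fin n)) (r : ℕ) : FreeGroup (Option (Fin n)) →* FreeGroup (Option (Fin n)) :=
  FreeGroup.lift fun o' => if o' = o then FreeGroup.of o ^ r else FreeGroup.of o'

theorem addLetter_comp_powMap (o : Option (Fin n)) (r : ℕ) :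
    (addLetter n).toMonoidHom.comp (powMap ((finSuccEquiv n).symm o) r) =
      (powOpt o r).comp (addLetter n).toMonoidHom := by
  ext j
  simp only [MonoidHom.comp_apply, powMap_of, addLetter, powOpt]
  by_cases h : j = (finSuccEquiv n).symm o
  · simp [h]
  · have : finSuccEquiv n j ≠ o := fun e => h (by rw [← e, Equiv.symm_apply_apply])
    simp [h, this]

theorem list_prod_ofFn_pow {G : Type} [Group G] (g : G) {q : ℕ} (k : Fin q → ℕ) :
    (List.ofFn fun i => g ^ k i).prod = g ^ ∑ i, k i := by
  induction q with
  | zero => simp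
  | succ q ih => rw [List.ofFn_succ, List.prod_cons, ih, Fin.sum_univ_succ, pow_add]

end PowerMaps

section Adams
variable {K : Type u} [Field K] [CharZero K] {V : ℕ → Type u} [∀ n, AddCommGroup (V n)]
  [∀ n, Module K (V n)] {R : GrRep K V} {n m D : ℕ}

/-- Write `x_a ^ (r + D + 1)` as `x_a ^ r y_1 ⋯ y_{D + 1}` with new letters that are set equal to
`x_a` afterwards. Killing a set `A` of new letters lowers the exponent by `|A|`, and the alternating
sum over all `A` is a cross effect of order `D + 1`, so it vanishes. Grouping the sets by size gives
the binomial coefficients. -/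
theorem sum_powMap_eq_zero {x : V n} (hx : x ∈ R.deg D n) (a : Fin n) (r : ℕ) :
    ∑ k ∈ Finset.range (D + 2), ((-1 : K) ^ k * (D + 1).choose k) •
      R.act (powMap a (r + (D + 1 - k))) x = 0 := by
  let q := D + 1
  -- The homomorphism `π` sets the `q` new letters equal to `x_a`, and `h` inserts their product
  -- after `x_a ^ r`.
  let π : FreeGroup (Fin (n + q)) →* FreeGroup (Fin n) :=
    FreeGroup.lift (Fin.append FreeGroup.of fun _ => FreeGroup.of a)
  let h : FreeGroup (Fin n) →* FreeGroup (Fin (n + q)) := FreeGroup.lift fun j =>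
    if j = a then FreeGroup.of (Fin.castAdd q a) ^ r *
      (List.ofFn fun i : Fin q => FreeGroup.of (Fin.natAdd n i)).prod
    else FreeGroup.of (Fin.castAdd q j)
  let T : Finset (Fin (n + q)) := Finset.univ.map (Fin.natAddEmb n)
  have hT : T.card = q := by simp [T]
  have hnot : ∀ (A : Finset (Fin (n + q))), A ⊆ T → ∀ j, Fin.castAdd q j ∉ A := by
    intro A hA j hj
    obtain ⟨i, -, hi⟩ := Finset.mem_map.1 (hA hj)
    have := congrArg Fin.val hi
    simp at this
    omega
  -- The exponent that is left after killing `A`: the number of surviving new letters.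
  have hcount : ∀ A ⊆ T, ∑ i : Fin q, (if Fin.natAdd n i ∈ A then 0 else 1) = q - A.card := by
    intro A hA
    have h1 : ∑ i : Fin q, (if Fin.natAdd n i ∈ A then 1 else 0) = A.card := by
      rw [Finset.sum_boole, Nat.cast_id, ← Finset.card_map (Fin.natAddEmb n)]
      congr 1
      ext j
      simp only [Finset.mem_map, Finset.mem_filter, Finset.mem_univ, true_and]
      constructor
      · rintro ⟨i, hi, rfl⟩
        exact hi
      · intro hj
        obtain ⟨i, -, rfl⟩ := Finset.mem_map.1 (hA hj)
        exact ⟨i, hj, rfl⟩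
    have h2 : ∑ i : Fin q, (if Fin.natAdd n i ∈ A then 1 else 0) +
        ∑ i : Fin q, (if Fin.natAdd n i ∈ A then 0 else 1) = q := by
      rw [← Finset.sum_add_distrib]
      have : ∀ i : Fin q, ((if Fin.natAdd n i ∈ A then 1 else 0) +
        (if Fin.natAdd n i ∈ A then 0 else 1) : ℕ) = 1 := fun i => by split_ifs <;> rfl
      simp [this]
    omega
  have hcomp : ∀ A ⊆ T, (π.comp (killSet id A)).comp h = powMap a (r + (q - A.card)) := by
    intro A hA
    refine FreeGroup.ext_hom _ _ fun j => ?_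
    rw [powMap_of, MonoidHom.comp_apply]
    show (π.comp (killSet id A)) (FreeGroup.lift _ (FreeGroup.of j)) = _
    have hcast : ∀ j, (π.comp (killSet id A)) (FreeGroup.of (Fin.castAdd q j)) =
        FreeGroup.of j := by
      intro j
      simp [killSet_of, hnot A hA j, π]
    rw [FreeGroup.lift_apply_of]
    split_ifs with hj
    · rw [map_mul, map_pow, hcast, pow_add, map_list_prod, List.map_ofFn, ← hcount A hA,
        ← list_prod_ofFn_pow]
      congr 3
      funext i
      simp only [Function.comp_apply, MonoidHom.comp_apply, killSet_of, id]
      by_cases hi : Fin.natAdd n i ∈ A <;> simp [hi, π]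
    · exact hcast j
  have h0 := cross_eq_zero (R.isStable_deg D π hx) (id : Fin (n + q) → _) (T := T) hT.ge
  have h1 := congrArg (R.act h) h0
  rw [map_zero, cross_apply, map_sum] at h1
  rw [← h1, Finset.sum_congr rfl (g := fun A : Finset (Fin (n + q)) => (fun k => (-1 : K) ^ k •
    R.act (powMap a (r + (q - k))) x) A.card) fun A hA => by
      rw [map_smul, ← R.act_comp, ← R.act_comp, ← MonoidHom.comp_assoc, hcomp A (Finset.mem_powerset.1 hA)],
    Finset.sum_powerset_apply_card (fun k => (-1 : K) ^ k • R.act (powMap a (r + (q - k))) x), hT]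
  refine Finset.sum_congr rfl fun k _ => ?_
  rw [← Nat.cast_smul_eq_nsmul K, smul_smul, mul_comm]

theorem exists_powMap_expansion {x : V n} (hx : x ∈ R.deg D n) (a : Fin n) :
    ∃ v : ℕ → V n, ∀ r, R.act (powMap a r) x = ∑ j ∈ Finset.range (D + 2), (r : K) ^ j • v j :=
  exists_pow_expansion (sum_powMap_eq_zero hx a)

variable (R)

/-- The coefficient of `r` in the polynomial `x_a ↦ x_a ^ r`. -/
noncomputable def proj (D : ℕ) (a : Fin n) : V n →ₗ[K] V n :=
  ∑ r ∈ Finset.range (D + 2), powCoeff K (D + 2) 1 r • R.act (powMap a r)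

theorem proj_apply (D : ℕ) (a : Fin n) (x : V n) : R.proj D a x =
    ∑ r ∈ Finset.range (D + 2), powCoeff K (D + 2) 1 r • R.act (powMap a r) x := by
  simp [proj]

variable {R}

theorem IsStable.proj {S : ∀ n, Submodule K (V n)} (hS : R.IsStable S) (D : ℕ) (a : Fin n) {x : V n}
    (hx : x ∈ S n) : R.proj D a x ∈ S n := by
  rw [proj_apply]
  exact Submodule.sum_mem _ fun A _ => Submodule.smul_mem _ _ (hS _ hx)

/-- Both sides are the coefficient of `r` of the same polynomial, extracted with different numbers
of nodes. -/
theorem proj_eq_of_le {D' : ℕ} (h : D ≤ D') {x : V n} (hx : x ∈ R.deg D n) (a : Fin n) :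
    R.proj D' a x = R.proj D a x := by
  obtain ⟨v, hv⟩ := exists_powMap_expansion hx a
  rw [proj_apply, proj_apply, sum_powCoeff_smul (by omega) (by omega) hv,
    sum_powCoeff_smul (by omega) le_rfl hv]

/-- Power maps compose by multiplication of exponents, and replacing `r` by `r s` multiplies the
coefficient of `r` by `s`. -/
theorem act_powMap_proj {x : V n} (hx : x ∈ R.deg D n) (a : Fin n) (s : ℕ) :
    R.act (powMap a s) (R.proj D a x) = (s : K) • R.proj D a x := by
  obtain ⟨v, hv⟩ := exists_powMap_expansion hx a
  rw [proj_apply, map_sum]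
  simp only [map_smul, ← R.act_comp, powMap_comp]
  rw [sum_powCoeff_smul (by omega) le_rfl hv, sum_powCoeff_smul (n := D + 2) (j := 1) (by omega)
    le_rfl (v := fun j => (s : K) ^ j • v j)]
  · rw [pow_one]
  · intro r
    rw [hv]
    refine Finset.sum_congr rfl fun j _ => ?_
    rw [smul_smul, Nat.cast_mul, mul_pow]

/-- Duplicate `a` into `a` and `z`, and raise the copies to the powers `r` and `s`. The result is
polynomial in both exponents. For `r = s` it is the power map applied before the duplication; for `s
= 0` or `r = 0` one copy disappears. Since `y` is multiplied by `r` under the power map, all three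
restrictions are linear in `r`, and the linear part along the diagonal is the sum of the two partial
ones (`linear_part_add`). -/
theorem proj_primMod {x : V n} (hx : x ∈ R.deg D n) (a : Fin n) :
    R.PrimMod (fun _ => ⊥) a (R.proj D a x) := by
  set y := R.proj D a x with hy
  have hyD : y ∈ R.deg D n := (R.isStable_deg D).proj D a hx
  refine PrimMod.of_addLetter R.isStable_bot ?_
  rw [Submodule.mem_bot, sub_sub, sub_eq_zero]
  set z := R.act ((subBoth a).comp (addLetter n).toMonoidHom) y with hz
  have hzD : z ∈ R.deg D (n + 1) := R.isStable_deg D _ hyD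
  let A := (finSuccEquiv n).symm (some a)
  let Z := (finSuccEquiv n).symm none
  obtain ⟨v, hv⟩ := exists_powMap_expansion hzD Z
  -- The coefficients are combinations of values, hence again of degree at most `D`, and can be
  -- expanded in the other exponent.
  have hvD : ∀ j < D + 2, v j ∈ R.deg D (n + 1) := by
    intro j hj
    rw [← sum_powCoeff_smul (K := K) hj le_rfl hv]
    exact Submodule.sum_mem _ fun r _ => Submodule.smul_mem _ _ (R.isStable_deg D _ hzD)
  -- Nothing is known about `v j` beyond the range; there the family zero is chosen and never used.
  have : ∀ j, ∃ w : ℕ → V (n + 1), j < D + 2 → ∀ r, R.act (powMap A r) (v j) =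
      ∑ i ∈ Finset.range (D + 2), (r : K) ^ i • w i := by
    intro j
    by_cases hj : j < D + 2
    · obtain ⟨w, hw⟩ := exists_powMap_expansion (hvD j hj) A
      exact ⟨w, fun _ => hw⟩
    · exact ⟨0, fun h => absurd h hj⟩
  choose w hw using this
  -- The double expansion, as the action of the homomorphism that duplicates `a` and raises the
  -- copies to the powers `r` and `s`.
  have hg : ∀ r s : ℕ, ∑ j ∈ Finset.range (D + 2), (s : K) ^ j •
      ∑ i ∈ Finset.range (D + 2), (r : K) ^ i • w j i =
      R.act (((subBoth a).comp ((powOpt none s).comp (powOpt (some a) r))).comp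
        (addLetter n).toMonoidHom) y := by
    intro r s
    have e : ((subBoth a).comp ((powOpt none s).comp (powOpt (some a) r))).comp
        (addLetter n).toMonoidHom =
        (((subBoth a).comp (addLetter n).toMonoidHom).comp (powMap Z s)).comp (powMap A r) := by
      have eA : (addLetter n).toMonoidHom.comp (powMap A r) = _ := addLetter_comp_powMap _ r
      have eZ : (addLetter n).toMonoidHom.comp (powMap Z s) = _ := addLetter_comp_powMap _ s
      simp only [MonoidHom.comp_assoc]
      rw [← eA, ← MonoidHom.comp_assoc _ _ (powOpt none s), ← eZ]
      rfl
    rw [e, R.act_comp, R.act_comp, hv, map_sum]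
    refine Finset.sum_congr rfl fun j hj => ?_
    rw [map_smul, hw j (Finset.mem_range.1 hj)]
  have hact := act_powMap_proj (R := R) hx a
  refine linear_part_add (K := K) (D := D) (z := fun i j => w j i) (fun r => ?_) (fun r => ?_)
    fun r => ?_
  · rw [hg, hz, ← map_smul, ← hact r, ← hy, ← R.act_comp]
    refine congrArg (fun f : FreeGroup (Option (Fin n)) →* FreeGroup (Fin n) =>
      R.act (f.comp (addLetter n).toMonoidHom) y) (?_ : (subBoth a).comp
        ((powOpt none r).comp (powOpt (some a) r)) = (powMap a r).comp (subBoth a))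
    ext o
    rcases o with _ | c
    · simp [subBoth, powOpt, powMap_of]
    · by_cases hc : c = a <;> simp [subBoth, powOpt, powMap_of, hc]
  · rw [hg, ← map_smul, ← hact r, ← hy, ← R.act_comp]
    refine congrArg (fun f : FreeGroup (Option (Fin n)) →* FreeGroup (Fin n) =>
      R.act (f.comp (addLetter n).toMonoidHom) y) (?_ : (subBoth a).comp
        ((powOpt none 0).comp (powOpt (some a) r)) = (powMap a r).comp subKill)
    ext o
    rcases o with _ | c
    · simp [subBoth, subKill, powOpt]
    · by_cases hc : c = a <;> simp [subBoth, subKill, powOpt, powMap_of, hc]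
  · rw [hg, ← map_smul, ← hact r, ← hy, ← R.act_comp]
    refine congrArg (fun f : FreeGroup (Option (Fin n)) →* FreeGroup (Fin n) =>
      R.act (f.comp (addLetter n).toMonoidHom) y) (?_ : (subBoth a).comp
        ((powOpt none r).comp (powOpt (some a) 0)) = (powMap a r).comp (subMove a))
    ext o
    rcases o with _ | c
    · simp [subBoth, subMove, powOpt, powMap_of]
    · by_cases hc : c = a <;> simp [subBoth, subMove, powOpt, powMap_of, hc]

/-- Induction on `r`: primitivity is tested on `x_a ↦ z x_a ^ r`, where the three substitutions give
the exponents `r + 1`, `r` and `1`. -/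
theorem PrimMod.act_powMap {S : ∀ n, Submodule K (V n)} {a : Fin n} {x : V n}
    (hx : R.PrimMod S a x) (r : ℕ) :
    R.act (powMap a r) x - (r : K) • x ∈ S n := by
  induction r with
  | zero =>
    -- If `x_a ↦ 1`, the three terms of the defect are equal, so the defect is minus one of them,
    -- which therefore lies in `S`.
    have h := hx n (FreeGroup.lift fun j => if j = a then 1 else FreeGroup.of (some j))
    have e : ∀ f : FreeGroup (Option (Fin n)) →* FreeGroup (Fin n),
        (∀ j, j ≠ a → f (FreeGroup.of (some j)) = FreeGroup.of j) →
        f.comp (FreeGroup.lift fun j => if j = a then 1 else FreeGroup.of (some j)) =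
          powMap a 0 := by
      intro f hf
      ext j
      by_cases hj : j = a
      · simp [hj, powMap_of]
      · simp [hj, powMap_of, hf]
    rw [e (subBoth a) fun j _ => by simp [subBoth], e subKill fun j _ => by simp [subKill],
      e (subMove a) fun j hj => by simp [subMove, hj], sub_self, zero_sub, neg_mem_iff] at h
    simpa using h
  | succ r ih =>
    have h := hx n (FreeGroup.lift fun j => if j = a then
      FreeGroup.of none * FreeGroup.of (some a) ^ r else FreeGroup.of (some j))
    have e : ∀ (f : FreeGroup (Option (Fin n)) →* FreeGroup (Fin n)) (s : ℕ),
        (∀ j, j ≠ a → f (FreeGroup.of (some j)) = FreeGroup.of j) →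
        f (FreeGroup.of none * FreeGroup.of (some a) ^ r) = FreeGroup.of a ^ s →
        f.comp (FreeGroup.lift fun j => if j = a then
          FreeGroup.of none * FreeGroup.of (some a) ^ r else FreeGroup.of (some j)) =
          powMap a s := by
      intro f s hf hfa
      ext j
      rw [MonoidHom.comp_apply, FreeGroup.lift_apply_of, powMap_of]
      split_ifs with hj
      · exact hfa
      · exact hf j hj
    rw [e (subBoth a) (r + 1) (fun j _ => by simp [subBoth]) (by simp [subBoth, pow_succ']),
      e subKill r (fun j _ => by simp [subKill]) (by simp [subKill]),
      e (subMove a) 1 (fun j hj => by simp [subMove, hj]) (by simp [subMove]), powMap_one,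
      R.act_id] at h
    have := Submodule.add_mem _ h ih
    convert this using 1
    push_cast
    rw [add_smul, one_smul]
    abel

/-- Modulo `S` the power maps multiply `x` by `r`, so the coefficient of `r` is `x` itself. This
holds for any `D`. -/
theorem PrimMod.proj_sub_mem {S : ∀ n, Submodule K (V n)} {a : Fin n} {x : V n}
    (hx : R.PrimMod S a x) (D : ℕ) : R.proj D a x - x ∈ S n := by
  have h : x = ∑ r ∈ Finset.range (D + 2), powCoeff K (D + 2) 1 r • ((r : K) • x) := by
    simp only [smul_smul, ← Finset.sum_smul]
    have := sum_powCoeff K (m := D + 2) (i := 1) 1 (by omega)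
    simp only [pow_one, if_true] at this
    rw [this, one_smul]
  have e : R.proj D a x - x = ∑ r ∈ Finset.range (D + 2), (powCoeff K (D + 2) 1 r •
      R.act (powMap a r) x - powCoeff K (D + 2) 1 r • ((r : K) • x)) := by
    rw [Finset.sum_sub_distrib, ← h, proj_apply]
  rw [e]
  refine Submodule.sum_mem _ fun r _ => ?_
  rw [← smul_sub]
  exact Submodule.smul_mem _ _ (hx.act_powMap r)

/-- Raising `a` to a power commutes with the three substitutions for a different letter `b`, once it
is also done in the presence of the extra letter. -/
theorem PrimMod.proj_of_ne {S : ∀ n, Submodule K (V n)} {a b : Fin n} {x : V n}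
    (hx : R.PrimMod S b x) (hab : a ≠ b) (D : ℕ) : R.PrimMod S b (R.proj D a x) := by
  intro m h
  have e : ∀ (r : ℕ) (f : FreeGroup (Option (Fin n)) →* FreeGroup (Fin n)),
      (powMap a r).comp f = f.comp (powOpt (some a) r) →
      R.act (f.comp h) (R.act (powMap a r) x) = R.act (f.comp ((powOpt (some a) r).comp h)) x := by
    intro r f hf
    rw [← R.act_comp, ← MonoidHom.comp_assoc, ← MonoidHom.comp_assoc, hf]
  have hba : ¬ b = a := fun h => hab h.symm
  have e1 : ∀ r, (powMap a r).comp (subBoth b) = (subBoth b).comp (powOpt (some a) r) := by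
    intro r; ext o
    rcases o with _ | c
    · simp [subBoth, powOpt, powMap_of, hba]
    · by_cases hc : c = a <;> simp [subBoth, powOpt, powMap_of, hc]
  have e2 : ∀ r, (powMap a r).comp subKill = subKill.comp (powOpt (some a) r) := by
    intro r; ext o
    rcases o with _ | c
    · simp [subKill, powOpt]
    · by_cases hc : c = a <;> simp [subKill, powOpt, powMap_of, hc]
  have e3 : ∀ r, (powMap a r).comp (subMove b) = (subMove b).comp (powOpt (some a) r) := by
    intro r; ext o
    rcases o with _ | c
    · simp [subMove, powOpt, powMap_of, hba]
    · by_cases hc : c = a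
      · simp [subMove, powOpt, powMap_of, hc, hab]
      · by_cases hcb : c = b <;> simp [subMove, powOpt, powMap_of, hc, hcb, hba]
  simp only [proj_apply, map_sum, map_smul]
  rw [← Finset.sum_sub_distrib, ← Finset.sum_sub_distrib]
  refine Submodule.sum_mem _ fun r _ => ?_
  rw [← smul_sub, ← smul_sub, e r _ (e1 r), e r _ (e2 r), e r _ (e3 r)]
  exact Submodule.smul_mem _ _ (hx m _)

variable (R)

/-- The composite of the projections for the variables in a list. -/
noncomputable def projList (D : ℕ) : List (Fin n) → V n →ₗ[K] V n
  | [] => LinearMap.id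
  | a :: l => (R.proj D a).comp (projList D l)

/-- The projection to the elements that are primitive in all variables. -/
noncomputable def projAll (D n : ℕ) : V n →ₗ[K] V n := R.projList D (List.finRange n)

variable {R}

theorem IsStable.projList {S : ∀ n, Submodule K (V n)} (hS : R.IsStable S) (D : ℕ)
    (l : List (Fin n)) {x : V n} (hx : x ∈ S n) : R.projList D l x ∈ S n := by
  induction l with
  | nil => exact hx
  | cons a l ih => exact hS.proj D a ih

theorem projList_eq_of_le {D' : ℕ} (h : D ≤ D') {x : V n} (hx : x ∈ R.deg D n) (l : List (Fin n)) :
    R.projList D' l x = R.projList D l x := by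
  induction l with
  | nil => rfl
  | cons a l ih =>
    refine (congrArg (R.proj D' a) ih).trans ?_
    exact proj_eq_of_le h ((R.isStable_deg D).projList D l hx) a

/-- The projection for `a` creates primitivity in `a`, and those for other letters preserve it. -/
theorem projList_primMod {x : V n} (hx : x ∈ R.deg D n) (l : List (Fin n)) {a : Fin n}
    (ha : a ∈ l) : R.PrimMod (fun _ => ⊥) a (R.projList D l x) := by
  induction l with
  | nil => simp at ha
  | cons b l ih =>
    have hl := (R.isStable_deg D).projList D l hx
    by_cases hab : b = a
    · subst hab
      exact proj_primMod hl b
    · refine (ih ?_).proj_of_ne hab D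
      rcases List.mem_cons.1 ha with h | h
      · exact absurd h.symm hab
      · exact h

theorem projList_sub_mem {S : ∀ n, Submodule K (V n)} (hS : R.IsStable S) {x : V n}
    (hx : ∀ a, R.PrimMod S a x) (D : ℕ) (l : List (Fin n)) : R.projList D l x - x ∈ S n := by
  induction l with
  | nil => simp [projList]
  | cons a l ih =>
    have h1 := hS.proj D a ih
    rw [map_sub] at h1
    have := Submodule.add_mem _ h1 ((hx a).proj_sub_mem D)
    rwa [sub_add_sub_cancel] at this

theorem projAll_eq_of_le {D' : ℕ} (h : D ≤ D') {x : V n} (hx : x ∈ R.deg D n) :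
    R.projAll D' n x = R.projAll D n x := projList_eq_of_le h hx _

theorem projAll_primMod {x : V n} (hx : x ∈ R.deg D n) (a : Fin n) :
    R.PrimMod (fun _ => ⊥) a (R.projAll D n x) := projList_primMod hx _ (List.mem_finRange a)

theorem projAll_sub_mem {S : ∀ n, Submodule K (V n)} (hS : R.IsStable S) {x : V n}
    (hx : ∀ a, R.PrimMod S a x) (D : ℕ) : R.projAll D n x - x ∈ S n := projList_sub_mem hS hx D _

theorem projAll_eq_self {x : V n} (hx : ∀ a, R.PrimMod (fun _ => ⊥) a x) (D : ℕ) :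
    R.projAll D n x = x :=
  sub_eq_zero.1 ((Submodule.mem_bot K).1 (projAll_sub_mem R.isStable_bot hx D))

/-- The projections are combinations of endomorphisms of `F_n` with coefficients that do not depend
on the functor, so they are natural. -/
theorem map_projAll {V' : ℕ → Type u} [∀ n, AddCommGroup (V' n)] [∀ n, Module K (V' n)]
    {R' : GrRep K V'} (f : ∀ n, V n →ₗ[K] V' n)
    (hf : ∀ {n n' : ℕ} (φ : FreeGroup (Fin n') →* FreeGroup (Fin n)) (x : V n),
      f n' (R.act φ x) = R'.act φ (f n x)) (D : ℕ) (x : V n) :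
    f n (R.projAll D n x) = R'.projAll D n (f n x) := by
  unfold projAll
  induction List.finRange n with
  | nil => rfl
  | cons a l ih =>
    show f n (R.proj D a (R.projList D l x)) = R'.proj D a (R'.projList D l (f n x))
    rw [← ih, proj_apply, proj_apply, map_sum]
    simp only [map_smul, hf]

end Adams

end GrRep

/-! ### Linear functors on `gr^op` and their subfunctors -/

section LinModules
variable {K : Type u} [CommRing K]

/-- The functor on `gr^op` that underlies a linear functor on its linearization. -/
noncomputable def grRep (N : LinMod K (KGrOp K)) :
    GrRep K fun n => N.obj.obj (Free.of K (GrOp.mk n)) where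
  act {n n'} φ := (N.obj.map ((Free.embedding K GrOp).map (X := ⟨n⟩) (Y := ⟨n'⟩) φ)).hom
  act_id {n} x := by
    have h : (Free.embedding K GrOp).map (X := ⟨n⟩) (Y := ⟨n⟩) (MonoidHom.id (FreeGroup (Fin n))) =
      𝟙 _ := (Free.embedding K GrOp).map_id ⟨n⟩
    rw [h]
    exact congrArg (fun f => f x) (N.obj.map_id (Free.of K (GrOp.mk n)))
  act_comp {l m n} φ ψ x := by
    have h : (Free.embedding K GrOp).map (X := ⟨l⟩) (Y := ⟨n⟩) (φ.comp ψ) =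
      (Free.embedding K GrOp).map (X := ⟨l⟩) (Y := ⟨m⟩) φ ≫
        (Free.embedding K GrOp).map (X := ⟨m⟩) (Y := ⟨n⟩) ψ := (Free.embedding K GrOp).map_comp _ _
    rw [h, N.obj.map_comp]
    rfl

/-- A group homomorphism as a morphism of the linearization of `gr^op`. -/
noncomputable def grMk {c c' : KGrOp K}
    (φ : FreeGroup (Fin (GrOp.rank c')) →* FreeGroup (Fin (GrOp.rank c))) : c ⟶ c' :=
  (Free.embedding K GrOp).map (X := c) (Y := c') φ

theorem kgrOp_hom_ind {c c' : KGrOp K} {P : (c ⟶ c') → Prop} (zero : P 0)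
    (add : ∀ f g, P f → P g → P (f + g))
    (smul : ∀ (r : K) (φ : FreeGroup (Fin (GrOp.rank c')) →* FreeGroup (Fin (GrOp.rank c))),
      P (r • grMk φ)) (f : c ⟶ c') : P f := by
  refine Finsupp.induction_linear (motive := P) f zero add fun φ r => ?_
  have := smul r φ
  have e : (r • grMk φ : c ⟶ c') = Finsupp.single φ r := by
    refine (Finsupp.smul_single r φ (1 : K)).trans ?_
    rw [smul_eq_mul, mul_one]
  rwa [e] at this

variable {N N' : LinMod K (KGrOp K)}

theorem map_mem_of_isStable {S : ∀ n, Submodule K (N.obj.obj (Free.of K (GrOp.mk n)))}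
    (hS : (grRep N).IsStable S) {c c' : KGrOp K} (f : c ⟶ c') {x : N.obj.obj c}
    (hx : x ∈ S (GrOp.rank c)) : N.obj.map f x ∈ S (GrOp.rank c') := by
  induction f using kgrOp_hom_ind with
  | zero =>
    have := N.property.1
    rw [N.obj.map_zero]
    exact Submodule.zero_mem _
  | add f g hf hg =>
    rw [N.map_add]
    exact Submodule.add_mem _ hf hg
  | smul r φ =>
    rw [N.map_smul]
    exact Submodule.smul_mem _ r (hS φ hx)

/-- A subfunctor. -/
noncomputable def subMod {S : ∀ n, Submodule K (N.obj.obj (Free.of K (GrOp.mk n)))}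
    (hS : (grRep N).IsStable S) : LinMod K (KGrOp K) where
  obj :=
    { obj c := ModuleCat.of K (S (GrOp.rank c))
      map {c c'} f := ModuleCat.ofHom (LinearMap.restrict (N.obj.map f).hom
        fun _ hx => map_mem_of_isStable hS f hx)
      map_id c := by
        ext x
        exact congrArg (fun f => f x.1) (N.obj.map_id c)
      map_comp f g := by
        ext x
        exact congrArg (fun f => f x.1) (N.obj.map_comp f g) }
  property :=
    ⟨⟨fun {c c'} f g => by
      ext x
      exact congrArg (fun f => f x.1) (N.map_add f g)⟩,
     ⟨fun {c c'} f r => by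
      ext x
      exact congrArg (fun f => f x.1) (N.map_smul r f)⟩⟩

/-- The inclusion of a subfunctor. -/
noncomputable def subModHom {S : ∀ n, Submodule K (N.obj.obj (Free.of K (GrOp.mk n)))}
    (hS : (grRep N).IsStable S) : subMod hS ⟶ N :=
  ObjectProperty.homMk
    { app c := ModuleCat.ofHom (S (GrOp.rank c)).subtype
      naturality _ _ _ := rfl }

instance {S : ∀ n, Submodule K (N.obj.obj (Free.of K (GrOp.mk n)))}
    (hS : (grRep N).IsStable S) : Mono (subModHom hS) := by
  have h : ∀ c, Mono ((subModHom hS).hom.app c) := fun c =>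
    (ModuleCat.mono_iff_injective _).2 (S (GrOp.rank c)).injective_subtype
  have : Mono (subModHom hS).hom := NatTrans.mono_of_mono_app _
  exact (IsLinear K (KGrOp K)).ι.mono_of_mono_map this

/-- The components of a morphism of functors. -/
noncomputable def homAct (f : N ⟶ N') (n : ℕ) :
    N.obj.obj (Free.of K (GrOp.mk n)) →ₗ[K] N'.obj.obj (Free.of K (GrOp.mk n)) :=
  (f.hom.app _).hom

theorem homAct_act (f : N ⟶ N') {n n' : ℕ} (φ : FreeGroup (Fin n') →* FreeGroup (Fin n))
    (x : N.obj.obj (Free.of K (GrOp.mk n))) :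
    homAct f n' ((grRep N).act φ x) = (grRep N').act φ (homAct f n x) :=
  NatTrans.naturality_apply f.hom _ x

theorem homAct_deg (f : N ⟶ N') {D n : ℕ} {x : N.obj.obj (Free.of K (GrOp.mk n))}
    (hx : x ∈ (grRep N).deg D n) : homAct f n x ∈ (grRep N').deg D n := by
  intro m φ p
  have h := congrArg (homAct f m) (hx m φ p)
  rw [map_zero, GrRep.cross_apply, map_sum] at h
  rw [GrRep.cross_apply, ← h]
  exact Finset.sum_congr rfl fun A _ => by rw [map_smul, homAct_act, homAct_act]

theorem homAct_primMod (f : N ⟶ N') {n : ℕ} {x : N.obj.obj (Free.of K (GrOp.mk n))} {a : Fin n}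
    (hx : (grRep N).PrimMod (fun _ => ⊥) a x) :
    (grRep N').PrimMod (fun _ => ⊥) a (homAct f n x) := by
  intro m h
  have := congrArg (homAct f m) ((Submodule.mem_bot K).1 (hx m h))
  rw [map_sub, map_sub, homAct_act, homAct_act, homAct_act, map_zero] at this
  exact (Submodule.mem_bot K).2 this

/-- Linear maps which commute with the action of `gr^op` form a morphism of functors. -/
noncomputable def homOfAct
    (f : ∀ n, N.obj.obj (Free.of K (GrOp.mk n)) →ₗ[K] N'.obj.obj (Free.of K (GrOp.mk n)))
    (hf : ∀ {n n' : ℕ} (φ : FreeGroup (Fin n') →* FreeGroup (Fin n)) x,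
      f n' ((grRep N).act φ x) = (grRep N').act φ (f n x)) : N ⟶ N' :=
  ObjectProperty.homMk
    { app c := ModuleCat.ofHom (f (GrOp.rank c))
      naturality c c' g := by
        ext x
        show f (GrOp.rank c') (N.obj.map g x) = N'.obj.map g (f (GrOp.rank c) x)
        induction g using kgrOp_hom_ind with
        | zero =>
          have := N.property.1
          have := N'.property.1
          rw [N.obj.map_zero, N'.obj.map_zero]
          exact map_zero _
        | add g h hg hh =>
          rw [N.map_add, N'.map_add]
          exact (map_add _ _ _).trans (congrArg₂ _ hg hh)
        | smul r φ =>
          rw [N.map_smul, N'.map_smul]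
          exact (map_smul _ _ _).trans (congrArg _ (hf φ x)) }

/-- The elements of `deg D` form a polynomial subfunctor, because an element killed by every block
equals its cross effect. Conversely, a cross effect in a polynomial functor of degree at most `D` is
killed by every block, so it is zero; morphisms carry this to `N`. -/
theorem isAnalytic_iff :
    IsAnalytic K N ↔ ∀ n (x : N.obj.obj (Free.of K (GrOp.mk n))), ∃ D, x ∈ (grRep N).deg D n := by
  constructor
  · intro h n x
    obtain ⟨P, j, D, -, hP, y, rfl⟩ := h (Free.of K (GrOp.mk n)) x
    refine ⟨D, homAct_deg j (n := n) fun m φ p => ?_⟩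
    refine hP m p _ fun i => ?_
    rw [killBlock_eq]
    exact (grRep P).act_killSet_cross p (Finset.mem_univ i) _
  · intro h c x
    obtain ⟨D, hD⟩ := h (GrOp.rank c) x
    have hS := (grRep N).isStable_deg D
    refine ⟨subMod hS, subModHom hS, D, inferInstance, fun n p y hy => ?_, ⟨x, hD⟩, rfl⟩
    refine Subtype.ext ?_
    have h0 := GrRep.cross_eq_zero (R := grRep N) y.2 p (T := Finset.univ) (by simp)
    refine (GrRep.cross_eq_self (p := p) (T := Finset.univ) (grRep N) fun i _ => ?_).symm.trans h0
    have := congrArg Subtype.val (hy i)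
    rw [killBlock_eq] at this
    exact this

end LinModules

/-! ### Rows of Powell's bimodule represent primitive elements -/

section PowellRows
variable (K : Type u) [CommRing K]

/-- Tuples of words as elements of a row of Powell's bimodule. -/
noncomputable def rowMk (d : CatLie K) (n : ℕ) : (WordTuple (Fin d.arity) n →₀ K) ≃ₗ[K]
    ((powell K).row d).obj.obj (Free.of K (GrOp.mk n)) :=
  LinearEquiv.refl K _

theorem row_act (d : CatLie K) {n n' : ℕ} (φ : FreeGroup (Fin n') →* FreeGroup (Fin n))
    (x : WordTuple (Fin d.arity) n →₀ K) :
    (grRep ((powell K).row d)).act φ (rowMk K d n x) = rowMk K d n' (cableLin K φ x) :=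
  LinearMap.congr_fun (grAct_single K (V := fun n => WordTuple (Fin d.arity) n →₀ K)
    (cableLin K) φ) x

/-- The generator of a row. -/
noncomputable def rowGen (d : CatLie K) :
    ((powell K).row d).obj.obj (Free.of K (GrOp.mk d.arity)) :=
  rowMk K d d.arity (Finsupp.single (WordTuple.id d.arity) 1)

/-- Cabling the one-letter words along `φ` spells out `φ` itself, of which the multilinear part is
taken. -/
theorem row_act_gen (d : CatLie K) {n : ℕ} (φ : FreeGroup (Fin n) →* FreeGroup (Fin d.arity)) :
    (grRep ((powell K).row d)).act φ (rowGen K d) =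
      rowMk K d n (multilinearPart K fun k => φ (FreeGroup.of k)) := by
  rw [rowGen, row_act, cableLin_single, one_smul, cable, lift_spell_id]
  rfl

/-- Hence every tuple of words is reached from the generator, and the row is generated by it. -/
theorem row_act_spell (d : CatLie K) {n : ℕ} (w : WordTuple (Fin d.arity) n) :
    (grRep ((powell K).row d)).act (FreeGroup.lift (spell w.1)) (rowGen K d) =
      rowMk K d n (Finsupp.single w 1) := by
  rw [row_act_gen, ← multilinearPart_spell]
  congr 2
  funext k
  exact FreeGroup.lift_apply_of

theorem rowGen_primMod (d : CatLie K) (a : Fin d.arity) :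
    (grRep ((powell K).row d)).PrimMod (fun _ => ⊥) a (rowGen K d) := by
  intro m h
  rw [Submodule.mem_bot, row_act_gen, row_act_gen, row_act_gen, ← map_sub, ← map_sub]
  refine (congrArg _ ?_).trans (map_zero _)
  rw [sub_sub, sub_eq_zero]
  exact multilinearPart_primitive K a fun k => h (FreeGroup.of k)

variable {K}

theorem row_ind {d : CatLie K} {n : ℕ}
    {P : ((powell K).row d).obj.obj (Free.of K (GrOp.mk n)) → Prop} (zero : P 0)
    (add : ∀ x y, P x → P y → P (x + y))
    (smul : ∀ (r : K) w, P (r • rowMk K d n (Finsupp.single w 1))) (x) : P x := by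
  obtain ⟨x, rfl⟩ := (rowMk K d n).surjective x
  induction x using Finsupp.induction_linear with
  | zero => rw [map_zero]; exact zero
  | add x y hx hy => rw [map_add]; exact add _ _ hx hy
  | single w r =>
    rw [← mul_one r, ← smul_eq_mul, ← Finsupp.smul_single, map_smul]
    exact smul r w

variable {N : LinMod K (KGrOp K)}

theorem homAct_row_eq {d : CatLie K} (f : (powell K).row d ⟶ N) {n : ℕ}
    (w : WordTuple (Fin d.arity) n) :
    homAct f n (rowMk K d n (Finsupp.single w 1)) =
      (grRep N).act (FreeGroup.lift (spell w.1)) (homAct f d.arity (rowGen K d)) := by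
  rw [← homAct_act, row_act_spell]

theorem row_hom_ext {d : CatLie K} {f g : (powell K).row d ⟶ N}
    (h : homAct f d.arity (rowGen K d) = homAct g d.arity (rowGen K d)) : f = g := by
  refine ObjectProperty.hom_ext _ (NatTrans.ext (funext fun c => ?_))
  ext x
  show homAct f (GrOp.rank c) x = homAct g (GrOp.rank c) x
  induction x using row_ind with
  | zero => rw [map_zero, map_zero]
  | add x y hx hy => rw [map_add, map_add, hx, hy]
  | smul r w => rw [map_smul, map_smul, homAct_row_eq, homAct_row_eq, h]

/-- A primitive element defines a morphism from a row. -/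
noncomputable def rowHom {d : CatLie K} {x : N.obj.obj (Free.of K (GrOp.mk d.arity))}
    (hx : ∀ a, (grRep N).PrimMod (fun _ => ⊥) a x) : (powell K).row d ⟶ N :=
  homOfAct (fun n => (Finsupp.linearCombination K fun w : WordTuple (Fin d.arity) n =>
      (grRep N).act (FreeGroup.lift (spell w.1)) x).comp (rowMk K d n).symm.toLinearMap)
    fun {n n'} φ y => by
      -- Primitivity of `x` says that the action on `x` is a primitive function of the images of the
      -- letters. Its expansion in multilinear words is exactly the compatibility with cabling that
      -- is needed.
      have hL : IsPrimitive fun g : Fin n' → FreeGroup (Fin d.arity) =>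
          (grRep N).act (FreeGroup.lift g) x := by
        intro a h
        have h0 := (Submodule.mem_bot K).1 (hx a n' (FreeGroup.lift h))
        have e : ∀ f : FreeGroup (Option (Fin d.arity)) →* FreeGroup (Fin d.arity),
            f.comp (FreeGroup.lift h) = FreeGroup.lift fun k => f (h k) := fun f => by ext; simp
        rw [e, e, e, sub_sub, sub_eq_zero] at h0
        exact h0
      induction y using row_ind with
      | zero => simp only [map_zero]
      | add y z hy hz => simp only [map_add, hy, hz]
      | smul r w =>
        simp only [map_smul]
        refine congrArg _ ?_
        rw [row_act, LinearMap.comp_apply, LinearMap.comp_apply, LinearEquiv.coe_coe,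
          LinearEquiv.coe_coe, LinearEquiv.symm_apply_apply, LinearEquiv.symm_apply_apply,
          Finsupp.linearCombination_single, one_smul, cableLin_single, one_smul, cable]
        refine (IsPrimitive.linear_expansion K hL _).symm.trans ?_
        rw [← GrRep.act_comp]
        refine congrArg (fun ψ => (grRep N).act ψ x) ?_
        ext k
        simp

theorem rowHom_gen {d : CatLie K} {x : N.obj.obj (Free.of K (GrOp.mk d.arity))}
    (hx : ∀ a, (grRep N).PrimMod (fun _ => ⊥) a x) :
    homAct (rowHom hx) d.arity (rowGen K d) = x := by
  have h := Finsupp.linearCombination_single K (v := fun w : WordTuple (Fin d.arity) d.arity =>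
    (grRep N).act (FreeGroup.lift (spell w.1)) x) 1 (WordTuple.id d.arity)
  rw [one_smul, lift_spell_id, GrRep.act_id] at h
  exact h

theorem GrRep.act_killSet_cross_comm {V : ℕ → Type u} [∀ n, AddCommGroup (V n)]
    [∀ n, Module K (V n)] (R : GrRep K V) {ι : Type} [DecidableEq ι] {n : ℕ} (p : Fin n → ι)
    (T : Finset ι) (i : ι) (x : V n) :
    R.act (killSet p {i}) (R.cross p T x) = R.cross p T (R.act (killSet p {i}) x) := by
  rw [cross_apply, cross_apply, map_sum]
  refine Finset.sum_congr rfl fun A _ => ?_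
  rw [map_smul, ← R.act_comp, ← R.act_comp, killSet_comp, killSet_comp, Finset.union_comm]

/-- The `d.arity` letters of a tuple of words occupy at most `d.arity` of the `d.arity + 1` blocks.
Killing a block without letters fixes the tuple, so the corresponding factor of the cross effect
gives zero. -/
theorem row_mem_deg {d : CatLie K} {n : ℕ} (x : ((powell K).row d).obj.obj (Free.of K (GrOp.mk n))) :
    x ∈ (grRep ((powell K).row d)).deg d.arity n := by
  intro m φ p
  generalize (grRep ((powell K).row d)).act φ x = y
  induction y using row_ind with
  | zero => exact map_zero _
  | add y z hy hz => rw [map_add, hy, hz, add_zero]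
  | smul r u =>
    rw [map_smul]
    refine (congrArg _ ?_).trans (smul_zero r)
    choose g hg using u.2.exists_mem
    obtain ⟨i, hi⟩ : ∃ i, ∀ a, p (g a) ≠ i := by
      by_contra! h
      have := Fintype.card_le_of_surjective (fun a => p (g a)) h
      simp at this
    have hk : (grRep ((powell K).row d)).act (killSet p {i}) (rowMk K d m (Finsupp.single u 1)) =
        rowMk K d m (Finsupp.single u 1) := by
      rw [row_act, cableLin_single, one_smul, cable, ← multilinearPart_spell]
      congr 2
      funext k
      rw [killSet_of]
      by_cases h : p k = i
      · have : u.1 k = [] := by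
          rw [List.eq_nil_iff_forall_not_mem]
          intro a ha
          exact hi a (by rw [u.2.unique (hg a) ha, h])
        simp [h, spell, this]
      · simp [h]
    rw [← Finset.insert_erase (Finset.mem_univ i),
      GrRep.cross_insert _ _ (Finset.notMem_erase i _), GrRep.act_killSet_cross_comm, hk, sub_self]

end PowellRows

/-! ### Tensor products with Powell's bimodule are analytic -/

section TensorAnalytic
open scoped TensorProduct DirectSum

theorem Bimod.tensor_ind {K : Type u} [CommRing K] {C D : Type} [Category.{u} C] [Preadditive C]
    [Linear K C] [Category.{u} D] [Preadditive D] [Linear K D] [DecidableEq D] (B : Bimod K C D)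
    {M : LinMod K D} {c : C} {P : B.TensorObj M c → Prop} (zero : P 0)
    (add : ∀ x y, P x → P y → P (x + y)) (tmul : ∀ d b y, P (B.tmul M c d b y)) (z) : P z := by
  obtain ⟨z, rfl⟩ := Submodule.mkQ_surjective _ z
  induction z using DirectSum.induction_on with
  | zero => rw [map_zero]; exact zero
  | add x y hx hy => rw [map_add]; exact add _ _ hx hy
  | of d z =>
    induction z using TensorProduct.induction_on with
    | zero => rw [map_zero, map_zero]; exact zero
    | add x y hx hy => rw [map_add, map_add]; exact add _ _ hx hy
    | tmul b y => exact tmul d b y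

variable {K : Type u} [CommRing K]

/-- An element `b ⊗ y` is the image of `b` under a morphism from a row, which has finite degree, and
finite sums only need the largest of these degrees. -/
theorem isAnalytic_tensor (M : LinMod K (CatLie K)) :
    IsAnalytic K ((powell K).tensorFunctor.obj M) := by
  rw [isAnalytic_iff]
  intro n x
  induction x using (powell K).tensor_ind with
  | zero => exact ⟨0, Submodule.zero_mem _⟩
  | add x y hx hy =>
    obtain ⟨D, hD⟩ := hx
    obtain ⟨D', hD'⟩ := hy
    exact ⟨max D D', Submodule.add_mem _ (GrRep.deg_mono (le_max_left _ _) hD)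
      (GrRep.deg_mono (le_max_right _ _) hD')⟩
  | tmul d b y =>
    exact ⟨d.arity, homAct_deg ((powell K).curryAt (𝟙 _) d y) (row_mem_deg b)⟩

end TensorAnalytic

/-! ### Left combs span the Lie operations -/

section Combs
variable (K : Type u) [CommRing K] {I β : Type} [Fintype I] [DecidableEq I] [DecidableEq β]

open Classical in
/-- The class modulo antisymmetry and IHX of a family of trees; it is zero if the leaves of the
trees are not in bijection with the letters. -/
noncomputable def treesMk (F : I → FreeMagma β) : (Forest I β →₀ K) ⧸ lieRelations K I β :=
  if h : EachOnce fun i => leaves (F i) then Submodule.mkQ _ (Finsupp.single ⟨F, h⟩ 1) else 0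

theorem treesMk_eq (F : Forest I β) :
    treesMk K F.1 = Submodule.mkQ (lieRelations K I β) (Finsupp.single F 1) := dif_pos F.2

theorem eachOnce_update_iff {w : I → List β} {p : I} {l l' : List β} (h : l.Perm l') :
    EachOnce (Function.update w p l) ↔ EachOnce (Function.update w p l') := by
  refine forall_congr' fun a => ?_
  rw [Finset.sum_congr rfl fun i _ => ?_]
  by_cases hi : i = p
  · subst hi; simp [h.count_eq]
  · simp [hi]

theorem leaves_update (F : I → FreeMagma β) (p : I) (t : FreeMagma β) :
    (fun i => leaves (Function.update F p t i)) =
      Function.update (fun i => leaves (F i)) p (leaves t) := by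
  funext i
  by_cases hi : i = p
  · subst hi; simp
  · simp [hi]

/-- The forest of trivial trees that renumbers the trees of a family. -/
def relabel {J : Type} [Fintype J] [DecidableEq J] (e : I ≃ J) : Forest I J :=
  ⟨fun i => FreeMagma.of (e i), EachOnce.singleton.map e.bijective⟩

/-- The relations are spanned by relators on forests indexed by some `Fin l`, followed by a
composition. A general index set is reduced to this by numbering it and composing with the
renumbering. -/
theorem isRelator_mem {r : Forest I β →₀ K} (hr : IsRelator K r) : r ∈ lieRelations K I β := by
  let e := Fintype.equivFin I
  have h : ∃ r' : Forest (Fin (Fintype.card I)) β →₀ K, IsRelator K r' ∧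
      r = Finsupp.lmapDomain K K (fun F => F.comp (relabel e)) r' := by
    have hs : ∀ F : Forest I β, ∃ F' : Forest (Fin (Fintype.card I)) β,
        (∀ j, F'.1 j = F.1 (e.symm j)) ∧ F'.comp (relabel e) = F := by
      intro F
      refine ⟨⟨fun j => F.1 (e.symm j), fun a => ?_⟩, fun j => rfl, Subtype.ext (funext fun i => ?_)⟩
      · rw [← F.2 a]
        exact Equiv.sum_comp e.symm fun i => (leaves (F.1 i)).count a
      · exact congrArg F.1 (e.symm_apply_apply i)
    cases hr with
    | as F F' p a b hF hF' h =>
      obtain ⟨G, hG, rfl⟩ := hs F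
      obtain ⟨G', hG', rfl⟩ := hs F'
      refine ⟨_, .as G G' (e p) a b ?_ ?_ fun i hi => ?_, ?_⟩
      · rw [hG, e.symm_apply_apply, hF]
      · rw [hG', e.symm_apply_apply, hF']
      · rw [hG, hG']
        exact h _ fun h => hi (by rw [← h, e.apply_symm_apply])
      · simp [Finsupp.mapDomain_add, Finsupp.mapDomain_single]
    | ihx F F' F'' p a b c hF hF' hF'' h h' =>
      obtain ⟨G, hG, rfl⟩ := hs F
      obtain ⟨G', hG', rfl⟩ := hs F'
      obtain ⟨G'', hG'', rfl⟩ := hs F''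
      refine ⟨_, .ihx G G' G'' (e p) a b c ?_ ?_ ?_ (fun i hi => ?_) fun i hi => ?_, ?_⟩
      · rw [hG, e.symm_apply_apply, hF]
      · rw [hG', e.symm_apply_apply, hF']
      · rw [hG'', e.symm_apply_apply, hF'']
      · rw [hG, hG']
        exact h _ fun h => hi (by rw [← h, e.apply_symm_apply])
      · rw [hG, hG'']
        exact h' _ fun h => hi (by rw [← h, e.apply_symm_apply])
      · simp [Finsupp.mapDomain_add, Finsupp.mapDomain_single]
  obtain ⟨r', hr', rfl⟩ := h
  exact Submodule.subset_span ⟨_, r', relabel e, hr', rfl⟩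

/-- Exchanging the factors does not change the multiset of leaves, so the default value zero occurs
on both sides at once. No condition on the leaves is needed. -/
theorem treesMk_antisymm (F : I → FreeMagma β) (p : I) (s t : FreeMagma β) :
    treesMk K (Function.update F p (s * t)) = -treesMk K (Function.update F p (t * s)) := by
  have hp := eachOnce_update_iff (w := fun i => leaves (F i)) (p := p)
    (List.perm_append_comm (l₁ := leaves s) (l₂ := leaves t))
  by_cases h : EachOnce fun i => leaves (Function.update F p (s * t) i)
  · have h' : EachOnce fun i => leaves (Function.update F p (t * s) i) := by
      rw [leaves_update] at h ⊢
      exact hp.1 h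
    rw [eq_neg_iff_add_eq_zero, treesMk, treesMk, dif_pos h, dif_pos h', ← map_add]
    refine (Submodule.Quotient.mk_eq_zero _).2 (isRelator_mem K (.as _ _ p s t ?_ ?_ ?_))
    · simp
    · simp
    · intro i hi; simp [hi]
  · have h' : ¬ EachOnce fun i => leaves (Function.update F p (t * s) i) := by
      rw [leaves_update] at h ⊢
      exact mt hp.2 h
    rw [treesMk, treesMk, dif_neg h, dif_neg h', neg_zero]

theorem treesMk_jacobi (F : I → FreeMagma β) (p : I) (a b c : FreeMagma β) :
    treesMk K (Function.update F p (a * b * c)) + treesMk K (Function.update F p (b * c * a)) +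
      treesMk K (Function.update F p (c * a * b)) = 0 := by
  have hp := eachOnce_update_iff (w := fun i => leaves (F i)) (p := p)
    (l := leaves (a * b * c)) (l' := leaves (b * c * a)) (by
      simpa using List.perm_append_comm (l₁ := leaves a) (l₂ := leaves b ++ leaves c))
  have hp' := eachOnce_update_iff (w := fun i => leaves (F i)) (p := p)
    (l := leaves (a * b * c)) (l' := leaves (c * a * b)) (by
      simpa using List.perm_append_comm (l₁ := leaves a ++ leaves b) (l₂ := leaves c))
  simp only [← leaves_update] at hp hp'
  by_cases h : EachOnce fun i => leaves (Function.update F p (a * b * c) i)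
  · rw [treesMk, treesMk, treesMk, dif_pos h, dif_pos (hp.1 h), dif_pos (hp'.1 h), ← map_add,
      ← map_add]
    refine (Submodule.Quotient.mk_eq_zero _).2 (isRelator_mem K (.ihx _ _ _ p a b c ?_ ?_ ?_ ?_ ?_))
    · simp
    · simp
    · simp
    · intro i hi; simp [hi]
    · intro i hi; simp [hi]
  · rw [treesMk, treesMk, treesMk, dif_neg h, dif_neg (mt hp.2 h), dif_neg (mt hp'.2 h)]
    simp

/-- The operation that joins the tree with index `none` to the tree with index `p`. -/
def joinForest (p : I) : Forest I (Option I) :=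
  ⟨fun i => if i = p then FreeMagma.of (some p) * FreeMagma.of none else FreeMagma.of (some i), by
    have : (fun i => leaves (if i = p then FreeMagma.of (some p) * FreeMagma.of none else
        FreeMagma.of (some i))) = splitLeft p := by
      funext i
      rw [splitLeft]
      split_ifs <;> rfl
    rw [this]
    exact splitLeft_eachOnce p⟩

variable (β) in
/-- The operation that joins the tree with index `none` to the tree with index `p`. -/
noncomputable def joinMap (p : I) :
    ((Forest (Option I) β →₀ K) ⧸ lieRelations K (Option I) β) →ₗ[K]
      ((Forest I β →₀ K) ⧸ lieRelations K I β) :=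
  Submodule.mapQ _ _ (Finsupp.lmapDomain K K fun F => F.comp (joinForest p))
    (lieRelations_comp_right _)

/-- Joining two trees is a linear map between spaces of families, so relations at the root of a
smaller tree become relations at an inner vertex. -/
theorem joinMap_treesMk (F : I → FreeMagma β) (p : I) (s t : FreeMagma β) :
    joinMap K β p (treesMk K fun o => o.elim t (Function.update F p s)) =
      treesMk K (Function.update F p (s * t)) := by
  have hF : (fun i => graft (fun o : Option I => o.elim t (Function.update F p s))
      ((joinForest p).1 i)) = Function.update F p (s * t) := by
    funext i
    by_cases hi : i = p
    · subst hi; simp [joinForest]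
    · simp [joinForest, hi]
  have he : EachOnce (fun o : Option I => leaves (o.elim t (Function.update F p s))) ↔
      EachOnce fun i => leaves (Function.update F p (s * t) i) := by
    refine forall_congr' fun a => ?_
    rw [Fintype.sum_option, ← Finset.add_sum_erase _ _ (Finset.mem_univ p),
      ← Finset.add_sum_erase Finset.univ (fun i => List.count a (leaves (Function.update F p (s * t) i)))
      (Finset.mem_univ p), Finset.sum_congr rfl (s₁ := Finset.univ.erase p)
        (g := fun i => List.count a (leaves (Function.update F p (s * t) i))) fun i hi => by
          simp [Finset.ne_of_mem_erase hi]]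
    simp only [Option.elim, Function.update_self, leaves_mul, List.count_append]
    constructor <;> intro h <;> omega
  by_cases h : EachOnce (fun o : Option I => leaves (o.elim t (Function.update F p s)))
  · have e := treesMk_eq K (⟨_, h⟩ : Forest (Option I) β)
    have e' := treesMk_eq K (⟨_, he.1 h⟩ : Forest I β)
    refine (congrArg _ e).trans (Eq.trans ?_ e'.symm)
    refine (Submodule.mapQ_apply _ _ _ _).trans ?_
    refine (congrArg (Submodule.mkQ _) (Finsupp.mapDomain_single)).trans ?_
    refine congrArg (fun F => Submodule.mkQ _ (Finsupp.single F 1)) (Subtype.ext hF)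
  · rw [treesMk, treesMk, dif_neg h, dif_neg (mt he.2 h), map_zero]

/-- The left comb `[…[[c, b₁], b₂], …]`. -/
def comb (c : FreeMagma β) (l : List β) : FreeMagma β := l.foldl (fun t b => t * FreeMagma.of b) c

theorem leaves_comb (c : FreeMagma β) (l : List β) : leaves (comb c l) = leaves c ++ l := by
  induction l generalizing c with
  | nil => exact (List.append_nil _).symm
  | cons b l ih =>
    refine (ih (c * FreeMagma.of b)).trans ?_
    simp

theorem comb_comb (c : FreeMagma β) (l l' : List β) : comb (comb c l) l' = comb c (l ++ l') :=
  List.foldl_append.symm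

theorem joinMap_update (F : I → FreeMagma β) (p : I) (t u : FreeMagma β) :
    joinMap K β p (treesMk K (Function.update (fun o : Option I => o.elim u F) (some p) t)) =
      treesMk K (Function.update F p (t * u)) := by
  rw [← joinMap_treesMk]
  congr 2
  funext o
  obtain _ | i := o
  · simp
  · by_cases hi : i = p
    · subst hi; simp
    · simp [hi]

/-- Rewriting the left subtree `s` of `s * u` is reduced to rewriting a root, by making `s` and `u`
separate trees and joining them again. -/
theorem treesMk_join_mem {F : I → FreeMagma β} {p : I} {s u : FreeMagma β} {P : FreeMagma β → Prop}
    (h : treesMk K (Function.update (fun o : Option I => o.elim u F) (some p) s) ∈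
      Submodule.span K {x | ∃ t, P t ∧
        x = treesMk K (Function.update (fun o : Option I => o.elim u F) (some p) t)}) :
    treesMk K (Function.update F p (s * u)) ∈
      Submodule.span K {x | ∃ t, P t ∧ x = treesMk K (Function.update F p (t * u))} := by
  have := Submodule.mem_map_of_mem (f := joinMap K β p) h
  rw [joinMap_update, Submodule.map_span] at this
  refine Submodule.span_mono ?_ this
  rintro _ ⟨_, ⟨t, ht, rfl⟩, rfl⟩
  exact ⟨t, ht, joinMap_update K F p t u⟩

/-- The Jacobi relation in the form `c (u v) = (c u) v - (c v) u` moves the vertices of the right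
factor to the spine, one at a time. -/
theorem treesMk_mul_mem (F : I → FreeMagma β) (p : I) (c u : FreeMagma β) :
    treesMk K (Function.update F p (c * u)) ∈ Submodule.span K
      {x | ∃ t, (∃ l : List β, l.Perm (leaves u) ∧ t = comb c l) ∧
        x = treesMk K (Function.update F p t)} := by
  induction u generalizing I c with
  | ih1 b => exact Submodule.subset_span ⟨_, ⟨[b], .refl _, rfl⟩, rfl⟩
  | ih2 u v hu hv =>
    have key : ∀ u v : FreeMagma β,
        (∀ {I : Type} [Fintype I] [DecidableEq I] (F : I → FreeMagma β) (p : I) (c : FreeMagma β),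
          treesMk K (Function.update F p (c * u)) ∈ Submodule.span K
            {x | ∃ t, (∃ l : List β, l.Perm (leaves u) ∧ t = comb c l) ∧
              x = treesMk K (Function.update F p t)}) →
        (∀ {I : Type} [Fintype I] [DecidableEq I] (F : I → FreeMagma β) (p : I) (c : FreeMagma β),
          treesMk K (Function.update F p (c * v)) ∈ Submodule.span K
            {x | ∃ t, (∃ l : List β, l.Perm (leaves v) ∧ t = comb c l) ∧
              x = treesMk K (Function.update F p t)}) →
        treesMk K (Function.update F p (c * u * v)) ∈ Submodule.span K
          {x | ∃ t, (∃ l : List β, l.Perm (leaves u ++ leaves v) ∧ t = comb c l) ∧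
            x = treesMk K (Function.update F p t)} := by
      intro u v hu hv
      refine Submodule.span_le.2 ?_ (treesMk_join_mem K (hu _ (some p) c))
      rintro _ ⟨_, ⟨l, hl, rfl⟩, rfl⟩
      refine Submodule.span_mono ?_ (hv F p (comb c l))
      rintro _ ⟨_, ⟨l', hl', rfl⟩, rfl⟩
      exact ⟨_, ⟨l ++ l', hl.append hl', comb_comb c l l'⟩, rfl⟩
    have h1 := key u v hu hv
    have h2 := key v u hv hu
    have hJ := treesMk_jacobi K F p c u v
    have e : treesMk K (Function.update F p (c * (u * v))) =
        treesMk K (Function.update F p (c * u * v)) -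
          treesMk K (Function.update F p (c * v * u)) := by
      -- Antisymmetry at an inner vertex, transported through `joinMap` from a root.
      have e2 : treesMk K (Function.update F p (v * c * u)) =
          -treesMk K (Function.update F p (c * v * u)) := by
        rw [← joinMap_update K F p (v * c) u, ← joinMap_update K F p (c * v) u,
          treesMk_antisymm K _ _ v c, map_neg]
      rw [e2, treesMk_antisymm K F p (u * v) c] at hJ
      rw [← sub_eq_zero, ← neg_eq_zero, ← hJ]
      abel
    rw [e]
    refine Submodule.sub_mem _ h1 ?_
    refine Submodule.span_mono ?_ h2
    rintro _ ⟨_, ⟨l, hl, rfl⟩, rfl⟩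
    exact ⟨_, ⟨l, hl.trans List.perm_append_comm, rfl⟩, rfl⟩

/-- Antisymmetry along the path from the root to the leaf `a` moves this leaf to the left end, and
the right factors along the path are flattened by `treesMk_mul_mem`. -/
theorem treesMk_mem_comb (F : I → FreeMagma β) (p : I) {t : FreeMagma β} {a : β}
    (ha : a ∈ leaves t) : treesMk K (Function.update F p t) ∈ Submodule.span K
      {x | ∃ t', (∃ l : List β, (a :: l).Perm (leaves t) ∧ t' = comb (FreeMagma.of a) l) ∧
        x = treesMk K (Function.update F p t')} := by
  induction t generalizing I with
  | ih1 b =>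
    obtain rfl : a = b := by simpa using ha
    exact Submodule.subset_span ⟨_, ⟨[], .refl _, rfl⟩, rfl⟩
  | ih2 s u hs hu =>
    have key : ∀ s u : FreeMagma β,
        (∀ {I : Type} [Fintype I] [DecidableEq I] (F : I → FreeMagma β) (p : I),
          treesMk K (Function.update F p s) ∈ Submodule.span K
            {x | ∃ t', (∃ l : List β, (a :: l).Perm (leaves s) ∧ t' = comb (FreeMagma.of a) l) ∧
              x = treesMk K (Function.update F p t')}) →
        treesMk K (Function.update F p (s * u)) ∈ Submodule.span K
          {x | ∃ t', (∃ l : List β, (a :: l).Perm (leaves s ++ leaves u) ∧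
            t' = comb (FreeMagma.of a) l) ∧ x = treesMk K (Function.update F p t')} := by
      intro s u hs
      refine Submodule.span_le.2 ?_ (treesMk_join_mem K (hs _ (some p)))
      rintro _ ⟨_, ⟨l, hl, rfl⟩, rfl⟩
      refine Submodule.span_mono ?_ (treesMk_mul_mem K F p (comb (FreeMagma.of a) l) u)
      rintro _ ⟨_, ⟨l', hl', rfl⟩, rfl⟩
      exact ⟨_, ⟨l ++ l', hl.append hl', comb_comb _ l l'⟩, rfl⟩
    rw [leaves_mul, List.mem_append] at ha
    rcases ha with ha | ha
    · exact key s u fun F p => hs F p ha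
    · rw [treesMk_antisymm]
      refine Submodule.neg_mem _ ?_
      refine Submodule.span_mono ?_ (key u s fun F p => hu F p ha)
      rintro _ ⟨_, ⟨l, hl, rfl⟩, rfl⟩
      exact ⟨_, ⟨l, hl.trans List.perm_append_comm, rfl⟩, rfl⟩

theorem treesMk_mem_combs (F : I → FreeMagma β) (a : I → β) (ha : ∀ i, a i ∈ leaves (F i)) :
    treesMk K F ∈ Submodule.span K {x | ∃ l : I → List β, (∀ i, (a i :: l i).Perm (leaves (F i))) ∧
      x = treesMk K fun i => comb (FreeMagma.of (a i)) (l i)} := by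
  have key : ∀ s : Finset I, treesMk K F ∈ Submodule.span K {x | ∃ G : I → FreeMagma β,
      (∀ i ∈ s, ∃ l, (a i :: l).Perm (leaves (F i)) ∧ G i = comb (FreeMagma.of (a i)) l) ∧
      (∀ i ∉ s, G i = F i) ∧ x = treesMk K G} := by
    intro s
    induction s using Finset.induction_on with
    | empty => exact Submodule.subset_span ⟨F, by simp, fun _ _ => rfl, rfl⟩
    | insert p s hp ih =>
      refine Submodule.span_le.2 ?_ ih
      rintro _ ⟨G, hG, hG', rfl⟩
      have h := treesMk_mem_comb K G p (t := G p) (a := a p) (by rw [hG' p hp]; exact ha p)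
      rw [Function.update_eq_self] at h
      refine Submodule.span_mono ?_ h
      rintro _ ⟨_, ⟨l, hl, rfl⟩, rfl⟩
      refine ⟨_, fun i hi => ?_, fun i hi => ?_, rfl⟩
      · by_cases hip : i = p
        · subst hip
          exact ⟨l, by rwa [hG' i hp] at hl, by simp⟩
        · obtain ⟨l', hl', e⟩ := hG i ((Finset.mem_insert.1 hi).resolve_left hip)
          exact ⟨l', hl', by simp [hip, e]⟩
      · rw [Finset.mem_insert, not_or] at hi
        simp [hi.1, hG' i hi.2]
  refine Submodule.span_mono ?_ (key Finset.univ)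
  rintro _ ⟨G, hG, -, rfl⟩
  choose l hl e using fun i => hG i (Finset.mem_univ i)
  exact ⟨l, hl, congrArg _ (funext e)⟩

/-- The left combs are triangular with respect to the words that start with the same letter. -/
theorem lieExp_comb [Fintype β] (a : β) {l : List β} (ha : a ∉ l) (l' : List β) :
    wordCoeff K (a :: l') (lieExp K (comb (FreeMagma.of a) l)) = if l = l' then 1 else 0 := by
  -- The comb minus its leading word contains no word starting with `a`. A new leaf `b` turns the
  -- comb `X` into `X b - b X`. Words of `b X` start with `b ≠ a`, and a word of `Y b` starting with
  -- `a` comes from one of `Y` with the same property.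
  have key : ∀ l : List β, a ∉ l → ∀ l', wordCoeff K (a :: l') (lieExp K (comb (FreeMagma.of a) l) -
      MonoidAlgebra.single (FreeMonoid.ofList (a :: l)) 1) = 0 := by
    intro l
    induction l using List.reverseRecOn with
    | nil =>
      intro _ l'
      rw [show comb (FreeMagma.of a) [] = FreeMagma.of a from rfl, lieExp_of]
      rw [show FreeMonoid.ofList [a] = FreeMonoid.of a from rfl, sub_self, map_zero]
    | append_singleton l b ih =>
      intro hab l'
      have ha : a ∉ l := fun h => hab (List.mem_append_left _ h)
      have hb : a ≠ b := fun h => hab (by simp [h])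
      set X := lieExp K (comb (FreeMagma.of a) l) with hX
      set Y := X - MonoidAlgebra.single (FreeMonoid.ofList (a :: l)) 1 with hY
      have hs : MonoidAlgebra.single (FreeMonoid.ofList (a :: (l ++ [b]))) (1 : K) =
          MonoidAlgebra.single (FreeMonoid.ofList (a :: l)) 1 *
            MonoidAlgebra.single (FreeMonoid.of b) 1 := by
        rw [MonoidAlgebra.single_mul_single, one_mul]; rfl
      have e : lieExp K (comb (FreeMagma.of a) (l ++ [b])) -
          MonoidAlgebra.single (FreeMonoid.ofList (a :: (l ++ [b]))) 1 =
            Y * MonoidAlgebra.single (FreeMonoid.of b) 1 -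
              MonoidAlgebra.single (FreeMonoid.of b) 1 * X := by
        rw [← comb_comb]
        show lieExp K (comb (FreeMagma.of a) l * FreeMagma.of b) - _ = _
        rw [lieExp_mul, lieExp_of, hs, hY, sub_mul]
        abel
      have hw : ∀ l, wordCoeff K l (MonoidAlgebra.single (FreeMonoid.of b) 1) ≠ 0 → l = [b] := by
        intro l hl
        have h := wordCoeff_single K l [b]
        rw [show FreeMonoid.ofList [b] = FreeMonoid.of b from rfl] at h
        rw [h] at hl
        exact (by_contra fun hne => hl (if_neg hne) : [b] = l).symm
      rw [e, map_sub, sub_eq_zero]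
      trans (0 : K)
      · by_contra hne
        obtain ⟨l₁, l₂, h, h₁, h₂⟩ := wordCoeff_mul_ne_zero K hne
        rw [hw _ h₂] at h
        obtain _ | ⟨c, l₁⟩ := l₁
        · exact hb (List.cons.inj h).1
        · rw [← (List.cons.inj h).1] at h₁
          exact h₁ (ih ha _)
      · by_contra hne
        obtain ⟨l₁, l₂, h, h₁, h₂⟩ := wordCoeff_mul_ne_zero K (Ne.symm hne)
        rw [hw _ h₁] at h
        exact hb (List.cons.inj h).1
  have h := key l ha l'
  rw [map_sub, sub_eq_zero] at h
  rw [h, wordCoeff_single]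
  simp

end Combs

/-! ### Unshuffles and sublists -/

section PrimitiveTuples
variable (K : Type u) [CommRing K] {I : Type} [Fintype I] [DecidableEq I] {n n' : ℕ}

/-- The homomorphism of free groups given by a partial map of the letters. -/
def partialHom (f : Fin n' → Option (Fin n)) : FreeGroup (Fin n') →* FreeGroup (Fin n) :=
  FreeGroup.lift fun k => (f k).elim 1 FreeGroup.of

/-- Each new word runs once along an old word or is empty. As all letters are positive and occur
once per word, the coefficient is `1` if every word of `w` is a sublist of the corresponding one,
and `0` otherwise. -/
theorem cableLin_partialHom (f : Fin n' → Option (Fin n)) (x : WordTuple I n →₀ K)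
    (w : WordTuple I n') : cableLin K (partialHom f) x w =
      ∑ u : WordTuple I n, if ∀ k, (w.1 k).Sublist ((f k).elim [] u.1) then x u else 0 := by
  rw [cableLin, Finsupp.linearCombination_apply, Finsupp.sum_fintype _ _ (by simp),
    Finsupp.finsetSum_apply]
  refine Finset.sum_congr rfl fun u _ => ?_
  have h : (fun k => FreeGroup.lift (spell u.1) (partialHom f (FreeGroup.of k))) =
      fun k => FreeGroup.mk (((f k).elim [] u.1).map fun a => (a, true)) := funext fun k => by
    rw [partialHom, FreeGroup.lift_apply_of]
    obtain _ | j := f k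
    · exact map_one _
    · exact FreeGroup.lift_apply_of.trans (list_prod_of _)
  have hn : ∀ k, ((f k).elim [] u.1).Nodup := fun k => by
    obtain _ | j := f k
    · exact List.nodup_nil
    · exact u.2.nodup j
  rw [Finsupp.smul_apply, cable, h, multilinearPart_apply, multCoeff_mk _ w.2]
  simp only [signedCount_positive (hn _)]
  split_ifs with hw
  · simp [hw]
  · push Not at hw
    obtain ⟨k, hk⟩ := hw
    rw [Finset.prod_eq_zero (Finset.mem_univ k) (if_neg hk)]
    simp

/-- Both tuples have as many letters in total as `I` has elements, so no sublist can be proper. -/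
theorem WordTuple.eq_of_sublist {u v : WordTuple I n} (h : ∀ k, (u.1 k).Sublist (v.1 k)) :
    u = v := by
  have h2 : ∑ k, (u.1 k).length = ∑ k, (v.1 k).length := by
    rw [u.2.sum_length, v.2.sum_length]
  have h3 := (Finset.sum_eq_sum_iff_of_le fun k _ => (h k).length_le).1 h2
  exact Subtype.ext (funext fun k => (h k).eq_of_length (h3 k (Finset.mem_univ k)))

/-- In a shuffle of `P` and `m :: Q`, only letters of `P` can precede `m`. If all of them do, the
shuffle is the concatenation; otherwise `m` has moved to the left. -/
theorem eq_or_idxOf_lt {L P Q : List I} {m : I} (hL : L.Nodup) (hP : P.Sublist L)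
    (hQ : (m :: Q).Sublist L) (h : L.Perm (P ++ m :: Q)) :
    L = P ++ m :: Q ∨ L.idxOf m < P.length := by
  obtain ⟨A, B, rfl, hA⟩ := List.append_of_mem (hQ.subset List.mem_cons_self) |>.elim
    fun A ⟨B, e⟩ => (⟨A, B, e, by
      rw [e] at hL
      exact fun hm => (List.disjoint_of_nodup_append hL) hm List.mem_cons_self⟩ :
      ∃ A B, L = A ++ m :: B ∧ m ∉ A)
  have hn := h.nodup_iff.1 hL
  have hQB : Q.Sublist B := by
    obtain ⟨l₁, l₂, e, h₁, h₂⟩ := List.sublist_append_iff.1 hQ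
    obtain _ | ⟨c, l₁⟩ := l₁
    · rw [List.nil_append] at e
      rw [← e] at h₂
      exact List.cons_sublist_cons.1 h₂
    · rw [List.cons_append, List.cons.injEq] at e
      exact absurd (h₁.subset (by rw [e.1]; exact List.mem_cons_self)) hA
  have hlen := h.length_eq
  simp only [List.length_append, List.length_cons] at hlen
  have hidx : (A ++ m :: B).idxOf m = A.length := by
    rw [List.idxOf_append_of_notMem hA, List.idxOf_cons_self, add_zero]
  rw [hidx]
  rcases Nat.lt_or_ge A.length P.length with hlt | hge
  · exact Or.inr hlt
  · left
    have hBQ := hQB.length_le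
    obtain rfl := hQB.eq_of_length (by omega)
    have hPA : P.Sublist A := by
      obtain ⟨l₁, l₂, rfl, h₁, h₂⟩ := List.sublist_append_iff.1 hP
      obtain _ | ⟨c, l₂⟩ := l₂
      · simpa using h₁
      · have hc : c ∈ m :: Q := h₂.subset List.mem_cons_self
        exact absurd hc fun hc => List.disjoint_of_nodup_append hn (by simp) hc
    rw [hPA.eq_of_length (by omega)]

end PrimitiveTuples

/-! ### Shuffle relations for primitive elements of a row -/

section PrimitiveRows
variable {K : Type u} [CommRing K] {d : CatLie K} {n : ℕ} {x : WordTuple (Fin d.arity) n →₀ K}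

/-- Primitivity tested on homomorphisms that send letters to letters or to `1`. The three composites
are of the same kind, so all terms can be computed by `cableLin_partialHom`. -/
theorem PrimMod.sum_eq_zero {a : Fin n}
    (hx : (grRep ((powell K).row d)).PrimMod (fun _ => ⊥) a (rowMk K d n x)) {n' : ℕ}
    (f : Fin n' → Option (Option (Fin n))) (w : WordTuple (Fin d.arity) n') :
    cableLin K (partialHom fun k => (f k).map fun o => o.getD a) x w =
      cableLin K (partialHom fun k => (f k).bind fun o => o) x w +
      cableLin K (partialHom fun k => (f k).bind fun o => o.elim (some a) fun i =>
        if i = a then none else some i) x w := by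
  have h := (Submodule.mem_bot K).1 (hx n'
    (FreeGroup.lift fun k => (f k).elim 1 FreeGroup.of))
  rw [row_act, row_act, row_act, ← map_sub, ← map_sub, LinearEquiv.map_eq_zero_iff, sub_sub,
    sub_eq_zero] at h
  have e1 : (subBoth a).comp (FreeGroup.lift fun k => (f k).elim 1 FreeGroup.of) =
      partialHom fun k => (f k).map fun o => o.getD a := by
    ext k
    simp only [partialHom, subBoth, MonoidHom.comp_apply, FreeGroup.lift_apply_of]
    rcases f k with _ | _ | i <;> simp
  have e2 : subKill.comp (FreeGroup.lift fun k => (f k).elim 1 FreeGroup.of) =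
      partialHom fun k => (f k).bind fun o => o := by
    ext k
    simp only [partialHom, subKill, MonoidHom.comp_apply, FreeGroup.lift_apply_of]
    rcases f k with _ | _ | i <;> simp
  have e3 : (subMove a).comp (FreeGroup.lift fun k => (f k).elim 1 FreeGroup.of) =
      partialHom fun k => (f k).bind fun o => o.elim (some a) fun i =>
        if i = a then none else some i := by
    ext k
    simp only [partialHom, subMove, MonoidHom.comp_apply, FreeGroup.lift_apply_of]
    rcases f k with _ | _ | i
    · simp
    · simp
    · by_cases hi : i = a <;> simp [hi]
  rw [e1, e2, e3] at h
  rw [h, Finsupp.add_apply]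

theorem PrimMod.apply_eq_zero_of_nil {a : Fin n}
    (hx : (grRep ((powell K).row d)).PrimMod (fun _ => ⊥) a (rowMk K d n x))
    {u : WordTuple (Fin d.arity) n} (hu : u.1 a = []) : x u = 0 := by
  -- If the new letter is not used, the first two terms coincide, and the third one must vanish. It
  -- kills the letter `a`, which does no harm to a tuple whose `a`-th word is empty.
  have h := PrimMod.sum_eq_zero hx (fun k => some (some k)) u
  simp only [Option.map_some, Option.getD_some, Option.bind_some, Option.elim_some,
    left_eq_add] at h
  rw [cableLin_partialHom, Finset.sum_eq_single u, if_pos] at h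
  · exact h
  · intro k
    by_cases hk : k = a
    · rw [hk, hu]; exact List.nil_sublist _
    · rw [if_neg hk]; exact List.Sublist.refl _
  · intro v _ hv
    refine if_neg fun hs => hv (WordTuple.eq_of_sublist fun k => ?_).symm
    by_cases hk : k = a
    · rw [hk, hu]; exact List.nil_sublist _
    · have := hs k
      rwa [if_neg hk] at this
  · simp

/-- The shuffle relations between the coefficients of a primitive element. -/
theorem PrimMod.shuffle {a : Fin n}
    (hx : (grRep ((powell K).row d)).PrimMod (fun _ => ⊥) a (rowMk K d n x))
    {u : WordTuple (Fin d.arity) n} {P Q : List (Fin d.arity)} (hu : u.1 a = P ++ Q)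
    (hP : P ≠ []) (hQ : Q ≠ []) :
    (∑ v : WordTuple (Fin d.arity) n, if P.Sublist (v.1 a) ∧ Q.Sublist (v.1 a) ∧
      ∀ k, k ≠ a → (u.1 k).Sublist (v.1 k) then x v else 0) = 0 := by
  -- The word at `a` is cut in two: `P` stays at `a`, now at the place `a.succ`, and `Q` goes to the
  -- new letter at the place `0`.
  let w : WordTuple (Fin d.arity) (n + 1) :=
    ⟨fun k => (finSuccEquiv n k).elim Q fun i => if i = a then P else u.1 i, fun b => by
      rw [Equiv.sum_comp (finSuccEquiv n) fun o =>
        List.count b (o.elim Q fun i => if i = a then P else u.1 i), Fintype.sum_option, ← u.2 b,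
        ← Finset.add_sum_erase _ _ (Finset.mem_univ a),
        ← Finset.add_sum_erase Finset.univ (fun k => List.count b (u.1 k)) (Finset.mem_univ a),
        Finset.sum_congr rfl (s₁ := Finset.univ.erase a)
          (g := fun k => List.count b (u.1 k)) fun i hi => by
            simp [Finset.ne_of_mem_erase hi]]
      simp only [Option.elim, if_true, hu, List.count_append]
      omega⟩
  have w0 : w.1 0 = Q := by simp [w]
  have wa : w.1 a.succ = P := by simp [w]
  have wi : ∀ i, i ≠ a → w.1 i.succ = u.1 i := fun i hi => by simp [w, hi]
  have h := PrimMod.sum_eq_zero hx (fun k => some (finSuccEquiv n k)) w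
  -- The terms with one copy removed vanish: the nonempty word `Q`, or `P`, would have to be a
  -- sublist of the empty word.
  have h1 : cableLin K (partialHom fun k => (some (finSuccEquiv n k)).bind fun o => o) x w = 0 := by
    rw [cableLin_partialHom]
    refine Finset.sum_eq_zero fun v _ => if_neg fun hs => hQ ?_
    simpa [w0] using hs 0
  have h2 : cableLin K (partialHom fun k => (some (finSuccEquiv n k)).bind fun o =>
      o.elim (some a) fun i => if i = a then none else some i) x w = 0 := by
    rw [cableLin_partialHom]
    refine Finset.sum_eq_zero fun v _ => if_neg fun hs => hP ?_
    simpa [wa] using hs a.succ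
  rw [h1, h2, cableLin_partialHom, add_zero] at h
  refine Eq.trans (Finset.sum_congr rfl fun v _ => if_congr ?_ rfl rfl) h
  rw [Fin.forall_fin_succ]
  simp only [finSuccEquiv_zero, finSuccEquiv_succ, Option.map_some, Option.getD_none,
    Option.getD_some, Option.elim_some]
  constructor
  · rintro ⟨h1, h2, h3⟩
    refine ⟨w0 ▸ h2, fun i => ?_⟩
    by_cases hi : i = a
    · rw [hi, wa]; exact h1
    · rw [wi i hi]; exact h3 i hi
  · rintro ⟨h1, h2⟩
    exact ⟨wa ▸ h2 a, w0 ▸ h1, fun i hi => wi i hi ▸ h2 i⟩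

/-- A primitive element is determined by its coefficients at the tuples of words with given
first letters. -/
theorem PrimMod.apply_eq_zero
    (hx : ∀ a, (grRep ((powell K).row d)).PrimMod (fun _ => ⊥) a (rowMk K d n x))
    (M : Fin n → Fin d.arity) (u₀ : WordTuple (Fin d.arity) n)
    (h0 : ∀ u : WordTuple (Fin d.arity) n, (∀ k b, b ∈ u.1 k ↔ b ∈ u₀.1 k) →
      (∀ k, ∃ l, u.1 k = M k :: l) → x u = 0) (hM : ∀ k, M k ∈ u₀.1 k) : x u₀ = 0 := by
  -- Induction on the total distance of the letters `M k` from the fronts of their words. If `M a`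
  -- is not in front, cut the word before it: in the resulting shuffle relation every other term has
  -- `M a` further to the left.
  have key : ∀ N : ℕ, ∀ u : WordTuple (Fin d.arity) n, (∀ k b, b ∈ u.1 k ↔ b ∈ u₀.1 k) →
      ∑ k, (u.1 k).idxOf (M k) = N → x u = 0 := by
    intro N
    induction N using Nat.strong_induction_on with
    | _ N ih =>
      intro u hu hN
      by_cases hh : ∀ k, ∃ l, u.1 k = M k :: l
      · exact h0 u hu hh
      · push Not at hh
        obtain ⟨a, ha⟩ := hh
        obtain ⟨P, Q, e⟩ := List.append_of_mem ((hu a _).2 (hM a))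
        have hP : P ≠ [] := by
          rintro rfl
          exact ha _ e
        have hs := PrimMod.shuffle (hx a) e hP (List.cons_ne_nil _ _)
        have hMP : M a ∉ P := fun hm => by
          have := u.2.nodup a
          rw [e] at this
          exact List.disjoint_of_nodup_append this hm List.mem_cons_self
        rw [Finset.sum_eq_single u, if_pos] at hs
        · exact hs
        · exact ⟨by rw [e]; exact List.sublist_append_left _ _,
            by rw [e]; exact List.sublist_append_right _ _, fun k _ => List.Sublist.refl _⟩
        · intro v _ hv
          refine ite_eq_right_iff.2 ?_
          rintro ⟨h1, h2, h3⟩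
          -- All letters of the words of `u` occur in the corresponding words of `v`; as each letter
          -- occurs once in total, the words at each place are permutations of each other.
          have hsub : ∀ k b, b ∈ u.1 k → b ∈ v.1 k := by
            intro k b hb
            by_cases hk : k = a
            · subst hk
              rw [e, List.mem_append] at hb
              exact hb.elim (fun hb => h1.subset hb) fun hb => h2.subset hb
            · exact (h3 k hk).subset hb
          have hmem : ∀ k b, b ∈ v.1 k ↔ b ∈ u.1 k := by
            intro k b
            refine ⟨fun hb => ?_, hsub k b⟩
            obtain ⟨j, hj⟩ := u.2.exists_mem b
            rwa [← v.2.unique (hsub j b hj) hb]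
          have hperm : ∀ k, (v.1 k).Perm (u.1 k) := fun k =>
            (List.perm_ext_iff_of_nodup (v.2.nodup k) (u.2.nodup k)).2 (hmem k)
          have heq : ∀ k, k ≠ a → v.1 k = u.1 k := fun k hk =>
            ((h3 k hk).eq_of_length (hperm k).length_eq.symm).symm
          have hpa := hperm a
          rw [e] at hpa
          rcases eq_or_idxOf_lt (v.2.nodup a) h1 h2 hpa with h | h
          · refine absurd (Subtype.ext (funext fun k => ?_)) hv
            by_cases hk : k = a
            · rw [hk, h, e]
            · exact heq k hk
          · refine ih _ ?_ v (fun k b => (hmem k b).trans (hu k b)) rfl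
            rw [← hN]
            refine Finset.sum_lt_sum (fun k _ => ?_) ⟨a, Finset.mem_univ _, ?_⟩
            · by_cases hk : k = a
              · subst hk
                refine h.le.trans ?_
                rw [e, List.idxOf_append_of_notMem hMP]
                omega
              · rw [heq k hk]
            · refine h.trans_le ?_
              rw [e, List.idxOf_append_of_notMem hMP]
              omega
        · simp
  exact key _ u₀ (fun _ _ => Iff.rfl) rfl

end PrimitiveRows

/-! ### Lie operations are the primitive elements -/

section LieRetraction
variable (K : Type u) [CommRing K] {m n : ℕ}

/-- Each of the words starts with its smallest letter. -/
def IsStandard (w : WordTuple (Fin m) n) : Prop := ∀ k, ∃ a l, w.1 k = a :: l ∧ ∀ b ∈ l, a < b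

/-- The left combs with given words as leaves. -/
def combForest (w : WordTuple (Fin m) n) (h : ∀ k, w.1 k ≠ []) : Forest (Fin n) (Fin m) :=
  ⟨fun k => comb (FreeMagma.of ((w.1 k).head (h k))) (w.1 k).tail, by
    have : (fun k => leaves (comb (FreeMagma.of ((w.1 k).head (h k))) (w.1 k).tail)) = w.1 := by
      funext k
      rw [leaves_comb, leaves_of]
      exact List.cons_head_tail (h k)
    rw [this]
    exact w.2⟩

theorem IsStandard.ne_nil {w : WordTuple (Fin m) n} (h : IsStandard w) (k : Fin n) :
    w.1 k ≠ [] := by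
  obtain ⟨a, l, e, -⟩ := h k
  simp [e]

open Classical in
/-- A left inverse of the map from the operations of Lie algebras to those of associative
algebras. -/
noncomputable def lieRetract (m n : ℕ) : (WordTuple (Fin m) n →₀ K) →ₗ[K] LieTrees K m n :=
  Finsupp.linearCombination K fun w =>
    if h : IsStandard w then lieMk K (combForest w h.ne_nil) else 0

/-- For equal first letters this is the triangularity of combs. For different first letters, a
nonzero coefficient would force both words to have the same letters, and each first letter would be
smaller than the other. -/
theorem forestExp_combForest {w w' : WordTuple (Fin m) n} (h : IsStandard w)
    (h' : IsStandard w') :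
    forestExp K (combForest w h.ne_nil) w' = if w = w' then 1 else 0 := by
  have hk : ∀ k, wordCoeff K (w'.1 k) (lieExp K ((combForest w h.ne_nil).1 k)) =
      if w.1 k = w'.1 k then 1 else 0 := by
    intro k
    obtain ⟨a, l, e, ha⟩ := h k
    obtain ⟨a', l', e', ha'⟩ := h' k
    have e1 : (combForest w h.ne_nil).1 k = comb (FreeMagma.of a) l := by
      simp only [combForest, e, List.head_cons, List.tail_cons]
    rw [e1]
    have hal : a ∉ l := fun hm => lt_irrefl _ (ha a hm)
    by_cases haa : a = a'
    · subst haa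
      rw [e, e', lieExp_comb K a hal]
      simp
    · rw [if_neg (by rw [e, e']; exact fun h => haa (List.cons.inj h).1)]
      by_contra hne
      have hp := lieExp_support K _ _ hne
      rw [leaves_comb, leaves_of, e'] at hp
      have h1 : a ∈ a' :: l' := hp.symm.subset (by simp)
      have h2 : a' ∈ a :: l := hp.subset (by simp)
      have h1' := ha' a ((List.mem_cons.1 h1).resolve_left haa)
      have h2' := ha a' ((List.mem_cons.1 h2).resolve_left (Ne.symm haa))
      exact lt_asymm h1' h2'
  rw [forestExp_apply, Finset.prod_congr rfl fun k _ => hk k]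
  split_ifs with hw
  · subst hw
    exact Finset.prod_eq_one fun k _ => if_pos rfl
  · obtain ⟨k, hk⟩ := Function.ne_iff.1 fun e => hw (Subtype.ext e)
    exact Finset.prod_eq_zero (Finset.mem_univ k) (if_neg hk)

theorem exists_min_mem {l : List (Fin m)} (h : l ≠ []) : ∃ a ∈ l, ∀ b ∈ l, a ≤ b := by
  obtain ⟨a, ha, hb⟩ := l.toFinset.exists_min_image id (by simpa using h)
  exact ⟨a, by simpa using ha, fun b hm => hb b (by simpa using hm)⟩

/-- In each tree, the smallest leaf is chosen as the beginning of the comb. -/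
theorem span_combForest : Submodule.span K {x | ∃ (w : WordTuple (Fin m) n) (h : IsStandard w),
    x = lieMk K (combForest w h.ne_nil)} = ⊤ := by
  refine eq_top_iff.2 fun x _ => ?_
  induction x using lie_ind with
  | zero => exact Submodule.zero_mem _
  | add x y hx hy => exact Submodule.add_mem _ (hx trivial) (hy trivial)
  | smul r x hx => exact Submodule.smul_mem _ r (hx trivial)
  | single F =>
    have hne : ∀ t : FreeMagma (Fin m), leaves t ≠ [] := by
      intro t
      induction t with
      | ih1 a => simp
      | ih2 s t hs ht => simp [hs]
    choose a ha hmin using fun k => exists_min_mem (hne (F.1 k))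
    have h := treesMk_mem_combs K F.1 a ha
    rw [treesMk_eq] at h
    refine Submodule.span_mono ?_ h
    rintro _ ⟨l, hl, rfl⟩
    have hE : EachOnce fun k => a k :: l k := fun b => by
      rw [← F.2 b]
      exact Finset.sum_congr rfl fun k _ => (hl k).count_eq b
    refine ⟨⟨_, hE⟩, fun k => ⟨a k, l k, rfl, fun b hb => ?_⟩, ?_⟩
    · refine lt_of_le_of_ne (hmin k b ((hl k).subset (List.mem_cons_of_mem _ hb))) ?_
      rintro rfl
      exact (List.nodup_cons.1 (hE.nodup k)).1 hb
    · exact treesMk_eq K (combForest ⟨_, hE⟩ fun k => List.cons_ne_nil _ _)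

/-- On the spanning standard combs, the coefficients at standard words form a unit matrix. In
particular the expansion of Lie operations into words is injective. -/
theorem lieRetract_lieExpand (f : LieTrees K m n) :
    lieRetract K m n (lieExpand K m n f) = f := by
  have hf : f ∈ Submodule.span K {x | ∃ (w : WordTuple (Fin m) n) (h : IsStandard w),
    x = lieMk K (combForest w h.ne_nil)} := by rw [span_combForest]; trivial
  induction hf using Submodule.span_induction with
  | zero => rw [map_zero, map_zero]
  | add x y _ _ hx hy => rw [map_add, map_add, hx, hy]
  | smul r x _ hx => rw [map_smul, map_smul, hx]
  | mem x hx =>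
    obtain ⟨w, h, rfl⟩ := hx
    rw [lieExpand_mk, lieRetract, Finsupp.linearCombination_apply,
      Finsupp.sum_fintype _ _ (by simp), Finset.sum_eq_single w]
    · rw [forestExp_combForest K h h, dif_pos h, if_pos rfl, one_smul]
    · intro w' _ hw
      by_cases h' : IsStandard w'
      · rw [forestExp_combForest K h h', if_neg (Ne.symm hw), zero_smul]
      · rw [dif_neg h', smul_zero]
    · simp

theorem lieExpand_lieRetract_apply (x : WordTuple (Fin m) n →₀ K) {w : WordTuple (Fin m) n}
    (hw : IsStandard w) : lieExpand K m n (lieRetract K m n x) w = x w := by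
  rw [lieRetract, Finsupp.linearCombination_apply, Finsupp.sum_fintype _ _ (by simp), map_sum,
    Finsupp.finsetSum_apply, Finset.sum_eq_single w]
  · rw [dif_pos hw, map_smul, lieExpand_mk, Finsupp.smul_apply, forestExp_combForest K hw hw,
      if_pos rfl, smul_eq_mul, mul_one]
  · intro v _ hv
    by_cases h : IsStandard v
    · rw [dif_pos h, map_smul, lieExpand_mk, Finsupp.smul_apply, forestExp_combForest K h hw,
        if_neg hv, smul_zero]
    · rw [dif_neg h, smul_zero, map_zero, Finsupp.zero_apply]
  · simp

/-- Precomposition with a Lie operation is a morphism between rows. It maps the generator, which is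
primitive, to the expansion of the operation. -/
theorem lieExpand_primMod {d : CatLie K} (f : LieTrees K d.arity n) (a : Fin n) :
    (grRep ((powell K).row d)).PrimMod (fun _ => ⊥) a (rowMk K d n (lieExpand K d.arity n f)) := by
  let d' : CatLie K := ⟨n⟩
  let g : d ⟶ d' := f
  have e : homAct ((powell K).rows.map g).unop n (rowGen K d') =
      rowMk K d n (lieExpand K d.arity n f) :=
    congrArg (rowMk K d n) (Category.comp_id ((lieToAss K).map g))
  rw [← e]
  exact homAct_primMod _ (rowGen_primMod K d' a)

/-- The primitive elements are the Lie operations. -/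
theorem lieExpand_lieRetract {d : CatLie K} {x : WordTuple (Fin d.arity) n →₀ K}
    (hx : ∀ a, (grRep ((powell K).row d)).PrimMod (fun _ => ⊥) a (rowMk K d n x)) :
    lieExpand K d.arity n (lieRetract K d.arity n x) = x := by
  -- The difference to the retracted Lie operation is primitive, and vanishes at all tuples of
  -- standard words. The shuffle relations extend this to all tuples without empty words, and tuples
  -- with an empty word have coefficient zero anyway.
  have hy : ∀ a, (grRep ((powell K).row d)).PrimMod (fun _ => ⊥) a
      (rowMk K d n (x - lieExpand K d.arity n (lieRetract K d.arity n x))) := by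
    intro a n' h
    rw [map_sub, map_sub, map_sub, map_sub]
    have h1 := (Submodule.mem_bot K).1 (hx a n' h)
    have h2 := (Submodule.mem_bot K).1 (lieExpand_primMod K (lieRetract K d.arity n x) a n' h)
    rw [Submodule.mem_bot, ← sub_eq_zero.2 (h1.trans h2.symm)]
    abel
  suffices h : ∀ u, (x - lieExpand K d.arity n (lieRetract K d.arity n x)) u = 0 by
    ext u
    exact (sub_eq_zero.1 (h u)).symm
  intro u
  by_cases hu : ∀ k, u.1 k ≠ []
  · choose M hM hmin using fun k => exists_min_mem (hu k)
    refine PrimMod.apply_eq_zero hy M u (fun v hv hv' => ?_) hM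
    rw [Finsupp.sub_apply, lieExpand_lieRetract_apply, sub_self]
    intro k
    obtain ⟨l, e⟩ := hv' k
    refine ⟨M k, l, e, fun b hb => lt_of_le_of_ne (hmin k b ((hv k b).1 ?_)) ?_⟩
    · rw [e]; exact List.mem_cons_of_mem _ hb
    · rintro rfl
      have := v.2.nodup k
      rw [e] at this
      exact (List.nodup_cons.1 this).1 hb
  · push Not at hu
    obtain ⟨a, ha⟩ := hu
    exact PrimMod.apply_eq_zero_of_nil (hy a) ha

end LieRetraction

/-! ### Unit and counit for Powell's bimodule -/

section Equivalence
variable {K : Type u} [Field K] [CharZero K]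

theorem isIso_of_bijective {K : Type u} [CommRing K] {C : Type} [Category.{u} C] [Preadditive C]
    [Linear K C] {M M' : LinMod K C} (f : M ⟶ M')
    (h : ∀ c, Function.Bijective (f.hom.app c)) : IsIso f := by
  have h1 : ∀ c, IsIso (f.hom.app c) := fun c => (ConcreteCategory.isIso_iff_bijective _).2 (h c)
  have h2 : IsIso f.hom := NatIso.isIso_of_isIso_app _
  have : IsIso ((IsLinear K C).ι.map f) := h2
  exact isIso_of_reflects_iso f (IsLinear K C).ι

/-- The Lie operation that is the primitive part of an element of a row. -/
noncomputable def primPart (d : CatLie K) (n : ℕ) :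
    ((powell K).row d).obj.obj (Free.of K (GrOp.mk n)) →ₗ[K] LieTrees K d.arity n :=
  (lieRetract K d.arity n).comp ((rowMk K d n).symm.toLinearMap.comp
    ((grRep ((powell K).row d)).projAll d.arity n))

/-- The projection has primitive values, and these are expansions of Lie operations. Any `D` that
bounds the degree of the row gives the same value. -/
theorem projAll_row {d : CatLie K} {n D : ℕ} (hD : d.arity ≤ D)
    (b : ((powell K).row d).obj.obj (Free.of K (GrOp.mk n))) :
    (grRep ((powell K).row d)).projAll D n b =
      rowMk K d n (lieExpand K d.arity n (primPart d n b)) := by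
  rw [GrRep.projAll_eq_of_le hD (row_mem_deg b)]
  obtain ⟨x, hx⟩ := (rowMk K d n).surjective ((grRep ((powell K).row d)).projAll d.arity n b)
  have hp : ∀ a, (grRep ((powell K).row d)).PrimMod (fun _ => ⊥) a (rowMk K d n x) := by
    rw [hx]
    exact GrRep.projAll_primMod (row_mem_deg b)
  have e : primPart d n b = lieRetract K d.arity n x :=
    congrArg (lieRetract K d.arity n) ((congrArg (rowMk K d n).symm hx).symm.trans
      ((rowMk K d n).symm_apply_apply x))
  rw [e, lieExpand_lieRetract K hp, hx]

/-- The projection is natural, so it commutes with precomposition by `f`; the identity of Lie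
operations follows since their expansion is injective. The maximum of the arities bounds the degrees
of both rows. -/
theorem primPart_right {d' d : CatLie K} (f : d' ⟶ d) {n : ℕ}
    (b : ((powell K).row d).obj.obj (Free.of K (GrOp.mk n))) :
    primPart d' n (homAct ((powell K).rows.map f).unop n b) =
      lieComp K d'.arity d.arity n f (primPart d n b) := by
  have h := GrRep.map_projAll (R := grRep ((powell K).row d)) (R' := grRep ((powell K).row d'))
    (homAct ((powell K).rows.map f).unop) (homAct_act _) (max d'.arity d.arity) b
  rw [projAll_row (le_max_right _ _), projAll_row (le_max_left _ _)] at h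
  have h' : lieExpand K d'.arity n (lieComp K d'.arity d.arity n f (primPart d n b)) =
      lieExpand K d'.arity n (primPart d' n (homAct ((powell K).rows.map f).unop n b)) :=
    (lieExpand_comp K f (primPart d n b)).trans h
  exact (lieRetract_lieExpand K _).symm.trans
    ((congrArg (lieRetract K d'.arity n) h'.symm).trans (lieRetract_lieExpand K _))

theorem primPart_gen (d : CatLie K) : primPart d d.arity (rowGen K d) = 𝟙 d := by
  have h := projAll_row le_rfl (rowGen K d)
  rw [GrRep.projAll_eq_self (rowGen_primMod K d)] at h
  have h' : lieExpand K d.arity d.arity (primPart d d.arity (rowGen K d)) =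
      lieExpand K d.arity d.arity (lieMk K (Forest.id _)) := by
    rw [lieExpand_mk, forestExp_id]
    exact (rowMk K d d.arity).injective h.symm
  exact (lieRetract_lieExpand K _).symm.trans
    ((congrArg (lieRetract K d.arity d.arity) h').trans (lieRetract_lieExpand K _))

/-- The map `b ⊗ y ↦ M (primPart b) y`. -/
noncomputable def tensorRetract (M : LinMod K (CatLie K)) (n : ℕ) :
    (powell K).TensorObj M (Free.of K (GrOp.mk n)) →ₗ[K] M.obj.obj (CatLie.mk n) :=
  (powell K).tensorLift M _
    (fun d => LinearMap.mk₂ K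
      (fun (b : ((powell K).row d).obj.obj (Free.of K (GrOp.mk n))) (y : M.obj.obj d) =>
        M.obj.map (X := d) (Y := CatLie.mk n) (primPart d n b) y)
      (fun b b' y => by
        refine (congrArg (fun g => M.obj.map (X := d) (Y := CatLie.mk n) g y)
          (map_add (primPart d n) b b')).trans ?_
        exact congrArg (fun f => f y) (M.map_add (c := d) (c' := CatLie.mk n) _ _))
      (fun r b y => by
        refine (congrArg (fun g => M.obj.map (X := d) (Y := CatLie.mk n) g y)
          (map_smul (primPart d n) r b)).trans ?_
        exact congrArg (fun f => f y) (M.map_smul (c := d) (c' := CatLie.mk n) _ _))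
      (fun b y y' => map_add _ _ _) (fun r b y => map_smul _ _ _))
    fun d' d f b y => by
      refine (congrArg (fun g => M.obj.map (X := d') (Y := CatLie.mk n) g y)
        (primPart_right f b)).trans ?_
      exact congrArg (fun g => g y) (M.obj.map_comp f (Y := d) (Z := CatLie.mk n) (primPart d n b))

/-- The primitive part of the generator is the identity operation. Consequently `y` can be recovered
from its tensor product with the generator, which gives injectivity of the unit. -/
theorem tensorRetract_gen (M : LinMod K (CatLie K)) (d : CatLie K) (y : M.obj.obj d) :
    tensorRetract M d.arity ((powell K).tmul M (Free.of K ⟨d.arity⟩) d (rowGen K d) y) = y := by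
  refine ((powell K).tensorLift_tmul M _ _ _ d (rowGen K d) y).trans ?_
  refine (congrArg (fun g => M.obj.map (X := d) (Y := d) g y) (primPart_gen d)).trans ?_
  exact congrArg (fun g => g y) (M.obj.map_id d)

/-- The generator of a row, tensored with elements of a module. -/
noncomputable def genTensor (M : LinMod K (CatLie K)) (d : CatLie K) (y : M.obj.obj d) :
    ((powell K).tensorFunctor.obj M).obj.obj (Free.of K (GrOp.mk d.arity)) :=
  (powell K).tmul M (Free.of K ⟨d.arity⟩) d (rowGen K d) y

/-- The projection acts on `b ⊗ y` through `b` and gives the expansion of a Lie operation, i.e. the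
generator acted upon by this operation, which can be moved across the tensor sign to `y`. A
primitive `z` is fixed by the projection. -/
theorem exists_genTensor {M : LinMod K (CatLie K)} {d : CatLie K}
    {z : ((powell K).tensorFunctor.obj M).obj.obj (Free.of K (GrOp.mk d.arity))}
    (hz : ∀ a, (grRep ((powell K).tensorFunctor.obj M)).PrimMod (fun _ => ⊥) a z) :
    ∃ y, z = genTensor M d y := by
  -- The threshold bounds the degrees of the rows that occur in some presentation of `z`; above it,
  -- one and the same `D` serves all summands.
  have key : ∀ z : (powell K).TensorObj M (Free.of K (GrOp.mk d.arity)), ∃ D₀, ∀ D, D₀ ≤ D →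
      ∃ y, (grRep ((powell K).tensorFunctor.obj M)).projAll D d.arity z = genTensor M d y := by
    intro z
    induction z using (powell K).tensor_ind with
    | zero =>
      refine ⟨0, fun D _ => ⟨0, ?_⟩⟩
      exact (map_zero _).trans (map_zero ((powell K).tmul M (Free.of K ⟨d.arity⟩) d _)).symm
    | add z z' hz hz' =>
      obtain ⟨D₁, h₁⟩ := hz
      obtain ⟨D₂, h₂⟩ := hz'
      refine ⟨max D₁ D₂, fun D hD => ?_⟩
      obtain ⟨y, hy⟩ := h₁ D (le_trans (le_max_left _ _) hD)
      obtain ⟨y', hy'⟩ := h₂ D (le_trans (le_max_right _ _) hD)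
      refine ⟨y + y', ?_⟩
      refine (map_add _ _ _).trans ((congrArg₂ _ hy hy').trans ?_)
      exact (map_add ((powell K).tmul M (Free.of K ⟨d.arity⟩) d _) y y').symm
    | tmul d' b y =>
      refine ⟨d'.arity, fun D hD => ⟨M.obj.map (X := d') (Y := d) (primPart d' d.arity b) y, ?_⟩⟩
      have h := GrRep.map_projAll (R := grRep ((powell K).row d'))
        (R' := grRep ((powell K).tensorFunctor.obj M))
        (homAct ((powell K).curryAt (𝟙 _) d' y)) (homAct_act _) D b
      refine h.symm.trans ((congrArg _ (projAll_row hD b)).trans ?_)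
      refine Eq.trans ?_ ((powell K).tmul_balance M (Free.of K ⟨d.arity⟩)
        (primPart d' d.arity b : d' ⟶ d) (rowGen K d) y)
      refine congrArg (fun b => (powell K).tmul M (Free.of K ⟨d.arity⟩) d' b y) ?_
      exact (congrArg (rowMk K d' d.arity) (Category.comp_id ((lieToAss K).map
        (primPart d' d.arity b : d' ⟶ d)))).symm
  obtain ⟨D, hD⟩ := key z
  obtain ⟨y, hy⟩ := hD D le_rfl
  exact ⟨y, (GrRep.projAll_eq_self hz D).symm.trans hy⟩

/-- A morphism from a row is determined by the image of the generator, which is primitive. In these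
terms the unit sends `y` to the generator tensored with `y`: it is injective by `tensorRetract_gen`
and surjective by `exists_genTensor`. -/
theorem isIso_unit_powell (M : LinMod K (CatLie K)) :
    IsIso ((powell K).homTensorAdj.unit.app M) := by
  rw [← Adjunction.homEquiv_id, Bimod.homTensorAdj_homEquiv]
  refine isIso_of_bijective _ fun d => ⟨fun y y' h => ?_, fun φ => ?_⟩
  · have h' : genTensor M d y = genTensor M d y' :=
      congrArg (fun φ : (powell K).row d ⟶ (powell K).tensorFunctor.obj M =>
        homAct φ d.arity (rowGen K d)) h
    exact (tensorRetract_gen M d y).symm.trans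
      ((congrArg (tensorRetract M d.arity) h').trans (tensorRetract_gen M d y'))
  · obtain ⟨y, hy⟩ := exists_genTensor (M := M) (d := d) fun a =>
      homAct_primMod (show (powell K).row d ⟶ (powell K).tensorFunctor.obj M from φ)
        (rowGen_primMod K d a)
    exact ⟨y, row_hom_ext hy.symm⟩

theorem Bimod.curry_uncurry {M : LinMod K (CatLie K)} {N : LinMod K (KGrOp K)}
    (B : Bimod K (KGrOp K) (CatLie K)) (g : M ⟶ B.homFunctor.obj N) : B.curry (B.uncurry g) = g := by
  rw [← Bimod.homTensorAdj_homEquiv]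
  refine (congrArg (B.homTensorAdj.homEquiv M N) ?_).trans
    ((B.homTensorAdj.homEquiv M N).apply_symm_apply g)
  simp [Bimod.homTensorAdj]

/-- The evaluation `b ⊗ φ ↦ φ b`. -/
noncomputable def rowEval (N : LinMod K (KGrOp K)) :
    (powell K).tensorFunctor.obj ((powell K).homFunctor.obj N) ⟶ N :=
  (powell K).uncurry (𝟙 _)

theorem counit_powell (N : LinMod K (KGrOp K)) :
    (powell K).homTensorAdj.counit.app N = rowEval N := by
  rw [← Adjunction.homEquiv_symm_id, Equiv.symm_apply_eq, Bimod.homTensorAdj_homEquiv, rowEval,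
    Bimod.curry_uncurry]

theorem rowEval_gen {N : LinMod K (KGrOp K)} (d : CatLie K) (φ : (powell K).row d ⟶ N) :
    homAct (rowEval N) d.arity (genTensor ((powell K).homFunctor.obj N) d φ) =
      homAct φ d.arity (rowGen K d) :=
  (powell K).uncurry_tmul (𝟙 ((powell K).homFunctor.obj N)) (Free.of K ⟨d.arity⟩) d (rowGen K d) φ

/-- The kernel is a subfunctor of an analytic functor, so it is enough that it has no nonzero
primitive elements. Such an element is the generator tensored with some `φ`, and evaluates to the
value of `φ` at the generator, which determines `φ`. -/
theorem rowEval_injective (N : LinMod K (KGrOp K)) (n : ℕ) :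
    Function.Injective (homAct (rowEval N) n) := by
  rw [injective_iff_map_eq_zero]
  intro z hz
  have hT : (grRep ((powell K).tensorFunctor.obj ((powell K).homFunctor.obj N))).IsStable
      fun n => LinearMap.ker (homAct (rowEval N) n) := by
    intro n n' φ x hx
    rw [LinearMap.mem_ker] at hx ⊢
    rw [homAct_act, hx, map_zero]
  refine (Submodule.mem_bot K).1 (GrRep.mem_of_primMod (GrRep.isStable_bot _) hT
    (fun n x _ => isAnalytic_iff.1 (isAnalytic_tensor _) n x) (fun n x hx hP => ?_) n z hz)
  obtain ⟨φ, rfl⟩ := exists_genTensor (d := CatLie.mk n) hP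
  have h0 := (rowEval_gen ⟨n⟩ φ).symm.trans hx
  have h1 : (show (powell K).row ⟨n⟩ ⟶ N from φ) = 0 := row_hom_ext h0
  rw [Submodule.mem_bot]
  refine (congrArg (genTensor ((powell K).homFunctor.obj N) ⟨n⟩) h1).trans ?_
  exact map_zero ((powell K).tmul ((powell K).homFunctor.obj N) (Free.of K ⟨n⟩) ⟨n⟩ _)

/-- Primitive elements are in the image because they define morphisms from rows. If `x` is only
primitive modulo the image, its projection is truly primitive and differs from `x` by an element of
the image. -/
theorem rowEval_surjective {N : LinMod K (KGrOp K)} (hN : IsAnalytic K N) (n : ℕ) :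
    Function.Surjective (homAct (rowEval N) n) := by
  have hS : (grRep N).IsStable fun n => LinearMap.range (homAct (rowEval N) n) := by
    rintro n n' φ _ ⟨z, rfl⟩
    exact ⟨_, homAct_act (rowEval N) φ z⟩
  intro x
  refine GrRep.mem_of_primMod hS (GrRep.isStable_top _) (fun n x _ => isAnalytic_iff.1 hN n x)
    (fun n x _ hP => ?_) n x trivial
  obtain ⟨D, hD⟩ := isAnalytic_iff.1 hN n x
  have hx' := GrRep.projAll_primMod hD
  have h1 : (grRep N).projAll D n x ∈ LinearMap.range (homAct (rowEval N) n) :=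
    ⟨_, (rowEval_gen ⟨n⟩ (rowHom (d := CatLie.mk n) hx')).trans (rowHom_gen (d := CatLie.mk n) hx')⟩
  rw [← sub_sub_cancel ((grRep N).projAll D n x) x]
  exact Submodule.sub_mem _ h1 (GrRep.projAll_sub_mem hS hP D)

theorem isIso_counit_powell {N : LinMod K (KGrOp K)} (hN : IsAnalytic K N) :
    IsIso ((powell K).homTensorAdj.counit.app N) := by
  rw [counit_powell]
  exact isIso_of_bijective _ fun c =>
    ⟨rowEval_injective N (GrOp.rank c), rowEval_surjective hN (GrOp.rank c)⟩

end Equivalence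

end JacobiDiagrams

theorem mainTheorem8 (K : Type u) [Field K] [CharZero K] :
    -- composition with `i^{⊗ m}` is an isomorphism of modules over the PROP of associative
    -- algebras; it maps the basis of tuples of words to the basis of chord diagrams
    (∀ m n : ℕ, Function.Bijective (iStar K m n) ∧
      ∃ b : Module.Basis (WordTuple (Fin m) n) K (DiagSpace K m n),
        ∀ w, b w = diagMk K (chordDiagram w) ∧ iStar K m n (Finsupp.single w 1) = b w) ∧
    (∀ (m n p : ℕ) (f : Free.of K (AssOp.mk m) ⟶ Free.of K (AssOp.mk n))
      (g : Free.of K (AssOp.mk n) ⟶ Free.of K (AssOp.mk p)),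
      iStar K m p (f ≫ g) = (AL0 K).left ⟨m⟩ ((assToGr K).map g) (iStar K m n f)) ∧
    -- twisted by the signs `(-1) ^ m`, it is an isomorphism of bimodules, which identifies the
    -- two hom-tensor adjunctions
    (∃ e : BimodIso (powell K) (AL0 K),
      (∀ (m n : ℕ) (x : Free.of K (AssOp.mk m) ⟶ Free.of K (AssOp.mk n)),
        e.equiv ⟨m⟩ (Free.of K ⟨n⟩) x = (-1 : K) ^ m • iStar K m n x) ∧
      (∃ α : (powell K).tensorFunctor ≅ (AL0 K).tensorFunctor,
        ∀ (M : LinMod K (CatLie K)) (c : KGrOp K) (d : CatLie K) (b : (powell K).obj d c)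
          (y : M.obj.obj d),
          (α.hom.app M).hom.app c ((powell K).tmul M c d b y) =
            (AL0 K).tmul M c d (e.equiv d c b) y) ∧
      (∃ β : (powell K).homFunctor ≅ (AL0 K).homFunctor,
        ∀ (N : LinMod K (KGrOp K)) (d : CatLie K) (φ : (powell K).row d ⟶ N)
          (ψ : (AL0 K).row d ⟶ N), (β.hom.app N).hom.app d φ = ψ →
          ∀ (c : KGrOp K) (b : (powell K).obj d c),
            ψ.hom.app c (e.equiv d c b) = φ.hom.app c b)) ∧
    -- the hom-tensor adjunctions exist and restrict to equivalences with analytic functors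
    (powell K).InducesAnalyticEquivalence ∧ (AL0 K).InducesAnalyticEquivalence := by
  have hu := isIso_unit_powell (K := K)
  have hc := fun N hN => isIso_counit_powell (K := K) (N := N) hN
  refine ⟨fun m n => ⟨iStar_bijective K m n, exists_chord_basis K m n⟩,
    fun m n p f g => iStar_comp K f g,
    ⟨powellIso K, fun m n x => wordsToDiag_eq K x,
      ⟨(powellIso K).tensorIso, (powellIso K).tensorTrans_tmul⟩, ⟨(powellIso K).homIso, ?_⟩⟩,
    inducesAnalyticEquivalence_of_homTensorAdj (powell K) hu hc isAnalytic_tensor,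
    transfer_homTensorAdj (powellIso K) hu hc isAnalytic_tensor⟩
  intro N d φ ψ h c b
  subst h
  exact congrArg (φ.hom.app c) (((powellIso K).equiv d c).symm_apply_apply b)
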